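/- Let $\mathbb{E}$ be a virtual equipment, i.e. a virtual double category in which every object has a unit (a composite of the empty list of proarrows) and every proarrow $K$ has a restriction $K(f,g)$ along every compatible pair of vertical arrows $f,g$. Here a 2-cell $\mu\colon J_1,\dots,J_k\to J$ with identity vertical boundaries exhibits $J$ as the composite of $J_1,\dots,J_k$ if every 2-cell whose domain is a list containing $J_1,\dots,J_k$ as a consecutive sublist factors uniquely as $\psi(\mathrm{id},\dots,\mathrm{id},\mu,\mathrm{id},\dots,\mathrm{id})$. Let $\mathbf{VCat}(\mathbb{E})$ be the virtual double category of $\mathbb{E}$-enriched categories, functors, profunctors and morphisms of profunctors (families of 2-cells of $\mathbb{E}$ compatible with the actions, composed componentwise). For an object $A$ of $\mathbb{E}$ let $|A|$ be the $\mathbb{E}$-enriched category whose objects are the vertical arrows $f\colon X\to A$, with extent $X$, and whose hom from $f$ to $g$ is $A(f,g)$, the restriction of the unit of $A$ along $f$ and $g$ (equivalently, the composite of the companion of $f$ and the conjoint of $g$), with the induced identities and composition. For a profunctor $J\colon |A|\nrightarrow|B|$ let $\overline{J}=J(\mathrm{id}_A,\mathrm{id}_B)$, a proarrow $A\nrightarrow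 B$ of $\mathbb{E}$. Let $A,B,C$ be objects of $\mathbb{E}$, let $J\colon |A|\nrightarrow|B|$, $K\colon|B|\nrightarrow|C|$ and $L\colon|A|\nrightarrow|C|$ be profunctors, and let $\mu\colon J,K\to L$ be a morphism of profunctors that exhibits $L$ as the composite $JK$ in $\mathbf{VCat}(\mathbb{E})$. Then the component of $\mu$ at the identities, $$\overline{\mu}\colon J(\mathrm{id}_A,\mathrm{id}_B),\,K(\mathrm{id}_B,\mathrm{id}_C)\to L(\mathrm{id}_A,\mathrm{id}_C),$$ exhibits $\overline{L}=\overline{JK}$ as the composite of $\overline{J}$ and $\overline{K}$ in $\mathbb{E}$. In particular, this composite exists, and $\overline{JK}\cong\overline{J}\,\overline{K}$: whenever $\nu\colon\overline{J},\overline{K}\to P$ exhibits a proarrow $P$ as the composite of $\overline{J}$ and $\overline{K}$ in $\mathbb{E}$, there is an isomorphism $i\colon P\cong\overline{JK}$ with $i\circ\nu=\overline{\mu}$. -/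

import Mathlib

open CategoryTheory

set_option linter.checkUnivs false

universe u v w z x

/-! ## Virtual double categories -/

/-- Finite composable lists of proarrows, including the empty list at each object. -/
inductive ProPath {E : Type u} (H : E → E → Type w) : E → E → Type (max u w)
  | nil (X : E) : ProPath H X X
  | cons {X Y Z : E} (J : H X Y) (p : ProPath H Y Z) : ProPath H X Z

namespace ProPath

variable {E : Type u} {H : E → E → Type w}

/-- Concatenation of lists of proarrows. -/
def append : {X Y Z : E} → ProPath H X Y → ProPath H Y Z → ProPath H X Z
  | _, _, _, nil _, q => q
  | _, _, _, cons J p, q => cons J (p.append q)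

/-- The list consisting of one proarrow. -/
abbrev one {X Y : E} (J : H X Y) : ProPath H X Y := cons J (nil Y)

/-- The list consisting of two proarrows. -/
abbrev two {X Y Z : E} (J : H X Y) (K : H Y Z) : ProPath H X Z := cons J (one K)

/-- The list consisting of three proarrows. -/
abbrev three {X Y Z W : E} (J : H X Y) (K : H Y Z) (L : H Z W) : ProPath H X W :=
  cons J (two K L)

theorem append_nil {X Y : E} (p : ProPath H X Y) : p.append (nil Y) = p := by
  induction p with
  | nil => rfl
  | cons J p ih => exact congrArg (cons J) ih

theorem append_assoc {X Y Z W : E} (p : ProPath H X Y) (q : ProPath H Y Z)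
    (r : ProPath H Z W) : (p.append q).append r = p.append (q.append r) := by
  induction p with
  | nil => rfl
  | cons J p ih => exact congrArg (cons J) (ih q)

end ProPath

/-- The underlying data of a virtual double category on the objects and vertical arrows of the
category `E`: proarrows, and 2-cells whose horizontal domain is a list of proarrows,
whose vertical domain and codomain are arrows and whose horizontal codomain is a proarrow. -/
class VirtualDoubleGraph (E : Type u) [Category.{v} E] where
  /-- proarrows -/
  proarrow : E → E → Type w
  /-- 2-cells -/
  twoCell : {X Y Z W : E} → ProPath proarrow X Y → (X ⟶ Z) → (Y ⟶ W) → proarrow Z W → Type z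

section Graph

variable {E : Type u} [Category.{v} E] [VirtualDoubleGraph.{u, v, w, z} E]

/-- Proarrows `X ⇸ Y`. -/
abbrev Pro (X Y : E) : Type w := VirtualDoubleGraph.proarrow.{u, v, w, z} X Y

/-- Lists of proarrows of `E`. -/
abbrev Pros (X Y : E) : Type (max u w) :=
  ProPath (E := E) (fun X Y => VirtualDoubleGraph.proarrow.{u, v, w, z} X Y) X Y

/-- 2-cells. -/
abbrev Cell {X Y Z W : E} (p : Pros X Y) (f : X ⟶ Z) (g : Y ⟶ W) (K : Pro Z W) : Type z :=
  VirtualDoubleGraph.twoCell p f g K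

/-- Transport of a 2-cell along equalities of its vertical domain and codomain. -/
def Cell.cast {X Y Z W : E} {p : Pros X Y} {f f' : X ⟶ Z} {g g' : Y ⟶ W} {K : Pro Z W}
    (α : Cell p f g K) (hf : f = f') (hg : g = g') : Cell p f' g' K := by
  subst hf hg; exact α

/-- `CellPath p f g q`: horizontally composable lists of 2-cells `α₁, …, α_ℓ`. The bottom `q` is the
list of their codomains, the top `p` is the concatenation of their domains, `f` is the left
vertical boundary of the first one and `g` the right vertical boundary of the last one. -/
inductive CellPath : {X Y Z W : E} → Pros X Y → (X ⟶ Z) → (Y ⟶ W) → Pros Z W →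
    Type (max u v w z)
  | nil {X Z : E} (f : X ⟶ Z) : CellPath (.nil X) f f (.nil Z)
  | cons {X Y V X' Y' V' : E} {p : Pros X Y} {f : X ⟶ X'} {g : Y ⟶ Y'} {h : V ⟶ V'}
      {K : Pro X' Y'} {q : Pros Y V} {r : Pros Y' V'} {t : Pros X V}
      (α : Cell p f g K) (Γ : CellPath q g h r) (e : p.append q = t) :
      CellPath t f h (.cons K r)

namespace CellPath

/-- The list with a single 2-cell. -/
def single {X Y X' Y' : E} {p : Pros X Y} {f : X ⟶ X'} {g : Y ⟶ Y'} {K : Pro X' Y'}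
    (α : Cell p f g K) : CellPath p f g (.one K) :=
  cons α (nil g) p.append_nil

/-- The list with two 2-cells. -/
def pair {X Y V X' Y' V' : E} {p : Pros X Y} {f : X ⟶ X'} {g : Y ⟶ Y'} {h : V ⟶ V'}
    {K : Pro X' Y'} {L : Pro Y' V'} {q : Pros Y V} {t : Pros X V}
    (α : Cell p f g K) (β : Cell q g h L) (e : p.append q = t) : CellPath t f h (.two K L) :=
  cons α (single β) e

/-- Concatenation of lists of 2-cells. -/
def append : {X Y V X' Y' V' : E} → {p : Pros X Y} → {f : X ⟶ X'} → {g : Y ⟶ Y'} →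
    {q : Pros X' Y'} → {p' : Pros Y V} → {h : V ⟶ V'} → {q' : Pros Y' V'} →
    {t : Pros X V} → {m : Pros X' V'} →
    CellPath p f g q → CellPath p' g h q' → p.append p' = t → q.append q' = m →
    CellPath t f h m
  | _, _, _, _, _, _, _, _, _, _, _, _, _, _, _, nil _, Δ, e, e' => by
      cases e; cases e'; exact Δ
  | _, _, _, _, _, _, _, _, _, _, p', _, _, _, _, cons (p := p₁) (q := q₁) α Γ e₀, Δ, e, e' => by
      cases e'
      exact cons α (append Γ Δ rfl rfl)
        (by rw [← ProPath.append_assoc, e₀, e])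

end CellPath

/-- Two-level pastings: a list of pairs `(Γᵢ, αᵢ)`, where `αᵢ` is a 2-cell and `Γᵢ` is a list
of 2-cells whose codomains form the domain of `αᵢ`. The indices are the top list, the upper and
lower left boundaries, the upper and lower right boundaries, the middle list and the bottom list. -/
inductive Pasting : {X V X' V' X'' V'' : E} → Pros X V → (X ⟶ X') → (X' ⟶ X'') →
    (V ⟶ V') → (V' ⟶ V'') → Pros X' V' → Pros X'' V'' → Type (max u v w z)
  | nil {X X' X'' : E} (f : X ⟶ X') (f' : X' ⟶ X'') :
      Pasting (.nil X) f f' f f' (.nil X') (.nil X'')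
  | cons {X Y V X' Y' V' X'' Y'' V'' : E} {p₁ : Pros X Y} {p₂ : Pros Y V} {p : Pros X V}
      {f : X ⟶ X'} {f' : X' ⟶ X''} {g : Y ⟶ Y'} {g' : Y' ⟶ Y''} {h : V ⟶ V'} {h' : V' ⟶ V''}
      {m₁ : Pros X' Y'} {m₂ : Pros Y' V'} {m : Pros X' V'} {K : Pro X'' Y''} {r : Pros Y'' V''}
      (Γ : CellPath p₁ f g m₁) (α : Cell m₁ f' g' K) (N : Pasting p₂ g g' h h' m₂ r)
      (e : p₁.append p₂ = p) (e' : m₁.append m₂ = m) :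
      Pasting p f f' h h' m (.cons K r)

namespace Pasting

/-- The concatenation of all the lists `Γᵢ`. -/
def upper : {X V X' V' X'' V'' : E} → {p : Pros X V} → {f : X ⟶ X'} → {f' : X' ⟶ X''} →
    {h : V ⟶ V'} → {h' : V' ⟶ V''} → {m : Pros X' V'} → {r : Pros X'' V''} →
    Pasting p f f' h h' m r → CellPath p f h m
  | _, _, _, _, _, _, _, _, _, _, _, _, _, nil f _ => .nil f
  | _, _, _, _, _, _, _, _, _, _, _, _, _, cons Γ _ N e e' => Γ.append N.upper e e'

/-- The list of all the `αᵢ`. -/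
def lower : {X V X' V' X'' V'' : E} → {p : Pros X V} → {f : X ⟶ X'} → {f' : X' ⟶ X''} →
    {h : V ⟶ V'} → {h' : V' ⟶ V''} → {m : Pros X' V'} → {r : Pros X'' V''} →
    Pasting p f f' h h' m r → CellPath m f' h' r
  | _, _, _, _, _, _, _, _, _, _, _, _, _, nil _ f' => .nil f'
  | _, _, _, _, _, _, _, _, _, _, _, _, _, cons _ α N _ e' => .cons α N.lower e'

end Pasting

end Graph

/-- The operations of a virtual double category: identity 2-cells and multi-composition
`β(α₁, …, α_ℓ)`. -/
class VirtualDoubleOps (E : Type u) [Category.{v} E] extends VirtualDoubleGraph.{u, v, w, z} E where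
  /-- the identity 2-cell of a proarrow -/
  id₂ {X Y : E} (J : Pro X Y) : Cell (.one J) (𝟙 X) (𝟙 Y) J
  /-- composition of a 2-cell with a list of 2-cells above it -/
  comp₂ {X Y X' Y' Z W : E} {p : Pros X Y} {f : X ⟶ X'} {g : Y ⟶ Y'} {q : Pros X' Y'}
    {f' : X' ⟶ Z} {g' : Y' ⟶ W} {K : Pro Z W} (Γ : CellPath p f g q) (β : Cell q f' g' K) :
    Cell p (f ≫ f') (g ≫ g') K

section Ops

variable {E : Type u} [Category.{v} E] [VirtualDoubleOps.{u, v, w, z} E]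

/-- The identity 2-cell of a proarrow. -/
abbrev idCell {X Y : E} (J : Pro X Y) : Cell (.one J) (𝟙 X) (𝟙 Y) J := VirtualDoubleOps.id₂ J

/-- The composite `β(Γ)`, with its vertical boundaries rewritten along given equalities. -/
def paste {X Y X' Y' Z W : E} {p : Pros X Y} {f : X ⟶ X'} {g : Y ⟶ Y'} {q : Pros X' Y'}
    {f' : X' ⟶ Z} {g' : Y' ⟶ W} {K : Pro Z W} {h : X ⟶ Z} {k : Y ⟶ W}
    (Γ : CellPath p f g q) (β : Cell q f' g' K)
    (eh : f ≫ f' = h := by simp) (ek : g ≫ g' = k := by simp) : Cell p h k K :=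
  Cell.cast (VirtualDoubleOps.comp₂ Γ β) eh ek

/-- The list of identity 2-cells on a list of proarrows. -/
def CellPath.ids : {X Y : E} → (p : Pros X Y) → CellPath p (𝟙 X) (𝟙 Y) p
  | _, _, .nil X => .nil (𝟙 X)
  | _, _, .cons J p => .cons (idCell J) (CellPath.ids p) rfl

/-- The list of the composites `αᵢ(Γᵢ)` of a two-level pasting. -/
def Pasting.composite : {X V X' V' X'' V'' : E} → {p : Pros X V} → {f : X ⟶ X'} →
    {f' : X' ⟶ X''} → {h : V ⟶ V'} → {h' : V' ⟶ V''} → {m : Pros X' V'} → {r : Pros X'' V''} →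
    Pasting p f f' h h' m r → CellPath p (f ≫ f') (h ≫ h') r
  | _, _, _, _, _, _, _, _, _, _, _, _, _, .nil f f' => .nil (f ≫ f')
  | _, _, _, _, _, _, _, _, _, _, _, _, _, .cons Γ α N e _ =>
      .cons (VirtualDoubleOps.comp₂ Γ α) N.composite e

end Ops

/-- A virtual double category whose category of objects and vertical arrows is `E`. -/
class VirtualDoubleCategory (E : Type u) [Category.{v} E] extends
    VirtualDoubleOps.{u, v, w, z} E where
  /-- `β(id, …, id) = β` -/
  ids_paste {X Y Z W : E} {p : Pros X Y} {f : X ⟶ Z} {g : Y ⟶ W} {K : Pro Z W}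
    (β : Cell p f g K) : paste (CellPath.ids p) β = β
  /-- `id(α) = α` -/
  paste_id {X Y Z W : E} {p : Pros X Y} {f : X ⟶ Z} {g : Y ⟶ W} {K : Pro Z W}
    (α : Cell p f g K) : paste (CellPath.single α) (idCell K) = α
  /-- `β(α₁, …, α_k)(γ₁₁, …) = β(α₁(γ₁₁, …), …, α_k(γ_k₁, …))` -/
  paste_assoc {X V X' V' X'' V'' Z W : E} {p : Pros X V} {f : X ⟶ X'} {f' : X' ⟶ X''}
    {h : V ⟶ V'} {h' : V' ⟶ V''} {m : Pros X' V'} {r : Pros X'' V''}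
    (N : Pasting p f f' h h' m r) {f'' : X'' ⟶ Z} {h'' : V'' ⟶ W} {K : Pro Z W}
    (β : Cell r f'' h'' K) :
    paste N.upper (VirtualDoubleOps.comp₂ N.lower β) (by simp) (by simp) =
      VirtualDoubleOps.comp₂ N.composite β

section Equipment

variable {E : Type u} [Category.{v} E] [VirtualDoubleCategory.{u, v, w, z} E]

/-- The list of 2-cells `id, …, id, μ, id, …, id`. -/
def CellPath.whisker : {X Y Z W : E} → (l : Pros X Y) → {p : Pros Y Z} → {J : Pro Y Z} →
    (μ : Cell p (𝟙 Y) (𝟙 Z) J) → (r : Pros Z W) →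
    CellPath (l.append (p.append r)) (𝟙 X) (𝟙 W) (l.append (.cons J r))
  | _, _, _, _, .nil _, _, _, μ, r => .cons μ (CellPath.ids r) rfl
  | _, _, _, _, .cons H l, _, _, μ, r => .cons (idCell H) (CellPath.whisker l μ r) rfl

/-- The 2-cell `μ` exhibits `J` as the composite of the list of proarrows `p`. -/
def IsComposite {X Y : E} {p : Pros X Y} {J : Pro X Y} (μ : Cell p (𝟙 X) (𝟙 Y) J) : Prop :=
  ∀ {Z W Z' W' : E} (l : Pros Z X) (r : Pros Y W) (f : Z ⟶ Z') (g : W ⟶ W') (K : Pro Z' W')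
    (φ : Cell (l.append (p.append r)) f g K),
    ∃! ψ : Cell (l.append (.cons J r)) f g K, paste (CellPath.whisker l μ r) ψ = φ

/-- The 2-cell `χ` is cartesian, i.e. exhibits `P` as the restriction `K(f, g)`. -/
def IsCartesian {X Y Z W : E} {P : Pro X Y} {f : X ⟶ Z} {g : Y ⟶ W} {K : Pro Z W}
    (χ : Cell (.one P) f g K) : Prop :=
  ∀ {X' Y' : E} (s : X' ⟶ X) (t : Y' ⟶ Y) (p : Pros X' Y') (φ : Cell p (s ≫ f) (t ≫ g) K),
    ∃! ψ : Cell p s t P, paste (CellPath.single ψ) χ = φ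

/-- Isomorphisms between parallel proarrows, in the category whose morphisms are the
2-cells with one proarrow as domain and with identity vertical boundaries. -/
structure ProIso {X Y : E} (P Q : Pro X Y) where
  hom : Cell (.one P) (𝟙 X) (𝟙 Y) Q
  inv : Cell (.one Q) (𝟙 X) (𝟙 Y) P
  hom_inv : paste (CellPath.single hom) inv = idCell P
  inv_hom : paste (CellPath.single inv) hom = idCell Q

end Equipment

/-- A virtual equipment: a virtual double category with all units and all restrictions. -/
class VirtualEquipment (E : Type u) [Category.{v} E] extends
    VirtualDoubleCategory.{u, v, w, z} E where
  exists_unit (A : E) : ∃ (U : Pro A A) (η : Cell (.nil A) (𝟙 A) (𝟙 A) U), IsComposite η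
  exists_restriction {X Y Z W : E} (f : X ⟶ Z) (g : Y ⟶ W) (K : Pro Z W) :
    ∃ (P : Pro X Y) (χ : Cell (.one P) f g K), IsCartesian χ

/-! ## Auxiliary facts on pasting -/

section Lemmas

variable {E : Type u} [Category.{v} E] [VirtualDoubleCategory.{u, v, w, z} E]

theorem Cell.cast_cast {X Y Z W : E} {p : Pros X Y} {f f' f'' : X ⟶ Z} {g g' g'' : Y ⟶ W}
    {K : Pro Z W} (α : Cell p f g K) (hf : f = f') (hg : g = g') (hf' : f' = f'')
    (hg' : g' = g'') :
    Cell.cast (Cell.cast α hf hg) hf' hg' = Cell.cast α (hf.trans hf') (hg.trans hg') := by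
  subst hf hg hf' hg'; rfl

theorem CellPath.cons_heq {X Y V X' Y' V' : E} {p : Pros X Y} {f : X ⟶ X'} {g : Y ⟶ Y'}
    {h : V ⟶ V'} {K : Pro X' Y'} {q q' : Pros Y V} {r r' : Pros Y' V'} {t t' : Pros X V}
    (α : Cell p f g K) {Γ : CellPath q g h r} {Γ' : CellPath q' g h r'} (e : p.append q = t)
    (e' : p.append q' = t') (hq : q = q') (hr : r = r') (hΓ : HEq Γ Γ') :
    HEq (CellPath.cons α Γ e) (CellPath.cons α Γ' e') := by
  subst hq hr e e'; cases hΓ; rfl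

theorem CellPath.append_nil_heq {X Y X' Y' : E} {p : Pros X Y} {f : X ⟶ X'} {g : Y ⟶ Y'}
    {q : Pros X' Y'} (Γ : CellPath p f g q) {t : Pros X Y} {m : Pros X' Y'}
    (e : p.append (.nil Y) = t) (e' : q.append (.nil Y') = m) :
    HEq (Γ.append (.nil g) e e') Γ := by
  induction Γ with
  | nil f => cases e; cases e'; rfl
  | cons α Γ e₀ ih =>
    cases e'
    exact CellPath.cons_heq _ _ _ (ProPath.append_nil _) (ProPath.append_nil _) (ih rfl rfl)

theorem CellPath.append_nil {X Y X' Y' : E} {p : Pros X Y} {f : X ⟶ X'} {g : Y ⟶ Y'}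
    {q : Pros X' Y'} (Γ : CellPath p f g q) :
    Γ.append (.nil g) (ProPath.append_nil p) (ProPath.append_nil q) = Γ :=
  eq_of_heq (Γ.append_nil_heq _ _)

theorem paste_nil_paste {X X' X'' Z W : E} (f : X ⟶ X') (f' : X' ⟶ X'') {f'' : X'' ⟶ Z}
    {h'' : X'' ⟶ W} {K : Pro Z W} (β : Cell (.nil X'') f'' h'' K) {a : X' ⟶ Z} {b : X' ⟶ W}
    {c : X ⟶ Z} {d : X ⟶ W} {l : X ⟶ X''}
    (ha : f' ≫ f'' = a) (hb : f' ≫ h'' = b) (hc : f ≫ a = c) (hd : f ≫ b = d) (hl : f ≫ f' = l) :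
    paste (.nil f) (paste (.nil f') β ha hb) hc hd =
      paste (.nil l) β (by simp [← hl, ← hc, ← ha]) (by simp [← hl, ← hd, ← hb]) := by
  subst ha hb hl hc hd
  have := VirtualDoubleCategory.paste_assoc (Pasting.nil f f') β
  change Cell.cast _ _ _ = _ at this
  change Cell.cast _ _ _ = Cell.cast (VirtualDoubleOps.comp₂ (Pasting.nil f f').composite β) _ _
  rw [← this, Cell.cast_cast]
  rfl

theorem paste_single_paste {X V X' V' X'' V'' Z W : E} {p : Pros X V} {f : X ⟶ X'}
    {g : V ⟶ V'} {q : Pros X' V'} (Γ : CellPath p f g q) {f' : X' ⟶ X''} {g' : V' ⟶ V''}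
    {K : Pro X'' V''} (m : Cell q f' g' K) {f'' : X'' ⟶ Z} {g'' : V'' ⟶ W} {L : Pro Z W}
    (β : Cell (.one K) f'' g'' L) {a : X ⟶ X''} {b : V ⟶ V''} {c : X ⟶ Z} {d : V ⟶ W}
    {s : X' ⟶ Z} {t : V' ⟶ W} (ha : f ≫ f' = a) (hb : g ≫ g' = b) (hc : a ≫ f'' = c)
    (hd : b ≫ g'' = d) (hs : f' ≫ f'' = s) (ht : g' ≫ g'' = t) :
    paste (.single (paste Γ m ha hb)) β hc hd =
      paste Γ (paste (.single m) β hs ht) (by simp [← hs, ← hc, ← ha])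
        (by simp [← ht, ← hd, ← hb]) := by
  subst ha hb hc hd hs ht
  have := VirtualDoubleCategory.paste_assoc (Pasting.cons Γ m (.nil g g')
    (ProPath.append_nil _) (ProPath.append_nil _)) β
  simp only [Pasting.upper, CellPath.append_nil] at this
  exact this.symm

theorem paste_pair_paste {X Y V X' Y' V' X'' Y'' V'' Z W : E} {p₁ : Pros X Y} {p₂ : Pros Y V}
    {p : Pros X V} {f : X ⟶ X'} {g : Y ⟶ Y'} {h : V ⟶ V'} {q₁ : Pros X' Y'} {q₂ : Pros Y' V'}
    {q : Pros X' V'} (Γ : CellPath p₁ f g q₁) (Δ : CellPath p₂ g h q₂)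
    (e : p₁.append p₂ = p) (e' : q₁.append q₂ = q)
    {f' : X' ⟶ X''} {g' : Y' ⟶ Y''} {h' : V' ⟶ V''} {K : Pro X'' Y''} {L : Pro Y'' V''}
    (m : Cell q₁ f' g' K) (n : Cell q₂ g' h' L) {f'' : X'' ⟶ Z} {h'' : V'' ⟶ W} {M : Pro Z W}
    (β : Cell (.two K L) f'' h'' M) {a : X ⟶ X''} {b : Y ⟶ Y''} {c : V ⟶ V''} {i : X ⟶ Z}
    {j : V ⟶ W} {s : X' ⟶ Z} {t : V' ⟶ W} (ha : f ≫ f' = a) (hb : g ≫ g' = b)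
    (hc : h ≫ h' = c) (hi : a ≫ f'' = i) (hj : c ≫ h'' = j) (hs : f' ≫ f'' = s)
    (ht : h' ≫ h'' = t) :
    paste (.pair (paste Γ m ha hb) (paste Δ n hb hc) e) β hi hj =
      paste (Γ.append Δ e e') (paste (.pair m n e') β hs ht) (by simp [← hs, ← hi, ← ha])
        (by simp [← ht, ← hj, ← hc]) := by
  subst ha hb hc hi hj hs ht
  have := VirtualDoubleCategory.paste_assoc (Pasting.cons Γ m
    (.cons Δ n (.nil h h') (ProPath.append_nil _) (ProPath.append_nil _)) e e') β
  simp only [Pasting.upper, CellPath.append_nil] at this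
  exact this.symm

end Lemmas

/-! ## Units -/

section Units

variable {E : Type u} [Category.{v} E] [VirtualEquipment.{u, v, w, z} E]

/-- The unit proarrow of an object. -/
noncomputable def unitPro (A : E) : Pro A A :=
  (VirtualEquipment.exists_unit A).choose

/-- The 2-cell exhibiting the unit proarrow as the composite of the empty list. -/
noncomputable def unitCell (A : E) : Cell (.nil A) (𝟙 A) (𝟙 A) (unitPro A) :=
  (VirtualEquipment.exists_unit A).choose_spec.choose

theorem unitCell_isComposite (A : E) : IsComposite (unitCell A) :=
  (VirtualEquipment.exists_unit A).choose_spec.choose_spec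

/-- The canonical 2-cell `h_A, h_A → h_A`. -/
noncomputable def unitMul (A : E) :
    Cell (.two (unitPro A) (unitPro A)) (𝟙 A) (𝟙 A) (unitPro A) :=
  (unitCell_isComposite A (.nil A) (.one (unitPro A)) (𝟙 A) (𝟙 A) (unitPro A)
    (idCell (unitPro A))).choose

theorem unitCell_mul (A : E) :
    paste (.pair (unitCell A) (idCell (unitPro A)) rfl) (unitMul A) = idCell (unitPro A) :=
  (unitCell_isComposite A (.nil A) (.one (unitPro A)) (𝟙 A) (𝟙 A) (unitPro A)
    (idCell (unitPro A))).choose_spec.1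

theorem unit_hom_ext {A Z W : E} {r : Pros A Z} {f : A ⟶ W} {Y : E} {g : Z ⟶ Y} {K : Pro W Y}
    {ψ ψ' : Cell (.cons (unitPro A) r) f g K}
    (h : paste (h := f) (k := g) (.cons (unitCell A) (.ids r) rfl) ψ =
      paste (.cons (unitCell A) (.ids r) rfl) ψ') :
    ψ = ψ' :=
  (unitCell_isComposite A (.nil A) r f g K
    (paste (.cons (unitCell A) (.ids r) rfl) ψ')).unique h rfl

theorem unit_pair_mul {A X : E} {p : Pros A X} {g : X ⟶ A} (φ : Cell p (𝟙 A) g (unitPro A)) :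
    paste (.pair (unitCell A) φ rfl) (unitMul A) = φ := by
  have h := paste_pair_paste (.nil (𝟙 A)) (.single φ) rfl rfl (unitCell A) (idCell (unitPro A))
    (unitMul A) (a := 𝟙 A) (b := 𝟙 A) (c := g) (i := 𝟙 A) (j := g) (s := 𝟙 A) (t := 𝟙 A)
    (by simp) (by simp) (by simp) (by simp) (by simp) (by simp) (by simp)
  rw [unitCell_mul, VirtualDoubleCategory.paste_id] at h
  have h1 : paste (.nil (𝟙 A)) (unitCell A) = unitCell A := VirtualDoubleCategory.ids_paste _
  rw [h1] at h
  exact h.trans (VirtualDoubleCategory.paste_id φ)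

theorem unitMul_assoc (A : E) :
    paste (p := .three (unitPro A) (unitPro A) (unitPro A)) (h := 𝟙 A) (k := 𝟙 A)
        (.pair (unitMul A) (idCell (unitPro A)) rfl) (unitMul A) =
      paste (.pair (idCell (unitPro A)) (unitMul A) rfl) (unitMul A) := by
  apply unit_hom_ext
  have h := paste_pair_paste (p := .two (unitPro A) (unitPro A))
    (q := .three (unitPro A) (unitPro A) (unitPro A))
    (.pair (unitCell A) (idCell (unitPro A)) rfl)
    (.single (idCell (unitPro A))) rfl rfl (unitMul A) (idCell (unitPro A))
    (unitMul A) (a := 𝟙 A) (b := 𝟙 A) (c := 𝟙 A) (i := 𝟙 A) (j := 𝟙 A) (s := 𝟙 A) (t := 𝟙 A)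
    (by simp) (by simp) (by simp) (by simp) (by simp) (by simp) (by simp)
  have h' := paste_pair_paste (p := .two (unitPro A) (unitPro A))
    (q := .three (unitPro A) (unitPro A) (unitPro A)) (.single (unitCell A))
    (.pair (idCell (unitPro A)) (idCell (unitPro A)) rfl) rfl rfl
    (idCell (unitPro A)) (unitMul A)
    (unitMul A) (a := 𝟙 A) (b := 𝟙 A) (c := 𝟙 A) (i := 𝟙 A) (j := 𝟙 A) (s := 𝟙 A) (t := 𝟙 A)
    (by simp) (by simp) (by simp) (by simp) (by simp) (by simp) (by simp)
  have h1 : paste (.pair (idCell (unitPro A)) (idCell (unitPro A)) rfl) (unitMul A) = unitMul A :=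
    VirtualDoubleCategory.ids_paste (unitMul A)
  rw [unitCell_mul, VirtualDoubleCategory.paste_id] at h
  rw [VirtualDoubleCategory.paste_id, h1] at h'
  exact h.symm.trans (h1.trans ((unit_pair_mul (unitMul A)).symm.trans h'))

theorem unitMul_cell (A : E) :
    paste (.pair (idCell (unitPro A)) (unitCell A) rfl) (unitMul A) = idCell (unitPro A) := by
  apply unit_hom_ext
  have h := paste_pair_paste (p := .nil A) (q := .one (unitPro A)) (.single (unitCell A))
    (.nil (𝟙 A)) rfl rfl (idCell (unitPro A)) (unitCell A)
    (unitMul A) (a := 𝟙 A) (b := 𝟙 A) (c := 𝟙 A) (i := 𝟙 A) (j := 𝟙 A) (s := 𝟙 A) (t := 𝟙 A)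
    (by simp) (by simp) (by simp) (by simp) (by simp) (by simp) (by simp)
  have h1 : paste (.nil (𝟙 A)) (unitCell A) = unitCell A := VirtualDoubleCategory.ids_paste _
  rw [VirtualDoubleCategory.paste_id, h1] at h
  exact h.symm.trans ((unit_pair_mul (unitCell A)).trans
    (VirtualDoubleCategory.paste_id _).symm)

theorem nil_unit_pair_mul {A X Y : E} {p : Pros X Y} {f : X ⟶ A} {g : Y ⟶ A}
    (φ : Cell p f g (unitPro A)) :
    paste (.pair (paste (h := f) (k := f) (.nil f) (unitCell A)) φ rfl) (unitMul A) = φ := by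
  have h := paste_pair_paste (.nil f) (.single φ) rfl rfl (unitCell A) (idCell (unitPro A))
    (unitMul A) (a := f) (b := f) (c := g) (i := f) (j := g) (s := 𝟙 A) (t := 𝟙 A)
    (by simp) (by simp) (by simp) (by simp) (by simp) (by simp) (by simp)
  rw [unitCell_mul, VirtualDoubleCategory.paste_id] at h
  exact h.trans (VirtualDoubleCategory.paste_id φ)

theorem pair_nil_unit_mul {A X Y : E} {p : Pros X Y} {f : X ⟶ A} {g : Y ⟶ A}
    (φ : Cell p f g (unitPro A)) :
    paste (.pair φ (paste (h := g) (k := g) (.nil g) (unitCell A)) p.append_nil) (unitMul A) =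
      φ := by
  have h := paste_pair_paste (.single φ) (.nil g) p.append_nil rfl (idCell (unitPro A))
    (unitCell A)
    (unitMul A) (a := f) (b := g) (c := g) (i := f) (j := g) (s := 𝟙 A) (t := 𝟙 A)
    (by simp) (by simp) (by simp) (by simp) (by simp) (by simp) (by simp)
  rw [unitMul_cell, VirtualDoubleCategory.paste_id] at h
  exact h.trans (VirtualDoubleCategory.paste_id φ)

end Units

/-! ## Categories enriched in a virtual equipment -/

section Enriched

/-- A category enriched in `E`. -/
structure ECategory (E : Type u) [Category.{v} E] [VirtualDoubleCategory.{u, v, w, z} E] where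
  Obj : Type x
  ext : Obj → E
  hom (a b : Obj) : Pro (ext a) (ext b)
  id (a : Obj) : Cell (.nil (ext a)) (𝟙 _) (𝟙 _) (hom a a)
  comp (a b c : Obj) : Cell (.two (hom a b) (hom b c)) (𝟙 _) (𝟙 _) (hom a c)
  id_comp (a b : Obj) :
    paste (.pair (id a) (idCell (hom a b)) rfl) (comp a a b) = idCell (hom a b)
  comp_id (a b : Obj) :
    paste (.pair (idCell (hom a b)) (id b) rfl) (comp a b b) = idCell (hom a b)
  assoc (a b c d : Obj) :
    paste (p := .three (hom a b) (hom b c) (hom c d)) (h := 𝟙 _) (k := 𝟙 _)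
        (.pair (comp a b c) (idCell (hom c d)) rfl) (comp a c d) =
      paste (.pair (idCell (hom a b)) (comp b c d) rfl) (comp a b d)

variable {E : Type u} [Category.{v} E] [VirtualDoubleCategory.{u, v, w, z} E]

/-- A functor between enriched categories. -/
structure EFunctor (C D : ECategory.{u, v, w, z, x} E) where
  obj : C.Obj → D.Obj
  arr (a : C.Obj) : C.ext a ⟶ D.ext (obj a)
  map (a b : C.Obj) : Cell (.one (C.hom a b)) (arr a) (arr b) (D.hom (obj a) (obj b))
  map_id (a : C.Obj) :
    paste (h := arr a) (k := arr a) (.single (C.id a)) (map a a) =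
      paste (.nil (arr a)) (D.id (obj a))
  map_comp (a b c : C.Obj) :
    paste (h := arr a) (k := arr c) (.single (C.comp a b c)) (map a c) =
      paste (.pair (map a b) (map b c) rfl) (D.comp (obj a) (obj b) (obj c))

/-- The identity functor. -/
def EFunctor.id (C : ECategory.{u, v, w, z, x} E) : EFunctor C C where
  obj a := a
  arr a := 𝟙 _
  map a b := idCell _
  map_id a := by
    rw [VirtualDoubleCategory.paste_id]
    exact (VirtualDoubleCategory.ids_paste (C.id a)).symm
  map_comp a b c := by
    rw [VirtualDoubleCategory.paste_id]
    exact (VirtualDoubleCategory.ids_paste (C.comp a b c)).symm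

/-- A profunctor `C ⇸ D` between enriched categories. -/
structure EProfunctor (C D : ECategory.{u, v, w, z, x} E) where
  pro (a : C.Obj) (b : D.Obj) : Pro (C.ext a) (D.ext b)
  /-- the action of `C` -/
  lact (a a' : C.Obj) (b : D.Obj) : Cell (.two (C.hom a a') (pro a' b)) (𝟙 _) (𝟙 _) (pro a b)
  /-- the action of `D` -/
  ract (a : C.Obj) (b b' : D.Obj) : Cell (.two (pro a b) (D.hom b b')) (𝟙 _) (𝟙 _) (pro a b')
  id_lact (a : C.Obj) (b : D.Obj) :
    paste (.pair (C.id a) (idCell (pro a b)) rfl) (lact a a b) = idCell (pro a b)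
  ract_id (a : C.Obj) (b : D.Obj) :
    paste (.pair (idCell (pro a b)) (D.id b) rfl) (ract a b b) = idCell (pro a b)
  comp_lact (a a' a'' : C.Obj) (b : D.Obj) :
    paste (p := .three (C.hom a a') (C.hom a' a'') (pro a'' b)) (h := 𝟙 _) (k := 𝟙 _)
        (.pair (C.comp a a' a'') (idCell (pro a'' b)) rfl) (lact a a'' b) =
      paste (.pair (idCell (C.hom a a')) (lact a' a'' b) rfl) (lact a a' b)
  ract_comp (a : C.Obj) (b b' b'' : D.Obj) :
    paste (p := .three (pro a b) (D.hom b b') (D.hom b' b'')) (h := 𝟙 _) (k := 𝟙 _)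
        (.pair (ract a b b') (idCell (D.hom b' b'')) rfl) (ract a b' b'') =
      paste (.pair (idCell (pro a b)) (D.comp b b' b'') rfl) (ract a b b'')
  exchange (a a' : C.Obj) (b b' : D.Obj) :
    paste (p := .three (C.hom a a') (pro a' b) (D.hom b b')) (h := 𝟙 _) (k := 𝟙 _)
        (.pair (lact a a' b) (idCell (D.hom b b')) rfl) (ract a b b') =
      paste (.pair (idCell (C.hom a a')) (ract a' b b') rfl) (lact a a' b')

/-- Composable lists of profunctors. -/
abbrev Profs (C D : ECategory.{u, v, w, z, x} E) :=
  ProPath (E := ECategory.{u, v, w, z, x} E) EProfunctor C D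

/-- `Pts p c d`: choices of an object in each of the enriched categories met by the list of
profunctors `p`, beginning with `c` and ending with `d`. -/
inductive Pts : {C D : ECategory.{u, v, w, z, x} E} → Profs C D → C.Obj → D.Obj →
    Type (max u v w z (x + 1))
  | nil {C : ECategory.{u, v, w, z, x} E} (c : C.Obj) : Pts (.nil C) c c
  | cons {C D D' : ECategory.{u, v, w, z, x} E} (J : EProfunctor C D) {p : Profs D D'}
      (c : C.Obj) {d : D.Obj} {d' : D'.Obj} (s : Pts p d d') : Pts (.cons J p) c d'

namespace Pts

/-- The list of proarrows `J₁(c₀, c₁), …, J_k(c_{k-1}, c_k)`. -/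
def pros : {C D : ECategory.{u, v, w, z, x} E} → {p : Profs C D} → {c : C.Obj} → {d : D.Obj} →
    Pts p c d → Pros (C.ext c) (D.ext d)
  | _, _, _, _, _, nil _ => .nil _
  | _, _, _, _, _, cons (d := d) J c s => .cons (J.pro c d) s.pros

/-- Concatenation. -/
def append : {C D D' : ECategory.{u, v, w, z, x} E} → {p : Profs C D} → {q : Profs D D'} →
    {c : C.Obj} → {d : D.Obj} → {d' : D'.Obj} → Pts p c d → Pts q d d' → Pts (p.append q) c d'
  | _, _, _, _, _, _, _, _, nil _, t => t
  | _, _, _, _, _, _, _, _, cons J c s, t => cons J c (s.append t)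

theorem pros_append {C D D' : ECategory.{u, v, w, z, x} E} {p : Profs C D} {q : Profs D D'}
    {c : C.Obj} {d : D.Obj} {d' : D'.Obj} (s : Pts p c d) (t : Pts q d d') :
    (s.append t).pros = s.pros.append t.pros := by
  induction s with
  | nil => rfl
  | cons J c s ih => exact congrArg (ProPath.cons _) (ih t)

/-- The list of 2-cells `id, …, id, μ, id, …, id` whose domain is the list of the proarrows
at the concatenation of `s₁`, `s₂` and `s₃`. -/
def whisker : {B C D D' : ECategory.{u, v, w, z, x} E} → {l : Profs B C} → {p : Profs C D} →
    {r : Profs D D'} → {J : EProfunctor C D} → {b : B.Obj} → {c : C.Obj} → {d : D.Obj} →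
    {d' : D'.Obj} → (s₁ : Pts l b c) → (s₂ : Pts p c d) →
    (μ : Cell s₂.pros (𝟙 _) (𝟙 _) (J.pro c d)) → (s₃ : Pts r d d') →
    CellPath (s₁.append (s₂.append s₃)).pros (𝟙 _) (𝟙 _) (s₁.append (cons J c s₃)).pros
  | _, _, _, _, _, _, _, _, _, _, _, _, nil _, s₂, μ, s₃ =>
      .cons μ (.ids s₃.pros) (pros_append s₂ s₃).symm
  | _, _, _, _, _, _, _, _, _, _, _, _, cons (d := e) H b s₁, s₂, μ, s₃ =>
      .cons (idCell (H.pro b e)) (whisker s₁ s₂ μ s₃) rfl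

end Pts

/-- A choice of objects along a list of profunctors together with an interior position,
at which two objects `y`, `y'` of the category are chosen instead of one. -/
inductive Interior : {C D : ECategory.{u, v, w, z, x} E} → Profs C D → C.Obj → D.Obj →
    Type (max u v w z (x + 1))
  | here {B C D D' : ECategory.{u, v, w, z, x} E} (J : EProfunctor B C) (J' : EProfunctor C D)
      {p : Profs D D'} (b : B.Obj) (y y' : C.Obj) {d : D.Obj} {d' : D'.Obj} (s : Pts p d d') :
      Interior (.cons J (.cons J' p)) b d'
  | there {C D D' : ECategory.{u, v, w, z, x} E} (J : EProfunctor C D) {p : Profs D D'}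
      (c : C.Obj) {d : D.Obj} {d' : D'.Obj} (m : Interior p d d') : Interior (.cons J p) c d'

namespace Interior

/-- The list `…, J_i(c, y), C_i(y, y'), J_{i+1}(y', d), …`. -/
def pros : {C D : ECategory.{u, v, w, z, x} E} → {p : Profs C D} → {c : C.Obj} → {d : D.Obj} →
    Interior p c d → Pros (C.ext c) (D.ext d)
  | _, _, _, _, _, here (C := C) (d := d) J J' b y y' s =>
      .cons (J.pro b y) (.cons (C.hom y y') (.cons (J'.pro y' d) s.pros))
  | _, _, _, _, _, there (d := d) J c m => .cons (J.pro c d) m.pros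

/-- The choice of objects keeping `y`. -/
def fstPts : {C D : ECategory.{u, v, w, z, x} E} → {p : Profs C D} → {c : C.Obj} →
    {d : D.Obj} → Interior p c d → Pts p c d
  | _, _, _, _, _, here J J' b y _ s => .cons J b (.cons J' y s)
  | _, _, _, _, _, there J c m => .cons J c m.fstPts

/-- The choice of objects keeping `y'`. -/
def sndPts : {C D : ECategory.{u, v, w, z, x} E} → {p : Profs C D} → {c : C.Obj} →
    {d : D.Obj} → Interior p c d → Pts p c d
  | _, _, _, _, _, here J J' b _ y' s => .cons J b (.cons J' y' s)
  | _, _, _, _, _, there J c m => .cons J c m.sndPts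

/-- `C_i(y, y')` acts on `J_{i+1}(y', d)`. -/
def actFst : {C D : ECategory.{u, v, w, z, x} E} → {p : Profs C D} → {c : C.Obj} →
    {d : D.Obj} → (m : Interior p c d) → CellPath m.pros (𝟙 _) (𝟙 _) m.fstPts.pros
  | _, _, _, _, _, here (d := d) J J' b y y' s =>
      .cons (idCell (J.pro b y)) (.cons (J'.lact y y' d) (.ids s.pros) rfl) rfl
  | _, _, _, _, _, there (d := d) J c m => .cons (idCell (J.pro c d)) m.actFst rfl

/-- `C_i(y, y')` acts on `J_i(c, y)`. -/
def actSnd : {C D : ECategory.{u, v, w, z, x} E} → {p : Profs C D} → {c : C.Obj} →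
    {d : D.Obj} → (m : Interior p c d) → CellPath m.pros (𝟙 _) (𝟙 _) m.sndPts.pros
  | _, _, _, _, _, here (d := d) J J' b y y' s =>
      .cons (J.ract b y y') (.cons (idCell (J'.pro y' d)) (.ids s.pros) rfl) rfl
  | _, _, _, _, _, there (d := d) J c m => .cons (idCell (J.pro c d)) m.actSnd rfl

end Interior

/-- A choice of objects along a non-empty list of profunctors, with two choices `d`, `d'`
of the last object. -/
inductive Last : {C D : ECategory.{u, v, w, z, x} E} → Profs C D → C.Obj → D.Obj → D.Obj →
    Type (max u v w z (x + 1))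
  | here {C D : ECategory.{u, v, w, z, x} E} (J : EProfunctor C D) (c : C.Obj) (d d' : D.Obj) :
      Last (.one J) c d d'
  | there {B C D : ECategory.{u, v, w, z, x} E} (J : EProfunctor B C) {p : Profs C D}
      (b : B.Obj) {c : C.Obj} {d d' : D.Obj} (m : Last p c d d') : Last (.cons J p) b d d'

namespace Last

/-- The choice of objects ending with `d`. -/
def fstPts : {C D : ECategory.{u, v, w, z, x} E} → {p : Profs C D} → {c : C.Obj} →
    {d d' : D.Obj} → Last p c d d' → Pts p c d
  | _, _, _, _, _, _, here J c d _ => .cons J c (.nil d)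
  | _, _, _, _, _, _, there J c m => .cons J c m.fstPts

/-- The choice of objects ending with `d'`. -/
def sndPts : {C D : ECategory.{u, v, w, z, x} E} → {p : Profs C D} → {c : C.Obj} →
    {d d' : D.Obj} → Last p c d d' → Pts p c d'
  | _, _, _, _, _, _, here J c _ d' => .cons J c (.nil d')
  | _, _, _, _, _, _, there J c m => .cons J c m.sndPts

/-- The last category acts on the last profunctor. -/
def act : {C D : ECategory.{u, v, w, z, x} E} → {p : Profs C D} → {c : C.Obj} →
    {d d' : D.Obj} → (m : Last p c d d') →
    CellPath (m.fstPts.pros.append (.one (D.hom d d'))) (𝟙 _) (𝟙 _) m.sndPts.pros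
  | _, _, _, _, _, _, here J c d d' => .single (J.ract c d d')
  | _, _, _, _, _, _, there (c := c) J b m => .cons (idCell (J.pro b c)) m.act rfl

end Last

/-- The families of 2-cells that underlie a morphism from the list `p` to `K` over `F`, `G`. -/
abbrev ProfFamily {C C' D D' : ECategory.{u, v, w, z, x} E} (p : Profs C C')
    (F : EFunctor C D) (G : EFunctor C' D') (K : EProfunctor D D') :=
  ∀ (c : C.Obj) (c' : C'.Obj) (s : Pts p c c'),
    Cell s.pros (F.arr c) (G.arr c') (K.pro (F.obj c) (G.obj c'))

/-- Compatibility with the action of the first category of the list. For the empty list, where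
there is no profunctor on which to act, this is naturality. -/
def ProfFamily.LeftLaw {C C' D D' : ECategory.{u, v, w, z, x} E} : {p : Profs C C'} →
    {F : EFunctor C D} → {G : EFunctor C' D'} → {K : EProfunctor D D'} →
    ProfFamily p F G K → Prop
  | .cons J _, F, G, K, α => ∀ (c₀ c : C.Obj) (d) (c' : C'.Obj) (s : Pts _ d c'),
      paste (h := F.arr c₀) (k := G.arr c')
          (.cons (J.lact c₀ c d) (.ids s.pros) rfl) (α c₀ c' (.cons J c₀ s)) =
        paste (.pair (F.map c₀ c) (α c c' (.cons J c s)) rfl)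
          (K.lact (F.obj c₀) (F.obj c) (G.obj c'))
  | .nil _, F, G, K, α => ∀ (c c' : C.Obj),
      paste (p := .one (C.hom c c')) (h := F.arr c) (k := G.arr c')
          (.pair (F.map c c') (α c' c' (.nil c')) rfl) (K.lact _ _ _) =
        paste (.pair (α c c (.nil c)) (G.map c c') rfl) (K.ract _ _ _)

/-- A morphism of profunctors (2-cell of enriched categories) with horizontal domain the list `p`,
horizontal codomain `K` and vertical boundaries `F` and `G`. -/
structure ProfMor {C C' D D' : ECategory.{u, v, w, z, x} E} (p : Profs C C')
    (F : EFunctor C D) (G : EFunctor C' D') (K : EProfunctor D D') where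
  app : ProfFamily p F G K
  interior {c : C.Obj} {c' : C'.Obj} (m : Interior p c c') :
    paste (h := F.arr c) (k := G.arr c') m.actFst (app c c' m.fstPts) =
      paste m.actSnd (app c c' m.sndPts)
  left : app.LeftLaw
  right {c : C.Obj} {d d' : C'.Obj} (m : Last p c d d') :
    paste (h := F.arr c) (k := G.arr d') m.act (app c d' m.sndPts) =
      paste (.pair (app c d m.fstPts) (G.map d d') rfl) (K.ract (F.obj c) (G.obj d) (G.obj d'))

/-- The morphism of profunctors `μ` exhibits `J` as the composite of the list of profunctors `p`
in the virtual double category of categories enriched in `E`, where composition of 2-cells is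
componentwise: every `φ` out of a list containing `p` factors uniquely as `ψ(id, …, μ, …, id)`. -/
def IsProfComposite {C D : ECategory.{u, v, w, z, x} E} {p : Profs C D} {J : EProfunctor C D}
    (μ : ProfMor p (EFunctor.id C) (EFunctor.id D) J) : Prop :=
  ∀ {B B' C' D' : ECategory.{u, v, w, z, x} E} (l : Profs B C) (r : Profs D B')
    (F : EFunctor B C') (G : EFunctor B' D') (K : EProfunctor C' D')
    (φ : ProfMor (l.append (p.append r)) F G K),
    ∃! ψ : ProfMor (l.append (.cons J r)) F G K,
      ∀ (b : B.Obj) (c : C.Obj) (d : D.Obj) (b' : B'.Obj)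
        (s₁ : Pts l b c) (s₂ : Pts p c d) (s₃ : Pts r d b'),
        paste (Pts.whisker s₁ s₂ (μ.app c d s₂) s₃)
          (ψ.app b b' (s₁.append (.cons J c s₃))) = φ.app b b' (s₁.append (s₂.append s₃))

end Enriched

/-! ## The canonical embedding on objects, and the coreflection on proarrows -/

section Representation

variable {E : Type u} [Category.{v} E] [VirtualEquipment.{u, v, w, z} E]

/-- `A(f, g)`, the restriction of the unit of `A` along `f` and `g`, equivalently
the composite of the companion of `f` and the conjoint of `g`. -/
noncomputable def reprHom {A X Y : E} (f : X ⟶ A) (g : Y ⟶ A) : Pro X Y :=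
  (VirtualEquipment.exists_restriction f g (unitPro A)).choose

/-- The cartesian 2-cell `A(f, g) → h_A`. -/
noncomputable def reprCart {A X Y : E} (f : X ⟶ A) (g : Y ⟶ A) :
    Cell (.one (reprHom f g)) f g (unitPro A) :=
  (VirtualEquipment.exists_restriction f g (unitPro A)).choose_spec.choose

theorem reprCart_isCartesian {A X Y : E} (f : X ⟶ A) (g : Y ⟶ A) : IsCartesian (reprCart f g) :=
  (VirtualEquipment.exists_restriction f g (unitPro A)).choose_spec.choose_spec

/-- The factorization of a 2-cell through the cartesian 2-cell `A(f, g) → h_A`. -/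
noncomputable def reprLift {A X Y : E} {f : X ⟶ A} {g : Y ⟶ A} {p : Pros X Y}
    (φ : Cell p f g (unitPro A)) : Cell p (𝟙 X) (𝟙 Y) (reprHom f g) :=
  (reprCart_isCartesian f g (𝟙 X) (𝟙 Y) p (Cell.cast φ (by simp) (by simp))).choose

theorem Cell.cast_paste {X Y X' Y' Z W : E} {p : Pros X Y} {f : X ⟶ X'} {g : Y ⟶ Y'}
    {q : Pros X' Y'} {f' : X' ⟶ Z} {g' : Y' ⟶ W} {K : Pro Z W} {h h' : X ⟶ Z} {k k' : Y ⟶ W}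
    (Γ : CellPath p f g q) (β : Cell q f' g' K) (eh : f ≫ f' = h) (ek : g ≫ g' = k)
    (eh' : h = h') (ek' : k = k') :
    Cell.cast (paste Γ β eh ek) eh' ek' = paste Γ β (eh.trans eh') (ek.trans ek') := by
  subst eh' ek'; rfl

theorem reprLift_cart {A X Y : E} {f : X ⟶ A} {g : Y ⟶ A} {p : Pros X Y}
    (φ : Cell p f g (unitPro A)) : paste (.single (reprLift φ)) (reprCart f g) = φ := by
  have h := (reprCart_isCartesian f g (𝟙 X) (𝟙 Y) p
    (Cell.cast φ (by simp) (by simp))).choose_spec.1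
  have h' := congrArg (fun ψ => Cell.cast (f' := f) (g' := g) ψ (by simp) (by simp)) h
  simp only [Cell.cast_paste, Cell.cast_cast] at h'
  exact h'

theorem repr_hom_ext {A X Y : E} {f : X ⟶ A} {g : Y ⟶ A} {p : Pros X Y}
    {φ ψ : Cell p (𝟙 X) (𝟙 Y) (reprHom f g)}
    (h : paste (h := f) (k := g) (.single φ) (reprCart f g) = paste (.single ψ) (reprCart f g)) :
    φ = ψ := by
  have h' := congrArg (fun θ => Cell.cast (f' := 𝟙 X ≫ f) (g' := 𝟙 Y ≫ g) θ
    (by simp) (by simp)) h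
  simp only [Cell.cast_paste] at h'
  exact (reprCart_isCartesian f g (𝟙 X) (𝟙 Y) p _).unique h' rfl

theorem id_paste_repr {A X Y : E} (f : X ⟶ A) (g : Y ⟶ A) :
    paste (.single (idCell (reprHom f g))) (reprCart f g) = reprCart f g :=
  VirtualDoubleCategory.ids_paste _

/-- The composition `A(f, g), A(g, h) → A(f, h)`. -/
noncomputable def reprComp {A X Y Z : E} (f : X ⟶ A) (g : Y ⟶ A) (h : Z ⟶ A) :
    Cell (.two (reprHom f g) (reprHom g h)) (𝟙 X) (𝟙 Z) (reprHom f h) :=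
  reprLift (paste (.pair (reprCart f g) (reprCart g h) rfl) (unitMul A))

/-- The identity `() → A(f, f)`. -/
noncomputable def reprId {A X : E} (f : X ⟶ A) : Cell (.nil X) (𝟙 X) (𝟙 X) (reprHom f f) :=
  reprLift (paste (.nil f) (unitCell A))

theorem paste_reprComp {A X Y Z : E} {f : X ⟶ A} {g : Y ⟶ A} {h : Z ⟶ A} {p : Pros X Y}
    {q : Pros Y Z} {t : Pros X Z} (φ : Cell p (𝟙 X) (𝟙 Y) (reprHom f g))
    (ψ : Cell q (𝟙 Y) (𝟙 Z) (reprHom g h)) (e : p.append q = t) :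
    paste (h := f) (k := h)
        (.single (paste (h := 𝟙 X) (k := 𝟙 Z) (.pair φ ψ e) (reprComp f g h))) (reprCart f h) =
      paste (.pair (paste (h := f) (k := g) (.single φ) (reprCart f g))
        (paste (h := g) (k := h) (.single ψ) (reprCart g h)) e) (unitMul A) := by
  rw [paste_single_paste (s := f) (t := h) (hs := by simp) (ht := by simp), reprComp,
    reprLift_cart]
  exact (paste_pair_paste (.single φ) (.single ψ) e rfl (reprCart f g) (reprCart g h) (unitMul A)
    (by simp) (by simp) (by simp) (by simp) (by simp) (by simp) (by simp)).symm

theorem repr_id_comp {A X Y : E} (f : X ⟶ A) (g : Y ⟶ A) :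
    paste (.pair (reprId f) (idCell (reprHom f g)) rfl) (reprComp f f g) =
      idCell (reprHom f g) := by
  refine repr_hom_ext (f := f) (g := g) ?_
  refine (paste_reprComp (reprId f) (idCell (reprHom f g)) rfl).trans ?_
  rw [id_paste_repr, reprId, reprLift_cart]
  exact (nil_unit_pair_mul (reprCart f g)).trans (id_paste_repr f g).symm

theorem repr_comp_id {A X Y : E} (f : X ⟶ A) (g : Y ⟶ A) :
    paste (.pair (idCell (reprHom f g)) (reprId g) rfl) (reprComp f g g) =
      idCell (reprHom f g) := by
  refine repr_hom_ext (f := f) (g := g) ?_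
  refine (paste_reprComp (idCell (reprHom f g)) (reprId g) rfl).trans ?_
  rw [id_paste_repr, reprId, reprLift_cart]
  exact (pair_nil_unit_mul (reprCart f g)).trans (id_paste_repr f g).symm

theorem repr_assoc {A X Y Z W : E} (f : X ⟶ A) (g : Y ⟶ A) (h : Z ⟶ A) (k : W ⟶ A) :
    paste (p := .three (reprHom f g) (reprHom g h) (reprHom h k)) (h := 𝟙 _) (k := 𝟙 _)
        (.pair (reprComp f g h) (idCell (reprHom h k)) rfl) (reprComp f h k) =
      paste (.pair (idCell (reprHom f g)) (reprComp g h k) rfl) (reprComp f g k) := by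
  refine repr_hom_ext (f := f) (g := k) ?_
  refine (paste_reprComp (reprComp f g h) (idCell (reprHom h k)) rfl).trans (Eq.trans ?_
    (paste_reprComp (idCell (reprHom f g)) (reprComp g h k) rfl).symm)
  rw [id_paste_repr, id_paste_repr, reprComp, reprComp, reprLift_cart, reprLift_cart]
  have h₁ := paste_pair_paste (p := .three (reprHom f g) (reprHom g h) (reprHom h k))
    (q := .three (unitPro A) (unitPro A) (unitPro A))
    (.pair (reprCart f g) (reprCart g h) rfl) (.single (reprCart h k)) rfl rfl
    (unitMul A) (idCell (unitPro A)) (unitMul A)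
    (a := f) (b := h) (c := k) (i := f) (j := k) (s := 𝟙 A) (t := 𝟙 A)
    (by simp) (by simp) (by simp) (by simp) (by simp) (by simp) (by simp)
  have h₂ := paste_pair_paste (p := .three (reprHom f g) (reprHom g h) (reprHom h k))
    (q := .three (unitPro A) (unitPro A) (unitPro A)) (.single (reprCart f g))
    (.pair (reprCart g h) (reprCart h k) rfl) rfl rfl
    (idCell (unitPro A)) (unitMul A) (unitMul A)
    (a := f) (b := g) (c := k) (i := f) (j := k) (s := 𝟙 A) (t := 𝟙 A)
    (by simp) (by simp) (by simp) (by simp) (by simp) (by simp) (by simp)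
  rw [VirtualDoubleCategory.paste_id] at h₁ h₂
  refine h₁.trans (Eq.trans ?_ h₂.symm)
  exact congrArg (fun θ => paste (p := .three (reprHom f g) (reprHom g h) (reprHom h k))
    (h := f) (k := k) (.cons (reprCart f g) (.pair (reprCart g h) (reprCart h k) rfl) rfl) θ)
    (unitMul_assoc A)

/-- The enriched category `|A|`: its objects are the vertical arrows into `A`, the extent of a
vertical arrow is its domain, the hom from `f` to `g` is `A(f, g)`; identities and composition
are induced by `() → h_A` and `h_A, h_A → h_A`. -/
noncomputable def represent (A : E) : ECategory.{u, v, w, z, max u v} E where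
  Obj := Σ X : E, (X ⟶ A)
  ext a := a.1
  hom a b := reprHom a.2 b.2
  id a := reprId a.2
  comp a b c := reprComp a.2 b.2 c.2
  id_comp a b := repr_id_comp a.2 b.2
  comp_id a b := repr_comp_id a.2 b.2
  assoc a b c d := repr_assoc a.2 b.2 c.2 d.2

/-- The object `id_A` of `|A|`. -/
noncomputable def idObj (A : E) : (represent A).Obj := ⟨A, 𝟙 A⟩

/-- The coreflection `J̄ = J(id_A, id_B)` of a profunctor `J : |A| ⇸ |B|`. -/
noncomputable def coreflect {A B : E} (J : EProfunctor (represent A) (represent B)) : Pro A B :=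
  J.pro (idObj A) (idObj B)

/-- The component at identities of a morphism `J, K → L` of profunctors. -/
noncomputable def coreflectMor {A B C : E} {J : EProfunctor (represent A) (represent B)}
    {K : EProfunctor (represent B) (represent C)} {L : EProfunctor (represent A) (represent C)}
    (μ : ProfMor (.two J K) (EFunctor.id _) (EFunctor.id _) L) :
    Cell (.two (coreflect J) (coreflect K)) (𝟙 A) (𝟙 C) (coreflect L) :=
  μ.app (idObj A) (idObj C) (.cons J (idObj A) (.cons K (idObj B) (.nil (idObj C))))

end Representation

/-!
The idea is to transport the universal property of `μ` along the passage from proarrows `H` of the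
equipment to the profunctors `|H|` they represent, whose value at `a` and `b` is the restriction
`H(a, b)`.

A profunctor `P : |A| ⇸ |B|` is *presented* by a proarrow `H : A ⇸ B` (`Presentation`) if it comes
with 2-cells `P(a, b) → H` compatible with the actions of `|A|` and `|B|`, the units of `A` and `B`
acting on `H`, together with a section of the 2-cell at the identities. There are two examples.
The profunctor `|H|` is presented by `H`, through the cartesian 2-cells. Every profunctor `J` is
presented by `J(id, id)`, through the 2-cells `toId : J(a, b) → J(id, id)` that let the conjoint of
`a` and the companion of `b` act on `J(a, b)`.

If `P₁, …, P_k` are presented by `H₁, …, H_k`, every 2-cell `φ : H₁, …, H_k → M` has a transpose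
`P₁, …, P_k → |M|` (`Presentations.transpose`): its components are the factorizations of
`P₁(a₀, a₁), …, P_k(a_{k-1}, a_k) → H₁, …, H_k → M` through the cartesian 2-cells of `M`. The laws
of a morphism of profunctors hold for it since a unit inserted between two proarrows may act on
either (`unitRact_unitLact`), and since a unit at either end of the list may be moved past `φ`
(`unitLact_paste`, `unitRact_paste`). From the transpose, `φ` is recovered by evaluating at the
identities and precomposing with the sections.

For lists `l` and `r` of proarrows, the lists `l, J(id, id), K(id, id), r` and `l, L(id, id), r`
present `|l|, J, K, |r|` and `|l|, L, |r|`. The components of `μ` are natural for the presentations: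
`μ(a, b, c)` followed by `L(a, c) → L(id, id)` is the component at the identities after
`J(a, b) → J(id, id)` and `K(b, c) → K(id, id)` (`ProfMor.app₂_toId`). For the outer objects this
is the compatibility of `μ` with the outer actions, and for `b` it is the compatibility with the
inner actions together with the zigzag identity of the companion and the conjoint of `b`. Hence
transposition turns precomposition with the component at the identities into precomposition with
`μ`. A factorization of `φ` is then obtained by factoring its transpose through `μ` and evaluating
at the identities, and two factorizations of `φ` have equal transposes, so they are equal. The
second assertion is the uniqueness of composites up to isomorphism (`IsComposite.exists_proIso`).
-/

/-! ### Vertical stacking of lists of 2-cells -/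

section Stacking

variable {E : Type u} [Category.{v} E] [VirtualDoubleCategory.{u, v, w, z} E]

theorem CellPath.cons_append {X Y V U X' Y' V' U' : E} {p : Pros X Y} {f : X ⟶ X'} {g : Y ⟶ Y'}
    {h : V ⟶ V'} {K : Pro X' Y'} {q : Pros Y V} {r : Pros Y' V'} {t : Pros X V}
    (α : Cell p f g K) (Γ : CellPath q g h r) (e : p.append q = t) {p' : Pros V U} {k : U ⟶ U'}
    {q' : Pros V' U'} (Δ : CellPath p' h k q') {s : Pros X U} {s' : Pros Y U} {m : Pros Y' U'}
    (i : t.append p' = s) (i' : (ProPath.cons K r).append q' = .cons K m)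
    (j : q.append p' = s') (j' : r.append q' = m) (j'' : p.append s' = s) :
    (CellPath.cons α Γ e).append Δ i i' = CellPath.cons α (Γ.append Δ j j') j'' := by
  subst e i j j'; rfl

theorem CellPath.append_assoc {X Y V U X' Y' V' U' : E} {p : Pros X Y} {f : X ⟶ X'} {g : Y ⟶ Y'}
    {q : Pros X' Y'} (Γ : CellPath p f g q) {p' : Pros Y V} {h : V ⟶ V'} {q' : Pros Y' V'}
    (Δ : CellPath p' g h q') {p'' : Pros V U} {k : U ⟶ U'} {q'' : Pros V' U'}
    (Θ : CellPath p'' h k q'') {t₁ : Pros X V} {m₁ : Pros X' V'} {t₂ : Pros Y U} {m₂ : Pros Y' U'}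
    {t : Pros X U} {m : Pros X' U'} (e₁ : p.append p' = t₁) (e₁' : q.append q' = m₁)
    (e₂ : p'.append p'' = t₂) (e₂' : q'.append q'' = m₂) (e : t₁.append p'' = t)
    (e' : m₁.append q'' = m) (i : p.append t₂ = t) (i' : q.append m₂ = m) :
    (Γ.append Δ e₁ e₁').append Θ e e' = Γ.append (Δ.append Θ e₂ e₂') i i' := by
  induction Γ with
  | nil f => cases e₁; cases e₁'; cases e₂; cases e₂'; cases e; cases e'; rfl
  | cons α Γ e₀ ih =>
    subst e₀ e₁ e₁' e₂ e₂' e i'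
    refine (CellPath.cons_append α (Γ.append Δ rfl rfl) (ProPath.append_assoc _ _ _).symm Θ rfl e'
      rfl (ProPath.append_assoc _ _ _) (by simp only [ProPath.append_assoc])).trans ?_
    refine Eq.trans ?_ (CellPath.cons_append α Γ rfl (Δ.append Θ rfl rfl) i rfl
      (ProPath.append_assoc _ _ _).symm rfl (by simp only [ProPath.append_assoc])).symm
    congr 1
    exact ih Δ rfl rfl rfl rfl rfl _ _ rfl

theorem CellPath.ids_append {X Y Z : E} (p : Pros X Y) (q : Pros Y Z) :
    CellPath.ids (p.append q) = (CellPath.ids p).append (CellPath.ids q) rfl rfl := by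
  induction p with
  | nil => rfl
  | cons J p ih => exact congrArg (fun Γ => CellPath.cons (idCell J) Γ rfl) (ih q)

theorem CellPath.whisker_eq_append {X Y Z W : E} (l : Pros X Y) {p : Pros Y Z} {J : Pro Y Z}
    (μ : Cell p (𝟙 Y) (𝟙 Z) J) (r : Pros Z W) :
    CellPath.whisker l μ r = (CellPath.ids l).append (.cons μ (.ids r) rfl) rfl rfl := by
  induction l with
  | nil => rfl
  | cons H l ih => exact congrArg (fun Γ => CellPath.cons (idCell H) Γ rfl) (ih μ)

/-- `Stack Γ Δ Θ`: the list of 2-cells `Θ` is obtained by pasting the list `Γ` on top of the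
list `Δ`. The vertical boundaries of the members of `Θ` are only required to be equal to the
composites of those of `Γ` and `Δ`, which spares transports. -/
inductive Stack : {X V X' V' X'' V'' : E} → {p : Pros X V} → {f : X ⟶ X'} → {h : V ⟶ V'} →
    {m : Pros X' V'} → {f' : X' ⟶ X''} → {h' : V' ⟶ V''} → {r : Pros X'' V''} → {a : X ⟶ X''} →
    {c : V ⟶ V''} → CellPath p f h m → CellPath m f' h' r → CellPath p a c r → Prop
  | nil {X X' X'' : E} {f : X ⟶ X'} {f' : X' ⟶ X''} {a : X ⟶ X''} (e : f ≫ f' = a) :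
      Stack (.nil f) (.nil f') (.nil a)
  | cons {X Y V X' Y' V' X'' Y'' V'' : E} {p₁ : Pros X Y} {p₂ : Pros Y V} {p : Pros X V}
      {f : X ⟶ X'} {f' : X' ⟶ X''} {g : Y ⟶ Y'} {g' : Y' ⟶ Y''} {h : V ⟶ V'} {h' : V' ⟶ V''}
      {a : X ⟶ X''} {b : Y ⟶ Y''} {c : V ⟶ V''}
      {m₁ : Pros X' Y'} {m₂ : Pros Y' V'} {m : Pros X' V'} {K : Pro X'' Y''} {r : Pros Y'' V''}
      {Γ : CellPath p₁ f g m₁} {α : Cell m₁ f' g' K} {γ : Cell p₁ a b K}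
      {Γ' : CellPath p₂ g h m₂} {Δ : CellPath m₂ g' h' r} {Θ : CellPath p₂ b c r}
      (e : p₁.append p₂ = p) (e' : m₁.append m₂ = m) (ha : f ≫ f' = a) (hb : g ≫ g' = b)
      (hγ : paste Γ α ha hb = γ) (S : Stack Γ' Δ Θ) :
      Stack (Γ.append Γ' e e') (.cons α Δ e') (.cons γ Θ e)

namespace Stack

variable {X V X' V' X'' V'' : E} {p : Pros X V} {f : X ⟶ X'} {h : V ⟶ V'} {m : Pros X' V'}
  {f' : X' ⟶ X''} {h' : V' ⟶ V''} {r : Pros X'' V''} {a : X ⟶ X''} {c : V ⟶ V''}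
  {Γ : CellPath p f h m} {Δ : CellPath m f' h' r} {Θ : CellPath p a c r}

theorem boundaries (S : Stack Γ Δ Θ) : f ≫ f' = a ∧ h ≫ h' = c := by
  induction S with
  | nil e => exact ⟨e, e⟩
  | cons e e' ha hb hγ S ih => exact ⟨ha, ih.2⟩

theorem exists_pasting (S : Stack Γ Δ Θ) :
    ∃ N : Pasting p f f' h h' m r, N.upper = Γ ∧ N.lower = Δ ∧ HEq N.composite Θ := by
  induction S with
  | nil e => subst e; exact ⟨.nil _ _, rfl, rfl, HEq.rfl⟩
  | @cons _ _ _ _ _ _ _ _ _ _ _ _ _ _ _ _ _ _ _ _ _ _ _ _ _ _ Γ α _ _ _ _ e e' ha hb hγ S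
      ih =>
    obtain ⟨N, rfl, rfl, hN⟩ := ih
    have hc := S.boundaries.2
    subst ha hb hγ hc
    cases hN
    exact ⟨.cons Γ α N e e', rfl, rfl, HEq.rfl⟩

/-- Associativity of pasting in terms of stacked lists. -/
theorem paste_paste (S : Stack Γ Δ Θ) {Z W : E} {f'' : X'' ⟶ Z} {h'' : V'' ⟶ W} {K : Pro Z W}
    (β : Cell r f'' h'' K) {s : X' ⟶ Z} {t : V' ⟶ W} {i : X ⟶ Z} {j : V ⟶ W}
    (hs : f' ≫ f'' = s) (ht : h' ≫ h'' = t) (hi : f ≫ s = i) (hj : h ≫ t = j)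
    (hi' : a ≫ f'' = i) (hj' : c ≫ h'' = j) :
    paste Γ (paste Δ β hs ht) hi hj = paste Θ β hi' hj' := by
  obtain ⟨N, rfl, rfl, hN⟩ := S.exists_pasting
  obtain ⟨rfl, rfl⟩ := S.boundaries
  cases hN
  subst hs ht hi hj
  refine Eq.trans ?_ (congrArg (fun θ => Cell.cast θ hi' hj')
    (VirtualDoubleCategory.paste_assoc N β))
  exact (Cell.cast_cast _ _ _ _ _).symm

theorem cons_single {Y Y' Y'' : E} {p₁ : Pros X Y} {p₂ : Pros Y V} {g : Y ⟶ Y'} {g' : Y' ⟶ Y''}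
    {b : Y ⟶ Y''} {J : Pro X' Y'} {m₂ : Pros Y' V'} {K : Pro X'' Y''} {r : Pros Y'' V''}
    {α : Cell p₁ f g J} {β : Cell (.one J) f' g' K} {γ : Cell p₁ a b K}
    {Γ' : CellPath p₂ g h m₂} {Δ : CellPath m₂ g' h' r} {Θ : CellPath p₂ b c r}
    (e : p₁.append p₂ = p) (ha : f ≫ f' = a) (hb : g ≫ g' = b)
    (hγ : paste (.single α) β ha hb = γ) (S : Stack Γ' Δ Θ) :
    Stack (.cons α Γ' e) (.cons β Δ rfl) (.cons γ Θ e) :=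
  Stack.cons (Γ := .single α) e rfl ha hb hγ S

theorem cons_pair {Y Y' Y'' U U' : E} {p₁ : Pros X Y} {p₂ : Pros Y U} {p₃ : Pros U V}
    {t : Pros X U} {t' : Pros Y V} {g : Y ⟶ Y'}
    {k : U ⟶ U'} {k' : U' ⟶ Y''} {b : U ⟶ Y''} {J : Pro X' Y'} {J' : Pro Y' U'}
    {m₂ : Pros U' V'} {K : Pro X'' Y''} {r : Pros Y'' V''}
    {α : Cell p₁ f g J} {α' : Cell p₂ g k J'} {β : Cell (.two J J') f' k' K} {γ : Cell t a b K}
    {Γ' : CellPath p₃ k h m₂} {Δ : CellPath m₂ k' h' r} {Θ : CellPath p₃ b c r}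
    (e₁ : p₁.append p₂ = t) (e₂ : p₂.append p₃ = t') (e : p₁.append t' = p)
    (e' : t.append p₃ = p) (ha : f ≫ f' = a) (hb : k ≫ k' = b)
    (hγ : paste (.pair α α' e₁) β ha hb = γ) (S : Stack Γ' Δ Θ) :
    Stack (.cons α (.cons α' Γ' e₂) e) (.cons β Δ rfl) (.cons γ Θ e') := by
  subst e₁ e₂
  exact Stack.cons (Γ := .pair α α' rfl) e' rfl ha hb hγ S

theorem cons_nil {Y'' : E} {g' : X' ⟶ Y''} {b : X ⟶ Y''} {K : Pro X'' Y''} {r : Pros Y'' V''}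
    {β : Cell (.nil X') f' g' K} {γ : Cell (.nil X) a b K}
    {Γ' : CellPath p f h m} {Δ : CellPath m g' h' r} {Θ : CellPath p b c r}
    (ha : f ≫ f' = a) (hb : f ≫ g' = b)
    (hγ : paste (.nil f) β ha hb = γ) (S : Stack Γ' Δ Θ) :
    Stack Γ' (.cons β Δ rfl) (.cons γ Θ rfl) :=
  Stack.cons (Γ := .nil f) rfl rfl ha hb hγ S

theorem append {U U' U'' : E} (S : Stack Γ Δ Θ) {p₂ : Pros V U} {k : U ⟶ U'} {m₂ : Pros V' U'}
    {k' : U' ⟶ U''} {r₂ : Pros V'' U''} {d : U ⟶ U''} {Γ₂ : CellPath p₂ h k m₂}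
    {Δ₂ : CellPath m₂ h' k' r₂} {Θ₂ : CellPath p₂ c d r₂} (S₂ : Stack Γ₂ Δ₂ Θ₂)
    {t : Pros X U} {m' : Pros X' U'} {r' : Pros X'' U''} (e : p.append p₂ = t)
    (e' : m.append m₂ = m') (e'' : r.append r₂ = r') :
    Stack (Γ.append Γ₂ e e') (Δ.append Δ₂ e' e'') (Θ.append Θ₂ e e'') := by
  induction S with
  | nil _ => subst e e' e''; exact S₂
  | cons e₀ e₀' ha hb hγ S ih =>
    subst e₀ e₀' e'' e e'
    rw [CellPath.append_assoc (e₂ := rfl) (e₂' := rfl) (i := (ProPath.append_assoc _ _ _).symm)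
      (i' := (ProPath.append_assoc _ _ _).symm)]
    exact Stack.cons _ _ ha hb hγ (ih S₂ rfl rfl rfl)

theorem ids_right {X Y X' Y' : E} {p : Pros X Y} {f : X ⟶ X'} {g : Y ⟶ Y'} {q : Pros X' Y'}
    (Γ : CellPath p f g q) : Stack Γ (CellPath.ids q) Γ := by
  induction Γ with
  | nil f => exact .nil (by simp)
  | cons α Γ e ih =>
    exact .cons_single e (by simp) (by simp) (VirtualDoubleCategory.paste_id α) ih

theorem ids_left {X Y X' Y' : E} {p : Pros X Y} {f : X ⟶ X'} {g : Y ⟶ Y'} {q : Pros X' Y'}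
    (Γ : CellPath p f g q) : Stack (CellPath.ids p) Γ Γ := by
  induction Γ with
  | nil f => exact .nil (by simp)
  | cons α Γ e ih =>
    subst e
    rw [CellPath.ids_append]
    exact .cons rfl rfl (by simp) (by simp) (VirtualDoubleCategory.ids_paste α) ih

end Stack

end Stacking

/-! ### Cartesian 2-cells and composites -/

section Universal

variable {E : Type u} [Category.{v} E] [VirtualDoubleCategory.{u, v, w, z} E]

section Cartesian

variable {X Y Z W : E} {P : Pro X Y} {f : X ⟶ Z} {g : Y ⟶ W} {K : Pro Z W}
  {χ : Cell (.one P) f g K}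

theorem IsCartesian.existsUnique (hχ : IsCartesian χ) {X' Y' : E} {s : X' ⟶ X} {t : Y' ⟶ Y}
    {p : Pros X' Y'} {a : X' ⟶ Z} {b : Y' ⟶ W} (φ : Cell p a b K) (ha : s ≫ f = a)
    (hb : t ≫ g = b) : ∃! ψ : Cell p s t P, paste (.single ψ) χ ha hb = φ := by
  subst ha hb; exact hχ s t p φ

/-- The factorization of a 2-cell through a cartesian one. -/
noncomputable def IsCartesian.lift (hχ : IsCartesian χ) {X' Y' : E} {s : X' ⟶ X} {t : Y' ⟶ Y}
    {p : Pros X' Y'} {a : X' ⟶ Z} {b : Y' ⟶ W} (φ : Cell p a b K) (ha : s ≫ f = a)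
    (hb : t ≫ g = b) : Cell p s t P :=
  (hχ.existsUnique φ ha hb).choose

theorem IsCartesian.lift_paste (hχ : IsCartesian χ) {X' Y' : E} {s : X' ⟶ X} {t : Y' ⟶ Y}
    {p : Pros X' Y'} {a : X' ⟶ Z} {b : Y' ⟶ W} (φ : Cell p a b K) (ha : s ≫ f = a)
    (hb : t ≫ g = b) : paste (.single (hχ.lift φ ha hb)) χ ha hb = φ :=
  (hχ.existsUnique φ ha hb).choose_spec.1

theorem IsCartesian.hom_ext (hχ : IsCartesian χ) {X' Y' : E} {s : X' ⟶ X} {t : Y' ⟶ Y}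
    {p : Pros X' Y'} {a : X' ⟶ Z} {b : Y' ⟶ W} (ha : s ≫ f = a) (hb : t ≫ g = b)
    {ψ ψ' : Cell p s t P} (h : paste (.single ψ) χ ha hb = paste (.single ψ') χ ha hb) :
    ψ = ψ' :=
  (hχ.existsUnique _ ha hb).unique h rfl

end Cartesian

theorem IsComposite.existsUnique {X Y : E} {p : Pros X Y} {J : Pro X Y}
    {μ : Cell p (𝟙 X) (𝟙 Y) J} (hμ : IsComposite μ) {Z W Z' W' : E} (l : Pros Z X) (r : Pros Y W)
    {n m : Pros Z W} (e : l.append (p.append r) = n) (e' : l.append (.cons J r) = m)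
    {f : Z ⟶ Z'} {g : W ⟶ W'} {K : Pro Z' W'} (φ : Cell n f g K) :
    ∃! ψ : Cell m f g K,
      paste ((CellPath.ids l).append (.cons μ (.ids r) rfl) e e') ψ (by simp) (by simp) = φ := by
  subst e e'
  simpa only [CellPath.whisker_eq_append] using hμ l r f g K φ

theorem IsComposite.hom_ext {X Y : E} {p : Pros X Y} {J : Pro X Y}
    {μ : Cell p (𝟙 X) (𝟙 Y) J} (hμ : IsComposite μ) {Z W Z' W' : E} (l : Pros Z X) (r : Pros Y W)
    {n m : Pros Z W} (e : l.append (p.append r) = n) (e' : l.append (.cons J r) = m)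
    {f : Z ⟶ Z'} {g : W ⟶ W'} {K : Pro Z' W'} {ψ ψ' : Cell m f g K}
    (h : paste ((CellPath.ids l).append (.cons μ (.ids r) rfl) e e') ψ (by simp) (by simp) =
      paste ((CellPath.ids l).append (.cons μ (.ids r) rfl) e e') ψ' (h := f) (k := g)
        (by simp) (by simp)) : ψ = ψ' :=
  (hμ.existsUnique l r e e' _).unique h rfl

/-- Two composites of the same list are isomorphic: the comparison 2-cells are mutually inverse
by uniqueness of factorizations. -/
theorem IsComposite.exists_proIso {X Y : E} {p : Pros X Y} {P Q : Pro X Y}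
    {ν : Cell p (𝟙 X) (𝟙 Y) P} {μ : Cell p (𝟙 X) (𝟙 Y) Q} (hν : IsComposite ν)
    (hμ : IsComposite μ) : ∃ i : ProIso P Q, paste (.single ν) i.hom = μ := by
  have whisker_nil : ∀ {R : Pro X Y} (θ : Cell p (𝟙 X) (𝟙 Y) R) {t : Pros X Y}
      (e : p.append (.nil Y) = t), (CellPath.ids (.nil X)).append
        (.cons θ (.ids (.nil Y)) rfl) e rfl = CellPath.cons θ (.nil (𝟙 Y)) e := by
    intro R θ t e
    subst e
    rfl
  have factor : ∀ {R S : Pro X Y} {θ : Cell p (𝟙 X) (𝟙 Y) R} (_ : IsComposite θ)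
      (φ : Cell p (𝟙 X) (𝟙 Y) S), ∃! ψ : Cell (.one R) (𝟙 X) (𝟙 Y) S,
        paste (.single θ) ψ = φ := by
    intro R S θ hθ φ
    have := hθ.existsUnique (.nil X) (.nil Y) p.append_nil rfl φ
    rwa [whisker_nil] at this
  obtain ⟨i, hi, -⟩ := factor hν μ
  obtain ⟨j, hj, -⟩ := factor hμ ν
  refine ⟨⟨i, j, (factor hν ν).unique ?_ (VirtualDoubleCategory.paste_id ν),
    (factor hμ μ).unique ?_ (VirtualDoubleCategory.paste_id μ)⟩, hi⟩
  · rw [← paste_single_paste (.single ν) i j (a := 𝟙 X) (b := 𝟙 Y) (c := 𝟙 X) (d := 𝟙 Y)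
      (by simp) (by simp) (by simp) (by simp) (by simp) (by simp), hi, hj]
  · rw [← paste_single_paste (.single μ) j i (a := 𝟙 X) (b := 𝟙 Y) (c := 𝟙 X) (d := 𝟙 Y)
      (by simp) (by simp) (by simp) (by simp) (by simp) (by simp), hj, hi]

end Universal

/-! ### The action of units on proarrows -/

section UnitActions

variable {E : Type u} [Category.{v} E] [VirtualEquipment.{u, v, w, z} E]

theorem ProPath.nil_append {A Y : E} (r : Pros A Y) : (ProPath.nil A).append r = r := rfl

/-- 2-cells out of a list containing a unit proarrow are determined by their restriction along
the insertion of the unit 2-cell. -/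
theorem unit_hom_ext_at {A X Y : E} (l : Pros X A) (r : Pros A Y) {n m : Pros X Y}
    (e : l.append r = n) (e' : l.append (.cons (unitPro A) r) = m) {Z W : E} {f : X ⟶ Z}
    {g : Y ⟶ W} {K : Pro Z W} {ψ ψ' : Cell m f g K}
    (h : paste ((CellPath.ids l).append (.cons (unitCell A) (.ids r) (ProPath.nil_append r)) e e') ψ
        (by simp) (by simp) =
      paste ((CellPath.ids l).append (.cons (unitCell A) (.ids r) (ProPath.nil_append r)) e e') ψ'
        (h := f) (k := g) (by simp) (by simp)) : ψ = ψ' :=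
  IsComposite.hom_ext (unitCell_isComposite A) l r e e' h

/-- The canonical 2-cell `h_A, H → H`. -/
noncomputable def unitLact {A B : E} (H : Pro A B) :
    Cell (.two (unitPro A) H) (𝟙 A) (𝟙 B) H :=
  (IsComposite.existsUnique (unitCell_isComposite A) (.nil A) (.one H) rfl rfl (idCell H)).choose

theorem unitCell_lact {A B : E} (H : Pro A B) :
    paste (.pair (unitCell A) (idCell H) rfl) (unitLact H) = idCell H :=
  (IsComposite.existsUnique (unitCell_isComposite A) (.nil A) (.one H) rfl rfl
    (idCell H)).choose_spec.1

/-- The canonical 2-cell `H, h_B → H`. -/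
noncomputable def unitRact {A B : E} (H : Pro A B) :
    Cell (.two H (unitPro B)) (𝟙 A) (𝟙 B) H :=
  (IsComposite.existsUnique (unitCell_isComposite B) (.one H) (.nil B) rfl rfl (idCell H)).choose

theorem unitCell_ract {A B : E} (H : Pro A B) :
    paste (.pair (idCell H) (unitCell B) rfl) (unitRact H) = idCell H :=
  (IsComposite.existsUnique (unitCell_isComposite B) (.one H) (.nil B) rfl rfl
    (idCell H)).choose_spec.1

theorem nil_unit_lact {A B X Y : E} {H : Pro A B} {p : Pros X Y} {f : X ⟶ A} {g : Y ⟶ B}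
    (φ : Cell p f g H) :
    paste (.pair (paste (h := f) (k := f) (.nil f) (unitCell A)) φ rfl) (unitLact H) = φ := by
  have h := paste_pair_paste (.nil f) (.single φ) rfl rfl (unitCell A) (idCell H)
    (unitLact H) (a := f) (b := f) (c := g) (i := f) (j := g) (s := 𝟙 A) (t := 𝟙 B)
    (by simp) (by simp) (by simp) (by simp) (by simp) (by simp) (by simp)
  rw [unitCell_lact, VirtualDoubleCategory.paste_id] at h
  exact h.trans (VirtualDoubleCategory.paste_id φ)

theorem nil_unit_ract {A B X Y : E} {H : Pro A B} {p : Pros X Y} {f : X ⟶ A} {g : Y ⟶ B}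
    (φ : Cell p f g H) :
    paste (.pair φ (paste (h := g) (k := g) (.nil g) (unitCell B)) p.append_nil) (unitRact H) =
      φ := by
  have h := paste_pair_paste (.single φ) (.nil g) p.append_nil rfl (idCell H)
    (unitCell B) (unitRact H) (a := f) (b := g) (c := g) (i := f) (j := g) (s := 𝟙 A) (t := 𝟙 B)
    (by simp) (by simp) (by simp) (by simp) (by simp) (by simp) (by simp)
  rw [unitCell_ract, VirtualDoubleCategory.paste_id] at h
  exact h.trans (VirtualDoubleCategory.paste_id φ)

theorem unit_lact {A B Y : E} {H : Pro A B} {p : Pros A Y} {g : Y ⟶ B} (φ : Cell p (𝟙 A) g H) :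
    paste (.pair (unitCell A) φ rfl) (unitLact H) = φ := by
  have h1 : paste (.nil (𝟙 A)) (unitCell A) = unitCell A := VirtualDoubleCategory.ids_paste _
  exact (congrArg (fun θ => paste (.pair θ φ rfl) (unitLact H)) h1.symm).trans (nil_unit_lact φ)

theorem unit_ract {A B X : E} {H : Pro A B} {p : Pros X B} {f : X ⟶ A} (φ : Cell p f (𝟙 B) H) :
    paste (.pair φ (unitCell B) p.append_nil) (unitRact H) = φ := by
  have h1 : paste (.nil (𝟙 B)) (unitCell B) = unitCell B := VirtualDoubleCategory.ids_paste _
  exact (congrArg (fun θ => paste (.pair φ θ p.append_nil) (unitRact H)) h1.symm).trans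
    (nil_unit_ract φ)

theorem unitLact_mul {A B : E} (H : Pro A B) :
    paste (p := .three (unitPro A) (unitPro A) H) (h := 𝟙 A) (k := 𝟙 B)
        (.pair (unitMul A) (idCell H) rfl) (unitLact H) =
      paste (.pair (idCell (unitPro A)) (unitLact H) rfl) (unitLact H) := by
  refine unit_hom_ext_at (.nil A) (.two (unitPro A) H) rfl rfl ?_
  refine (Stack.paste_paste (.cons_pair rfl rfl rfl rfl (by simp) (by simp)
      (unitCell_mul A) (.ids_right _)) _ _ _ _ _ (by simp) (by simp)).trans ?_
  refine Eq.trans ?_ (Stack.paste_paste (.cons_single rfl (by simp) (by simp)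
      (VirtualDoubleCategory.paste_id _)
      (.cons (Γ := .ids (.two (unitPro A) H)) (Γ' := .nil (𝟙 B)) rfl rfl (by simp) (by simp)
        (VirtualDoubleCategory.ids_paste _) (.nil (by simp)))) _ _ _ _ _
        (by simp) (by simp)).symm
  exact (VirtualDoubleCategory.ids_paste _).trans (unit_lact _).symm

theorem unitLact_ract {A B : E} (H : Pro A B) :
    paste (p := .three (unitPro A) H (unitPro B)) (h := 𝟙 A) (k := 𝟙 B)
        (.pair (unitLact H) (idCell (unitPro B)) rfl) (unitRact H) =
      paste (.pair (idCell (unitPro A)) (unitRact H) rfl) (unitLact H) := by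
  refine unit_hom_ext_at (.nil A) (.two H (unitPro B)) rfl rfl ?_
  refine (Stack.paste_paste (.cons_pair rfl rfl rfl rfl (by simp) (by simp)
      (unitCell_lact H) (.ids_right _)) _ _ _ _ _ (by simp) (by simp)).trans ?_
  refine Eq.trans ?_ (Stack.paste_paste (.cons_single rfl (by simp) (by simp)
      (VirtualDoubleCategory.paste_id _)
      (.cons (Γ := .ids (.two H (unitPro B))) (Γ' := .nil (𝟙 B)) rfl rfl (by simp) (by simp)
        (VirtualDoubleCategory.ids_paste _) (.nil (by simp)))) _ _ _ _ _
        (by simp) (by simp)).symm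
  exact (VirtualDoubleCategory.ids_paste _).trans (unit_lact _).symm

theorem unitRact_mul {A B : E} (H : Pro A B) :
    paste (p := .three H (unitPro B) (unitPro B)) (h := 𝟙 A) (k := 𝟙 B)
        (.pair (unitRact H) (idCell (unitPro B)) rfl) (unitRact H) =
      paste (.pair (idCell H) (unitMul B) rfl) (unitRact H) := by
  refine unit_hom_ext_at (.two H (unitPro B)) (.nil B) rfl rfl ?_
  refine (Stack.paste_paste (.cons (Γ := .ids (.two H (unitPro B))) rfl rfl
      (Category.id_comp _) (Category.id_comp _) (VirtualDoubleCategory.ids_paste _)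
      (.cons_single rfl (by simp) (by simp) (VirtualDoubleCategory.paste_id (unitCell B))
        (.nil (by simp)))) _ _ _ _ _ (by simp) (by simp)).trans ?_
  refine Eq.trans ?_ (Stack.paste_paste (.cons_single rfl (by simp) (by simp)
      (VirtualDoubleCategory.paste_id (idCell H)) (.cons_pair rfl rfl rfl rfl (by simp) (by simp)
      (unitMul_cell B) (.nil (by simp)))) (unitRact H) _ _ _ _
        (Category.id_comp (𝟙 A)) (Category.id_comp (𝟙 B))).symm
  exact (unit_ract _).trans (VirtualDoubleCategory.ids_paste _).symm

/-- The 2-cell `h_f : h_A → h_Z` induced by a vertical arrow `f`. -/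
noncomputable def unitHom {A Z : E} (f : A ⟶ Z) : Cell (.one (unitPro A)) f f (unitPro Z) :=
  (IsComposite.existsUnique (unitCell_isComposite A) (.nil A) (.nil A) rfl rfl
    (paste (h := f) (k := f) (.nil f) (unitCell Z))).choose

theorem unitCell_hom {A Z : E} (f : A ⟶ Z) :
    paste (h := f) (k := f) (.single (unitCell A)) (unitHom f) = paste (.nil f) (unitCell Z) :=
  (IsComposite.existsUnique (unitCell_isComposite A) (.nil A) (.nil A) rfl rfl
    (paste (h := f) (k := f) (.nil f) (unitCell Z))).choose_spec.1

theorem unitMul_hom {A Z : E} (f : A ⟶ Z) :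
    paste (h := f) (k := f) (.single (unitMul A)) (unitHom f) =
      paste (.pair (unitHom f) (unitHom f) rfl) (unitMul Z) := by
  refine unit_hom_ext_at (.nil A) (.one (unitPro A)) rfl rfl ?_
  refine (Stack.paste_paste (.cons_pair rfl rfl rfl rfl (by simp) (by simp)
      (unitCell_mul A) (.nil (by simp))) _ _ _ _ _ (by simp) (by simp)).trans ?_
  refine Eq.trans ?_ (Stack.paste_paste (.cons_single rfl (by simp) (by simp)
      (unitCell_hom f) (.ids_left (.single (unitHom f)))) _ _ _ _ _ (by simp) (by simp)).symm
  exact (VirtualDoubleCategory.ids_paste _).trans (nil_unit_pair_mul _).symm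

/-- Between two proarrows of a list it makes no difference on which of them a unit acts. -/
theorem unitRact_unitLact {X A B C Y : E} (l : Pros X A) (H : Pro A B) (K : Pro B C)
    (r : Pros C Y) {m : Pros X Y} {n : Pros X Y} (e : l.append (.cons H (.cons K r)) = m)
    (e' : l.append (.cons H (.cons (unitPro B) (.cons K r))) = n) {Z W : E} {f : X ⟶ Z}
    {g : Y ⟶ W} {M : Pro Z W} (φ : Cell m f g M) :
    paste ((CellPath.ids l).append
        (.cons (idCell H) (.cons (unitLact K) (.ids r) rfl) rfl) e' e) φ (h := f) (k := g)
        (by simp) (by simp) =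
      paste ((CellPath.ids l).append
        (.cons (unitRact H) (.cons (idCell K) (.ids r) rfl) rfl) e' e) φ (by simp) (by simp) := by
  have e₁ : (l.append (.one H)).append (.cons K r) = m := by rw [ProPath.append_assoc]; exact e
  have e₂ : (l.append (.one H)).append (.cons (unitPro B) (.cons K r)) = n := by
    rw [ProPath.append_assoc]; exact e'
  refine unit_hom_ext_at (l.append (.one H)) (.cons K r) e₁ e₂ ?_
  rw [CellPath.ids_append, CellPath.append_assoc (e₂ := rfl) (e₂' := rfl) (i := e) (i' := e')]
  have S₁ : Stack (.cons (idCell H) (.cons (unitCell B) (.ids (.cons K r))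
      (ProPath.nil_append (.cons K r))) rfl)
      (.cons (idCell H) (.cons (unitLact K) (.ids r) rfl) rfl) (.ids (.cons H (.cons K r))) :=
    .cons_single rfl (by simp) (by simp) (VirtualDoubleCategory.paste_id _)
      (.cons_pair rfl rfl rfl rfl (by simp) (by simp) (unitCell_lact K) (.ids_right _))
  have S₂ : Stack (.cons (idCell H) (.cons (unitCell B) (.ids (.cons K r))
      (ProPath.nil_append (.cons K r))) rfl)
      (.cons (unitRact H) (.cons (idCell K) (.ids r) rfl) rfl) (.ids (.cons H (.cons K r))) :=
    .cons_pair rfl rfl rfl rfl (by simp) (by simp) (unitCell_ract H) (.ids_right _)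
  exact (((Stack.ids_left (.ids l)).append S₁ e e' e).paste_paste φ _ _ _ _
    (by simp) (by simp)).trans
    (((Stack.ids_left (.ids l)).append S₂ e e' e).paste_paste φ _ _ _ _ (by simp) (by simp)).symm

theorem unitLact_paste {A B Y : E} (H : Pro A B) (r : Pros B Y) {Z W : E} {f : A ⟶ Z}
    {g : Y ⟶ W} {M : Pro Z W} (φ : Cell (.cons H r) f g M) :
    paste (h := f) (k := g) (.cons (unitLact H) (.ids r) rfl) φ =
      paste (.pair (unitHom f) φ rfl) (unitLact M) := by
  refine unit_hom_ext_at (.nil A) (.cons H r) rfl rfl ?_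
  refine (Stack.paste_paste (.cons_pair rfl rfl rfl rfl (by simp) (by simp)
    (unitCell_lact H) (.ids_right _)) φ _ _ _ _ (by simp) (by simp)).trans ?_
  have h := paste_pair_paste (.single (unitCell A)) (.ids (.cons H r)) rfl rfl (unitHom f) φ
    (unitLact M) (a := f) (b := f) (c := g) (i := f) (j := g) (s := f) (t := g)
    (by simp) (by simp) (by simp) (by simp) (by simp) (by simp) (by simp)
  rw [unitCell_hom, VirtualDoubleCategory.ids_paste, nil_unit_lact] at h
  exact (VirtualDoubleCategory.ids_paste φ).trans h

theorem unitRact_paste {X A B : E} (l : Pros X A) (H : Pro A B) {m n : Pros X B}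
    (e : l.append (.one H) = m) (e' : l.append (.two H (unitPro B)) = n)
    (e'' : m.append (.one (unitPro B)) = n) {Z W : E} {f : X ⟶ Z}
    {g : B ⟶ W} {M : Pro Z W} (φ : Cell m f g M) :
    paste (h := f) (k := g) ((CellPath.ids l).append (.single (unitRact H)) e' e) φ
        (by simp) (by simp) =
      paste (.pair φ (unitHom g) e'') (unitRact M) := by
  refine unit_hom_ext_at m (.nil B) m.append_nil e'' ?_
  have h := paste_pair_paste (.ids m) (.single (unitCell B)) m.append_nil e'' φ (unitHom g)
    (unitRact M) (a := f) (b := g) (c := g) (i := f) (j := g) (s := f) (t := g)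
    (by simp) (by simp) (by simp) (by simp) (by simp) (by simp) (by simp)
  rw [unitCell_hom, VirtualDoubleCategory.ids_paste, nil_unit_ract] at h
  refine Eq.trans ?_ h
  subst e
  rw [CellPath.ids_append, CellPath.append_assoc (t₂ := .one H) (m₂ := .two H (unitPro B))
    (e₂ := rfl) (e₂' := rfl) (i := rfl) (i' := e')]
  refine (Stack.paste_paste ((Stack.ids_left (.ids l)).append
    (Stack.cons_pair rfl rfl rfl rfl (by simp) (by simp) (unitCell_ract H) (.nil (by simp)))
    rfl e' rfl) φ _ _ _ _ (by simp) (by simp)).trans ?_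
  have h' := VirtualDoubleCategory.ids_paste φ
  rwa [CellPath.ids_append] at h'

theorem unitLact_unitRact_nil {X Z W : E} {f : X ⟶ Z} {g : X ⟶ W} {M : Pro Z W}
    (φ : Cell (.nil X) f g M) :
    paste (h := f) (k := g) (.pair (unitHom f) φ rfl) (unitLact M) =
      paste (.pair φ (unitHom g) rfl) (unitRact M) := by
  refine unit_hom_ext_at (.nil X) (.nil X) rfl rfl ?_
  have h := paste_pair_paste (.single (unitCell X)) (.ids (.nil X)) rfl rfl (unitHom f) φ
    (unitLact M) (a := f) (b := f) (c := g) (i := f) (j := g) (s := f) (t := g)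
    (by simp) (by simp) (by simp) (by simp) (by simp) (by simp) (by simp)
  have h' := paste_pair_paste (.ids (.nil X)) (.single (unitCell X)) rfl rfl φ (unitHom g)
    (unitRact M) (a := f) (b := g) (c := g) (i := f) (j := g) (s := f) (t := g)
    (by simp) (by simp) (by simp) (by simp) (by simp) (by simp) (by simp)
  rw [unitCell_hom, VirtualDoubleCategory.ids_paste, nil_unit_lact] at h
  rw [unitCell_hom, VirtualDoubleCategory.ids_paste] at h'
  exact h.symm.trans ((nil_unit_ract φ).symm.trans h')

end UnitActions

/-! ### Represented functors and profunctors -/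

section Represented

variable {E : Type u} [Category.{v} E] [VirtualEquipment.{u, v, w, z} E]

theorem paste_nil_id {X Z W : E} {f : X ⟶ Z} {g : X ⟶ W} {K : Pro Z W} (β : Cell (.nil X) f g K) :
    paste (.nil (𝟙 X)) β = β :=
  VirtualDoubleCategory.ids_paste β

theorem id_paste {X Y Z W : E} {J : Pro X Y} {f : X ⟶ Z} {g : Y ⟶ W} {K : Pro Z W}
    (β : Cell (.one J) f g K) : paste (.single (idCell J)) β = β :=
  VirtualDoubleCategory.ids_paste β

theorem unitHom_id (A : E) : unitHom (𝟙 A) = idCell (unitPro A) := by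
  refine unit_hom_ext_at (.nil A) (.nil A) rfl rfl ?_
  exact (unitCell_hom (𝟙 A)).trans ((paste_nil_id _).trans
    (VirtualDoubleCategory.paste_id (unitCell A)).symm)

/-- The vertical arrow into `A` that an object of `|A|` is. -/
def structArr {A : E} (a : (represent A).Obj) : (represent A).ext a ⟶ A := Sigma.snd a

/-- The cartesian 2-cell from a hom of `|A|` to the unit of `A`. -/
noncomputable def homCart {A : E} (a a' : (represent A).Obj) :
    Cell (.one ((represent A).hom a a')) (structArr a) (structArr a') (unitPro A) :=
  reprCart (structArr a) (structArr a')

theorem homCart_isCartesian {A : E} (a a' : (represent A).Obj) : IsCartesian (homCart a a') :=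
  reprCart_isCartesian _ _

theorem id_homCart {A : E} (a : (represent A).Obj) :
    paste (h := structArr a) (k := structArr a) (.single ((represent A).id a)) (homCart a a) =
      paste (.nil (structArr a)) (unitCell A) :=
  reprLift_cart _

theorem comp_homCart {A : E} (a b c : (represent A).Obj) :
    paste (h := structArr a) (k := structArr c) (.single ((represent A).comp a b c))
        (homCart a c) =
      paste (.pair (homCart a b) (homCart b c) rfl) (unitMul A) :=
  reprLift_cart _

theorem paste_comp_homCart {A : E} {a b c : (represent A).Obj} {X Y Z : E} {p : Pros X Y}
    {q : Pros Y Z} {t : Pros X Z} {f : X ⟶ (represent A).ext a} {g : Y ⟶ (represent A).ext b}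
    {h : Z ⟶ (represent A).ext c} (φ : Cell p f g ((represent A).hom a b))
    (ψ : Cell q g h ((represent A).hom b c)) (e : p.append q = t) {f' : X ⟶ A} {g' : Y ⟶ A}
    {h' : Z ⟶ A} (hf : f ≫ structArr a = f') (hg : g ≫ structArr b = g')
    (hh : h ≫ structArr c = h') {φ' : Cell p f' g' (unitPro A)} {ψ' : Cell q g' h' (unitPro A)}
    (hφ : paste (.single φ) (homCart a b) hf hg = φ')
    (hψ : paste (.single ψ) (homCart b c) hg hh = ψ') :
    paste (.single (paste (h := f) (k := h) (.pair φ ψ e) ((represent A).comp a b c)))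
        (homCart a c) hf hh =
      paste (.pair φ' ψ' e) (unitMul A) := by
  subst hφ hψ
  rw [paste_single_paste (s := structArr a) (t := structArr c) (hs := by simp) (ht := by simp),
    comp_homCart]
  exact (paste_pair_paste (.single φ) (.single ψ) e rfl (homCart a b) (homCart b c) (unitMul A)
    hf hg hh (by simp) (by simp) (by simp) (by simp)).symm

/-- The object `f ∘ a` of `|Z|`, for a vertical arrow `f : A → Z` and an object `a` of `|A|`. -/
noncomputable def postObj {A Z : E} (f : A ⟶ Z) (a : (represent A).Obj) : (represent Z).Obj :=
  ⟨(represent A).ext a, structArr a ≫ f⟩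

/-- The action `A(s, t) → Z(f ∘ s, f ∘ t)` of postcomposition with `f : A → Z`. -/
noncomputable def postMap {A Z X Y : E} (f : A ⟶ Z) (s : X ⟶ A) (t : Y ⟶ A) :
    Cell (.one (reprHom s t)) (𝟙 X) (𝟙 Y) (reprHom (s ≫ f) (t ≫ f)) :=
  reprLift (paste (.single (reprCart s t)) (unitHom f) rfl rfl)

theorem postMap_cart {A Z X Y : E} (f : A ⟶ Z) (s : X ⟶ A) (t : Y ⟶ A) :
    paste (.single (postMap f s t)) (reprCart (s ≫ f) (t ≫ f)) =
      paste (.single (reprCart s t)) (unitHom f) rfl rfl :=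
  reprLift_cart _

theorem postMap_id {A Z X : E} (f : A ⟶ Z) (s : X ⟶ A) :
    paste (.single (reprId s)) (postMap f s s) = reprId (s ≫ f) := by
  refine repr_hom_ext (f := s ≫ f) (g := s ≫ f) ?_
  rw [paste_single_paste (hs := Category.id_comp _) (ht := Category.id_comp _), postMap_cart,
    ← paste_single_paste (a := s) (b := s) (ha := Category.id_comp _) (hb := Category.id_comp _)
      (hc := rfl) (hd := rfl), reprId, reprLift_cart, reprId, reprLift_cart,
    paste_single_paste (hs := Category.id_comp f) (ht := Category.id_comp f), unitCell_hom,
    paste_nil_paste (hl := rfl)]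

theorem postMap_comp {A Z X Y V : E} (f : A ⟶ Z) (s : X ⟶ A) (t : Y ⟶ A) (r : V ⟶ A) :
    paste (h := 𝟙 X) (k := 𝟙 V) (.single (reprComp s t r)) (postMap f s r) =
      paste (.pair (postMap f s t) (postMap f t r) rfl)
        (reprComp (s ≫ f) (t ≫ f) (r ≫ f)) := by
  refine repr_hom_ext (f := s ≫ f) (g := r ≫ f) ?_
  refine Eq.trans ?_ (paste_reprComp (postMap f s t) (postMap f t r) rfl).symm
  rw [paste_single_paste (hs := Category.id_comp _) (ht := Category.id_comp _),
    postMap_cart, postMap_cart, postMap_cart,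
    ← paste_single_paste (a := s) (b := r) (ha := Category.id_comp _) (hb := Category.id_comp _)
      (hc := rfl) (hd := rfl), reprComp, reprLift_cart,
    paste_single_paste (hs := Category.id_comp f) (ht := Category.id_comp f), unitMul_hom,
    paste_pair_paste (e' := rfl) (hs := Category.comp_id _) (ht := Category.comp_id _)]
  rfl

/-- The functor `|f| : |A| → |Z|` represented by a vertical arrow `f : A → Z`: composition
with `f`. -/
noncomputable def representHom {A Z : E} (f : A ⟶ Z) :
    EFunctor (represent A) (represent Z) where
  obj := postObj f
  arr a := 𝟙 ((represent A).ext a)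
  map a b := postMap f (structArr a) (structArr b)
  map_id a := (postMap_id f (structArr a)).trans (paste_nil_id _).symm
  map_comp a b c := postMap_comp f (structArr a) (structArr b) (structArr c)

/-- The restriction `H(a, b)` of a proarrow `H : A ⇸ B`. -/
noncomputable def restrict {A B : E} (H : Pro A B) (a : (represent A).Obj)
    (b : (represent B).Obj) : Pro ((represent A).ext a) ((represent B).ext b) :=
  (VirtualEquipment.exists_restriction (structArr a) (structArr b) H).choose

/-- The cartesian 2-cell `H(a, b) → H`. -/
noncomputable def restrictCart {A B : E} (H : Pro A B) (a : (represent A).Obj)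
    (b : (represent B).Obj) : Cell (.one (restrict H a b)) (structArr a) (structArr b) H :=
  (VirtualEquipment.exists_restriction (structArr a) (structArr b) H).choose_spec.choose

theorem restrictCart_isCartesian {A B : E} (H : Pro A B) (a : (represent A).Obj)
    (b : (represent B).Obj) : IsCartesian (restrictCart H a b) :=
  (VirtualEquipment.exists_restriction (structArr a) (structArr b) H).choose_spec.choose_spec

/-- The action `A(a, a'), H(a', b) → H(a, b)`. -/
noncomputable def restrictLact {A B : E} (H : Pro A B) (a a' : (represent A).Obj)
    (b : (represent B).Obj) : Cell (.two ((represent A).hom a a') (restrict H a' b)) (𝟙 _) (𝟙 _)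
      (restrict H a b) :=
  IsCartesian.lift (restrictCart_isCartesian H a b)
    (paste (.pair (homCart a a') (restrictCart H a' b) rfl) (unitLact H) (Category.comp_id _)
      (Category.comp_id _)) (Category.id_comp _) (Category.id_comp _)

theorem restrictLact_cart {A B : E} (H : Pro A B) (a a' : (represent A).Obj)
    (b : (represent B).Obj) :
    paste (.single (restrictLact H a a' b)) (restrictCart H a b) (Category.id_comp _)
        (Category.id_comp _) =
      paste (.pair (homCart a a') (restrictCart H a' b) rfl)
        (unitLact H) (Category.comp_id _) (Category.comp_id _) :=
  IsCartesian.lift_paste (restrictCart_isCartesian H a b) _ _ _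

/-- The action `H(a, b), B(b, b') → H(a, b')`. -/
noncomputable def restrictRact {A B : E} (H : Pro A B) (a : (represent A).Obj)
    (b b' : (represent B).Obj) : Cell (.two (restrict H a b) ((represent B).hom b b')) (𝟙 _) (𝟙 _)
      (restrict H a b') :=
  IsCartesian.lift (restrictCart_isCartesian H a b')
    (paste (.pair (restrictCart H a b) (homCart b b') rfl) (unitRact H) (Category.comp_id _)
      (Category.comp_id _)) (Category.id_comp _) (Category.id_comp _)

theorem restrictRact_cart {A B : E} (H : Pro A B) (a : (represent A).Obj)
    (b b' : (represent B).Obj) :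
    paste (.single (restrictRact H a b b')) (restrictCart H a b') (Category.id_comp _)
        (Category.id_comp _) =
      paste (.pair (restrictCart H a b) (homCart b b') rfl)
        (unitRact H) (Category.comp_id _) (Category.comp_id _) :=
  IsCartesian.lift_paste (restrictCart_isCartesian H a b') _ _ _

section

variable {A B : E} {H : Pro A B} {X Y Z : E} {p : Pros X Y} {q : Pros Y Z} {t : Pros X Z}

theorem paste_restrictLact {a a' : (represent A).Obj} {b : (represent B).Obj}
    {f : X ⟶ (represent A).ext a} {g : Y ⟶ (represent A).ext a'} {h : Z ⟶ (represent B).ext b}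
    (φ : Cell p f g ((represent A).hom a a')) (ψ : Cell q g h (restrict H a' b))
    (e : p.append q = t) {f' : X ⟶ A} {g' : Y ⟶ A} {h' : Z ⟶ B} (hf : f ≫ structArr a = f')
    (hg : g ≫ structArr a' = g') (hh : h ≫ structArr b = h') :
    paste (.single (paste (h := f) (k := h) (.pair φ ψ e) (restrictLact H a a' b)))
        (restrictCart H a b) hf hh =
      paste (.pair (paste (.single φ) (homCart a a') hf hg)
        (paste (.single ψ) (restrictCart H a' b) hg hh) e) (unitLact H) := by
  rw [paste_single_paste (s := structArr a) (t := structArr b) (hs := by simp) (ht := by simp),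
    restrictLact_cart]
  exact (paste_pair_paste (.single φ) (.single ψ) e rfl (homCart a a') (restrictCart H a' b)
    (unitLact H) hf hg hh (by simp) (by simp) (by simp) (by simp)).symm

theorem paste_restrictRact {a : (represent A).Obj} {b b' : (represent B).Obj}
    {f : X ⟶ (represent A).ext a} {g : Y ⟶ (represent B).ext b} {h : Z ⟶ (represent B).ext b'}
    (φ : Cell p f g (restrict H a b)) (ψ : Cell q g h ((represent B).hom b b'))
    (e : p.append q = t) {f' : X ⟶ A} {g' : Y ⟶ B} {h' : Z ⟶ B} (hf : f ≫ structArr a = f')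
    (hg : g ≫ structArr b = g') (hh : h ≫ structArr b' = h') :
    paste (.single (paste (h := f) (k := h) (.pair φ ψ e) (restrictRact H a b b')))
        (restrictCart H a b') hf hh =
      paste (.pair (paste (.single φ) (restrictCart H a b) hf hg)
        (paste (.single ψ) (homCart b b') hg hh) e) (unitRact H) := by
  rw [paste_single_paste (s := structArr a) (t := structArr b') (hs := by simp) (ht := by simp),
    restrictRact_cart]
  exact (paste_pair_paste (.single φ) (.single ψ) e rfl (restrictCart H a b) (homCart b b')
    (unitRact H) hf hg hh (by simp) (by simp) (by simp) (by simp)).symm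

end

/-- The profunctor `|H| : |A| ⇸ |B|` represented by a proarrow `H : A ⇸ B`: the restrictions
of `H`. -/
noncomputable def representPro {A B : E} (H : Pro A B) :
    EProfunctor (represent A) (represent B) where
  pro := restrict H
  lact := restrictLact H
  ract := restrictRact H
  id_lact a b := by
    refine IsCartesian.hom_ext (restrictCart_isCartesian H a b) (Category.id_comp _)
      (Category.id_comp _) ?_
    refine (paste_restrictLact ((represent A).id a) (idCell (restrict H a b)) rfl
      (Category.id_comp _) (Category.id_comp _) (Category.id_comp _)).trans ?_
    rw [id_homCart]
    exact (nil_unit_lact _)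
  ract_id a b := by
    refine IsCartesian.hom_ext (restrictCart_isCartesian H a b) (Category.id_comp _)
      (Category.id_comp _) ?_
    refine (paste_restrictRact (idCell (restrict H a b)) ((represent B).id b) rfl
      (Category.id_comp _) (Category.id_comp _) (Category.id_comp _)).trans ?_
    rw [id_homCart]
    exact (nil_unit_ract _)
  comp_lact a a' a'' b := by
    refine IsCartesian.hom_ext (restrictCart_isCartesian H a b) (Category.id_comp _)
      (Category.id_comp _) ?_
    refine (paste_restrictLact ((represent A).comp a a' a'') (idCell (restrict H a'' b)) rfl
      (Category.id_comp _) (Category.id_comp _) (Category.id_comp _)).trans ?_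
    refine Eq.trans ?_ (paste_restrictLact (idCell ((represent A).hom a a'))
      (restrictLact H a' a'' b) rfl
      (Category.id_comp _) (Category.id_comp _) (Category.id_comp _)).symm
    rw [comp_homCart, restrictLact_cart, id_paste, id_paste]
    have h₁ := paste_pair_paste (.pair (homCart a a') (homCart a' a'') rfl)
      (.single (restrictCart H a'' b)) rfl rfl (unitMul A) (idCell H) (unitLact H)
      (Category.comp_id _) (Category.comp_id _) (Category.comp_id _) (Category.comp_id _)
      (Category.comp_id _) (Category.comp_id _) (Category.comp_id _)
    have h₂ := paste_pair_paste (.single (homCart a a'))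
      (.pair (homCart a' a'') (restrictCart H a'' b) rfl) rfl rfl (idCell (unitPro A))
      (unitLact H) (unitLact H)
      (Category.comp_id _) (Category.comp_id _) (Category.comp_id _) (Category.comp_id _)
      (Category.comp_id _) (Category.comp_id _) (Category.comp_id _)
    rw [VirtualDoubleCategory.paste_id] at h₁ h₂
    rw [← unitLact_mul] at h₂
    exact h₁.trans h₂.symm
  ract_comp a b b' b'' := by
    refine IsCartesian.hom_ext (restrictCart_isCartesian H a b'') (Category.id_comp _)
      (Category.id_comp _) ?_
    refine (paste_restrictRact (restrictRact H a b b') (idCell ((represent B).hom b' b'')) rfl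
      (Category.id_comp _) (Category.id_comp _) (Category.id_comp _)).trans ?_
    refine Eq.trans ?_ (paste_restrictRact (idCell (restrict H a b))
      ((represent B).comp b b' b'') rfl
      (Category.id_comp _) (Category.id_comp _) (Category.id_comp _)).symm
    rw [comp_homCart, restrictRact_cart, id_paste, id_paste]
    have h₁ := paste_pair_paste (.pair (restrictCart H a b) (homCart b b') rfl)
      (.single (homCart b' b'')) rfl rfl (unitRact H) (idCell (unitPro B)) (unitRact H)
      (Category.comp_id _) (Category.comp_id _) (Category.comp_id _) (Category.comp_id _)
      (Category.comp_id _) (Category.comp_id _) (Category.comp_id _)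
    have h₂ := paste_pair_paste (.single (restrictCart H a b))
      (.pair (homCart b b') (homCart b' b'') rfl) rfl rfl (idCell H)
      (unitMul B) (unitRact H)
      (Category.comp_id _) (Category.comp_id _) (Category.comp_id _) (Category.comp_id _)
      (Category.comp_id _) (Category.comp_id _) (Category.comp_id _)
    rw [VirtualDoubleCategory.paste_id] at h₁ h₂
    rw [← unitRact_mul] at h₂
    exact h₁.trans h₂.symm
  exchange a a' b b' := by
    refine IsCartesian.hom_ext (restrictCart_isCartesian H a b') (Category.id_comp _)
      (Category.id_comp _) ?_
    refine (paste_restrictRact (restrictLact H a a' b) (idCell ((represent B).hom b b')) rfl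
      (Category.id_comp _) (Category.id_comp _) (Category.id_comp _)).trans ?_
    refine Eq.trans ?_ (paste_restrictLact (idCell ((represent A).hom a a'))
      (restrictRact H a' b b') rfl
      (Category.id_comp _) (Category.id_comp _) (Category.id_comp _)).symm
    rw [restrictLact_cart, restrictRact_cart, id_paste, id_paste]
    have h₁ := paste_pair_paste (.pair (homCart a a') (restrictCart H a' b) rfl)
      (.single (homCart b b')) rfl rfl (unitLact H) (idCell (unitPro B)) (unitRact H)
      (Category.comp_id _) (Category.comp_id _) (Category.comp_id _) (Category.comp_id _)
      (Category.comp_id _) (Category.comp_id _) (Category.comp_id _)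
    have h₂ := paste_pair_paste (.single (homCart a a'))
      (.pair (restrictCart H a' b) (homCart b b') rfl) rfl rfl (idCell (unitPro A))
      (unitRact H) (unitLact H)
      (Category.comp_id _) (Category.comp_id _) (Category.comp_id _) (Category.comp_id _)
      (Category.comp_id _) (Category.comp_id _) (Category.comp_id _)
    rw [VirtualDoubleCategory.paste_id] at h₁ h₂
    rw [← unitLact_ract] at h₂
    exact h₁.trans h₂.symm

end Represented

/-! ### A profunctor between represented categories and its value at the identities -/

section Counit

variable {E : Type u} [Category.{v} E] [VirtualEquipment.{u, v, w, z} E]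

/-- The unit `() → A(id, a)` of the conjoint of `a`. -/
noncomputable def conjUnit {A : E} (a : (represent A).Obj) :
    Cell (.nil ((represent A).ext a)) (structArr a) (𝟙 ((represent A).ext a))
      ((represent A).hom (idObj A) a) :=
  IsCartesian.lift (homCart_isCartesian (idObj A) a) (paste (.nil (structArr a)) (unitCell A)
    (Category.comp_id _) (Category.comp_id _)) (Category.comp_id _) (Category.id_comp _)

theorem conjUnit_homCart {A : E} (a : (represent A).Obj) :
    paste (.single (conjUnit a)) (homCart (idObj A) a) (Category.comp_id _) (Category.id_comp _) =
      paste (.nil (structArr a)) (unitCell A) (Category.comp_id _) (Category.comp_id _) :=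
  IsCartesian.lift_paste (homCart_isCartesian (idObj A) a) _ _ _

/-- The unit `() → A(a, id)` of the companion of `a`. -/
noncomputable def compUnit {A : E} (a : (represent A).Obj) :
    Cell (.nil ((represent A).ext a)) (𝟙 ((represent A).ext a)) (structArr a)
      ((represent A).hom a (idObj A)) :=
  IsCartesian.lift (homCart_isCartesian a (idObj A)) (paste (.nil (structArr a)) (unitCell A)
    (Category.comp_id _) (Category.comp_id _)) (Category.id_comp _) (Category.comp_id _)

theorem compUnit_homCart {A : E} (a : (represent A).Obj) :
    paste (.single (compUnit a)) (homCart a (idObj A)) (Category.id_comp _) (Category.comp_id _) =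
      paste (.nil (structArr a)) (unitCell A) (Category.comp_id _) (Category.comp_id _) :=
  IsCartesian.lift_paste (homCart_isCartesian a (idObj A)) _ _ _

theorem conjUnit_idObj (A : E) : conjUnit (idObj A) = (represent A).id (idObj A) := by
  refine IsCartesian.hom_ext (homCart_isCartesian (idObj A) (idObj A)) (Category.id_comp _)
    (Category.id_comp _) ?_
  exact (conjUnit_homCart (idObj A)).trans (id_homCart (idObj A)).symm

theorem compUnit_idObj (A : E) : compUnit (idObj A) = (represent A).id (idObj A) := by
  refine IsCartesian.hom_ext (homCart_isCartesian (idObj A) (idObj A)) (Category.id_comp _)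
    (Category.id_comp _) ?_
  exact (compUnit_homCart (idObj A)).trans (id_homCart (idObj A)).symm

/-- The comparison `h_A → A(id, id)`. -/
noncomputable def unitHomId (A : E) :
    Cell (.one (unitPro A)) (𝟙 A) (𝟙 A) ((represent A).hom (idObj A) (idObj A)) :=
  IsCartesian.lift (homCart_isCartesian (idObj A) (idObj A)) (idCell (unitPro A))
    (Category.id_comp _) (Category.id_comp _)

theorem unitHomId_homCart (A : E) :
    paste (.single (unitHomId A)) (homCart (idObj A) (idObj A)) (Category.id_comp _)
      (Category.id_comp _) = idCell (unitPro A) :=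
  IsCartesian.lift_paste (homCart_isCartesian (idObj A) (idObj A)) _ _ _

theorem unitCell_unitHomId (A : E) :
    paste (.single (unitCell A)) (unitHomId A) (Category.id_comp _) (Category.id_comp _) =
      (represent A).id (idObj A) := by
  refine IsCartesian.hom_ext (homCart_isCartesian (idObj A) (idObj A)) (Category.id_comp _)
    (Category.id_comp _) ?_
  refine Eq.trans ?_ (id_homCart (idObj A)).symm
  refine (paste_single_paste (.single (unitCell A)) (unitHomId A) (homCart (idObj A) (idObj A))
    _ _ _ _ (Category.id_comp _) (Category.id_comp _)).trans ?_
  rw [unitHomId_homCart]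
  exact (VirtualDoubleCategory.paste_id _).trans (paste_nil_id _).symm

/-- The zigzag identity of the companion and the conjoint of `a`. -/
theorem compUnit_conjUnit {A : E} (a : (represent A).Obj) :
    paste (.pair (compUnit a) (conjUnit a) rfl) ((represent A).comp a (idObj A) a)
      (Category.comp_id _) (Category.comp_id _) = (represent A).id a := by
  refine IsCartesian.hom_ext (homCart_isCartesian a a) (Category.id_comp _)
    (Category.id_comp _) ?_
  refine (paste_comp_homCart (b := idObj A) (compUnit a) (conjUnit a) rfl (Category.id_comp _)
    (Category.comp_id _) (Category.id_comp _) (compUnit_homCart a) (conjUnit_homCart a)).trans ?_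
  exact (nil_unit_pair_mul _).trans (id_homCart a).symm

theorem homCart_unitHomId_homCart {A : E} (a a' : (represent A).Obj) :
    paste (.single (paste (.single (homCart a a')) (unitHomId A) (Category.comp_id _)
      (Category.comp_id _))) (homCart (idObj A) (idObj A)) (Category.comp_id _)
      (Category.comp_id _) = homCart a a' := by
  refine (paste_single_paste (.single (homCart a a')) (unitHomId A)
    (homCart (idObj A) (idObj A)) _ _ _ _ (Category.id_comp _) (Category.id_comp _)).trans ?_
  rw [unitHomId_homCart]
  exact VirtualDoubleCategory.paste_id _

/-- A hom `A(a, a')`, acted on by the conjoint of `a`, becomes a unit acting on the conjoint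
of `a'`. -/
theorem conjUnit_comp {A : E} (a a' : (represent A).Obj) :
    paste (.pair (conjUnit a) (idCell ((represent A).hom a a')) rfl)
        ((represent A).comp (idObj A) a a') (Category.comp_id _) (Category.comp_id _) =
      paste (.pair (paste (.single (homCart a a')) (unitHomId A) (Category.comp_id _)
        (Category.comp_id _)) (conjUnit a') (ProPath.append_nil _))
        ((represent A).comp (idObj A) (idObj A) a') (Category.comp_id _) (Category.comp_id _) := by
  refine IsCartesian.hom_ext (homCart_isCartesian (idObj A) a') (Category.comp_id _)
    (Category.id_comp _) ?_
  refine (paste_comp_homCart (a := idObj A) (conjUnit a) (idCell ((represent A).hom a a')) rfl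
    (Category.comp_id _) (Category.id_comp _) (Category.id_comp _) (conjUnit_homCart a)
    (id_paste (homCart a a'))).trans ?_
  refine Eq.trans ?_ (paste_comp_homCart (a := idObj A) (b := idObj A)
    (paste (.single (homCart a a')) (unitHomId A) (Category.comp_id _) (Category.comp_id _))
    (conjUnit a') (ProPath.append_nil _) (Category.comp_id _) (Category.comp_id _)
    (Category.id_comp _) (homCart_unitHomId_homCart a a') (conjUnit_homCart a')).symm
  exact (nil_unit_pair_mul _).trans (pair_nil_unit_mul _).symm

/-- A hom `A(a, a')`, acted on by the companion of `a'`, becomes a unit acting on the companion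
of `a`. -/
theorem comp_compUnit {A : E} (a a' : (represent A).Obj) :
    paste (.pair (idCell ((represent A).hom a a')) (compUnit a') (ProPath.append_nil _))
        ((represent A).comp a a' (idObj A)) (Category.comp_id _) (Category.comp_id _) =
      paste (.pair (compUnit a) (paste (.single (homCart a a')) (unitHomId A)
        (Category.comp_id _) (Category.comp_id _)) rfl)
        ((represent A).comp a (idObj A) (idObj A)) (Category.comp_id _) (Category.comp_id _) := by
  refine IsCartesian.hom_ext (homCart_isCartesian a (idObj A)) (Category.id_comp _)
    (Category.comp_id _) ?_
  refine (paste_comp_homCart (c := idObj A) (idCell ((represent A).hom a a')) (compUnit a')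
    (ProPath.append_nil _) (Category.id_comp _) (Category.id_comp _) (Category.comp_id _)
    (id_paste (homCart a a')) (compUnit_homCart a')).trans ?_
  refine Eq.trans ?_ (paste_comp_homCart (b := idObj A) (c := idObj A) (compUnit a)
    (paste (.single (homCart a a')) (unitHomId A) (Category.comp_id _) (Category.comp_id _)) rfl
    (Category.id_comp _) (Category.comp_id _) (Category.comp_id _) (compUnit_homCart a)
    (homCart_unitHomId_homCart a a')).symm
  exact (pair_nil_unit_mul _).trans (nil_unit_pair_mul _).symm

variable {A B : E} (J : EProfunctor (represent A) (represent B))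

/-- The 2-cell `J(a, b) → J(id, b)`: the conjoint of `a` acts on the left. -/
noncomputable def toIdLeft (a : (represent A).Obj) (b : (represent B).Obj) :
    Cell (.one (J.pro a b)) (structArr a) (𝟙 ((represent B).ext b)) (J.pro (idObj A) b) :=
  paste (.pair (conjUnit a) (idCell (J.pro a b)) rfl) (J.lact (idObj A) a b)
    (Category.comp_id _) (Category.comp_id _)

/-- The 2-cell `J(a, b) → J(a, id)`: the companion of `b` acts on the right. -/
noncomputable def toIdRight (a : (represent A).Obj) (b : (represent B).Obj) :
    Cell (.one (J.pro a b)) (𝟙 ((represent A).ext a)) (structArr b) (J.pro a (idObj B)) :=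
  paste (.pair (idCell (J.pro a b)) (compUnit b) rfl) (J.ract a b (idObj B))
    (Category.comp_id _) (Category.comp_id _)

/-- The 2-cell `J(a, b) → J(id, id)`: the conjoint of `a` and the companion of `b` act. -/
noncomputable def toId (a : (represent A).Obj) (b : (represent B).Obj) :
    Cell (.one (J.pro a b)) (structArr a) (structArr b) (coreflect J) :=
  paste (.single (toIdLeft J a b)) (toIdRight J (idObj A) b) (Category.comp_id _)
    (Category.id_comp _)

theorem toIdLeft_idObj (b : (represent B).Obj) :
    toIdLeft J (idObj A) b = idCell (J.pro (idObj A) b) := by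
  refine Eq.trans ?_ (J.id_lact (idObj A) b)
  rw [toIdLeft, conjUnit_idObj]
  rfl

theorem toIdRight_idObj (a : (represent A).Obj) :
    toIdRight J a (idObj B) = idCell (J.pro a (idObj B)) := by
  refine Eq.trans ?_ (J.ract_id a (idObj B))
  rw [toIdRight, compUnit_idObj]
  rfl

theorem toId_idObj : toId J (idObj A) (idObj B) = idCell (coreflect J) := by
  rw [toId, toIdLeft_idObj, toIdRight_idObj]
  exact id_paste _

/-- The actions of the conjoint of `a` and the companion of `b` commute. -/
theorem toIdRight_toIdLeft (a : (represent A).Obj) (b : (represent B).Obj) :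
    paste (.single (toIdRight J a b)) (toIdLeft J a (idObj B)) (Category.id_comp _)
      (Category.comp_id _) = toId J a b := by
  have S₁ : Stack (.single (toIdRight J a b))
      (.pair (conjUnit a) (idCell (J.pro a (idObj B))) rfl)
      (.pair (conjUnit a) (toIdRight J a b) rfl) :=
    .cons_nil (Category.id_comp _) (Category.id_comp _) (paste_nil_id _) (.ids_right _)
  have S₂ : Stack (.cons (conjUnit a) (.cons (idCell (J.pro a b)) (.single (compUnit b)) rfl) rfl)
      (.pair (idCell ((represent A).hom (idObj A) a)) (J.ract a b (idObj B)) rfl)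
      (.pair (conjUnit a) (toIdRight J a b) rfl) :=
    .cons_single rfl (Category.comp_id _) (Category.comp_id _) (VirtualDoubleCategory.paste_id _)
      (.cons_pair rfl rfl rfl rfl (Category.comp_id _) (Category.comp_id _) rfl
        (.nil (Category.comp_id _)))
  have S₃ : Stack (.single (toIdLeft J a b))
      (.pair (idCell (J.pro (idObj A) b)) (compUnit b) rfl)
      (.pair (toIdLeft J a b) (compUnit b) rfl) :=
    .cons_single rfl (Category.comp_id _) (Category.comp_id _) (VirtualDoubleCategory.paste_id _)
      (.cons_nil (Category.id_comp _) (Category.id_comp _) (paste_nil_id _)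
        (.nil (Category.id_comp _)))
  have S₄ : Stack (.cons (conjUnit a) (.cons (idCell (J.pro a b)) (.single (compUnit b)) rfl) rfl)
      (.pair (J.lact (idObj A) a b) (idCell ((represent B).hom b (idObj B))) rfl)
      (.pair (toIdLeft J a b) (compUnit b) rfl) :=
    .cons_pair rfl rfl rfl rfl (Category.comp_id _) (Category.comp_id _) rfl
      (.cons_single rfl (Category.comp_id _) (Category.comp_id _)
        (VirtualDoubleCategory.paste_id _) (.nil (Category.comp_id _)))
  refine (S₁.paste_paste (J.lact (idObj A) a (idObj B)) _ _ _ _ (Category.comp_id _)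
    (Category.comp_id _)).trans ?_
  refine (S₂.paste_paste (J.lact (idObj A) a (idObj B)) (Category.comp_id _) (Category.comp_id _)
    (Category.comp_id _) (Category.comp_id _) _ _).symm.trans ?_
  refine Eq.trans ?_ (S₃.paste_paste (J.ract (idObj A) b (idObj B)) _ _ _ _ (Category.comp_id _)
    (Category.comp_id _)).symm
  refine Eq.trans ?_ (S₄.paste_paste (J.ract (idObj A) b (idObj B)) (Category.comp_id _)
    (Category.comp_id _) (Category.comp_id _) (Category.comp_id _) _ _)
  exact congrArg (fun θ => paste (.cons (conjUnit a) (.cons (idCell (J.pro a b))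
    (.single (compUnit b)) rfl) rfl) θ (Category.comp_id _) (Category.comp_id _))
    (J.exchange (idObj A) a b (idObj B)).symm

/-- At the identity, the action of the unit is that of the hom `A(id, id)`. -/
theorem unitLact_eq_lact (b : (represent B).Obj) :
    unitLact (J.pro (idObj A) b) =
      paste (.pair (unitHomId A) (idCell (J.pro (idObj A) b)) rfl)
        (J.lact (idObj A) (idObj A) b) (Category.comp_id _) (Category.comp_id _) := by
  refine unit_hom_ext_at (.nil A) (.one (J.pro (idObj A) b)) rfl rfl ?_
  refine (unitCell_lact _).trans ((J.id_lact (idObj A) b).symm.trans (Eq.symm ?_))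
  have S : Stack (.pair (unitCell A) (idCell (J.pro (idObj A) b)) rfl)
      (.pair (unitHomId A) (idCell (J.pro (idObj A) b)) rfl)
      (.pair ((represent A).id (idObj A)) (idCell (J.pro (idObj A) b)) rfl) :=
    .cons_single rfl (Category.comp_id _) (Category.comp_id _) (unitCell_unitHomId A)
      (.ids_right _)
  exact S.paste_paste (J.lact (idObj A) (idObj A) b) _ _ _ _ (Category.comp_id _)
    (Category.comp_id _)

theorem unitRact_eq_ract (a : (represent A).Obj) :
    unitRact (J.pro a (idObj B)) =
      paste (.pair (idCell (J.pro a (idObj B))) (unitHomId B) rfl)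
        (J.ract a (idObj B) (idObj B)) (Category.comp_id _) (Category.comp_id _) := by
  refine unit_hom_ext_at (.one (J.pro a (idObj B))) (.nil B) rfl rfl ?_
  refine (unitCell_ract _).trans ((J.ract_id a (idObj B)).symm.trans (Eq.symm ?_))
  have S : Stack (.pair (idCell (J.pro a (idObj B))) (unitCell B) rfl)
      (.pair (idCell (J.pro a (idObj B))) (unitHomId B) rfl)
      (.pair (idCell (J.pro a (idObj B))) ((represent B).id (idObj B)) rfl) :=
    .cons_single rfl (Category.comp_id _) (Category.comp_id _) (VirtualDoubleCategory.paste_id _)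
      (.cons_single rfl (Category.comp_id _) (Category.comp_id _) (unitCell_unitHomId B)
        (.nil (Category.comp_id _)))
  exact S.paste_paste (J.ract a (idObj B) (idObj B)) _ _ _ _ (Category.comp_id _)
    (Category.comp_id _)

theorem lact_toIdLeft (a a' : (represent A).Obj) (b : (represent B).Obj) :
    paste (.single (J.lact a a' b)) (toIdLeft J a b) (Category.id_comp _) (Category.id_comp _) =
      paste (.pair (homCart a a') (toIdLeft J a' b) rfl) (unitLact (J.pro (idObj A) b))
        (Category.comp_id _) (Category.comp_id _) := by
  have S₁ : Stack (.single (J.lact a a' b)) (.pair (conjUnit a) (idCell (J.pro a b)) rfl)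
      (.pair (conjUnit a) (J.lact a a' b) rfl) :=
    .cons_nil (Category.id_comp _) (Category.id_comp _) (paste_nil_id _) (.ids_right _)
  have S₂ : Stack (.cons (conjUnit a) (.ids (.two ((represent A).hom a a') (J.pro a' b)))
      (ProPath.nil_append _))
      (.pair (idCell ((represent A).hom (idObj A) a)) (J.lact a a' b) rfl)
      (.pair (conjUnit a) (J.lact a a' b) rfl) :=
    .cons_single rfl (Category.comp_id _) (Category.comp_id _) (VirtualDoubleCategory.paste_id _)
      (.ids_left (.single (J.lact a a' b)))
  have S₃ : Stack (.cons (conjUnit a) (.ids (.two ((represent A).hom a a') (J.pro a' b)))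
      (ProPath.nil_append _))
      (.pair ((represent A).comp (idObj A) a a') (idCell (J.pro a' b)) rfl)
      (.pair (paste (.pair (conjUnit a) (idCell ((represent A).hom a a')) rfl)
        ((represent A).comp (idObj A) a a') (Category.comp_id _) (Category.comp_id _))
        (idCell (J.pro a' b)) rfl) :=
    .cons_pair rfl rfl rfl rfl (Category.comp_id _) (Category.comp_id _) rfl (.ids_right _)
  have S₄ : Stack (.pair (homCart a a') (toIdLeft J a' b) rfl)
      (.pair (unitHomId A) (idCell (J.pro (idObj A) b)) rfl)
      (.pair (paste (.single (homCart a a')) (unitHomId A) (Category.comp_id _)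
        (Category.comp_id _)) (toIdLeft J a' b) rfl) :=
    .cons_single rfl (Category.comp_id _) (Category.comp_id _) rfl (.ids_right _)
  have S₅ : Stack (.cons (paste (.single (homCart a a')) (unitHomId A) (Category.comp_id _)
        (Category.comp_id _)) (.pair (conjUnit a') (idCell (J.pro a' b)) rfl) rfl)
      (.pair (idCell ((represent A).hom (idObj A) (idObj A))) (J.lact (idObj A) a' b) rfl)
      (.pair (paste (.single (homCart a a')) (unitHomId A) (Category.comp_id _)
        (Category.comp_id _)) (toIdLeft J a' b) rfl) :=
    .cons_single rfl (Category.comp_id _) (Category.comp_id _) (VirtualDoubleCategory.paste_id _)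
      (.cons_pair rfl rfl rfl rfl (Category.comp_id _) (Category.comp_id _) rfl
        (.nil (Category.comp_id _)))
  have S₆ : Stack (.cons (paste (.single (homCart a a')) (unitHomId A) (Category.comp_id _)
        (Category.comp_id _)) (.pair (conjUnit a') (idCell (J.pro a' b)) rfl) rfl)
      (.pair ((represent A).comp (idObj A) (idObj A) a') (idCell (J.pro a' b)) rfl)
      (.pair (paste (.pair (conjUnit a) (idCell ((represent A).hom a a')) rfl)
        ((represent A).comp (idObj A) a a') (Category.comp_id _) (Category.comp_id _))
        (idCell (J.pro a' b)) rfl) :=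
    .cons_pair rfl rfl rfl rfl (Category.comp_id _) (Category.comp_id _)
      (conjUnit_comp a a').symm (.ids_right _)
  refine (S₁.paste_paste (J.lact (idObj A) a b) _ _ _ _ (Category.comp_id _)
    (Category.comp_id _)).trans ?_
  refine (S₂.paste_paste (J.lact (idObj A) a b) (Category.comp_id _) (Category.comp_id _)
    (Category.comp_id _) (Category.comp_id _) _ _).symm.trans ?_
  refine (congrArg (fun θ => paste (.cons (conjUnit a)
    (.ids (.two ((represent A).hom a a') (J.pro a' b))) (ProPath.nil_append _)) θ
    (Category.comp_id _) (Category.comp_id _)) (J.comp_lact (idObj A) a a' b).symm).trans ?_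
  refine (S₃.paste_paste (J.lact (idObj A) a' b) _ _ _ _ (Category.comp_id _)
    (Category.comp_id _)).trans ?_
  refine (S₆.paste_paste (J.lact (idObj A) a' b) (Category.comp_id _) (Category.comp_id _)
    (Category.comp_id _) (Category.comp_id _) _ _).symm.trans ?_
  refine (congrArg (fun θ => paste (.cons (paste (.single (homCart a a')) (unitHomId A)
    (Category.comp_id _) (Category.comp_id _)) (.pair (conjUnit a') (idCell (J.pro a' b)) rfl) rfl)
    θ (Category.comp_id _) (Category.comp_id _)) (J.comp_lact (idObj A) (idObj A) a' b)).trans ?_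
  refine (S₅.paste_paste (J.lact (idObj A) (idObj A) b) _ _ _ _ (Category.comp_id _)
    (Category.comp_id _)).trans ?_
  rw [unitLact_eq_lact]
  exact (S₄.paste_paste (J.lact (idObj A) (idObj A) b) (Category.comp_id _) (Category.comp_id _)
    (Category.comp_id _) (Category.comp_id _) _ _).symm

theorem ract_toIdRight (a : (represent A).Obj) (b b' : (represent B).Obj) :
    paste (.single (J.ract a b b')) (toIdRight J a b') (Category.id_comp _) (Category.id_comp _) =
      paste (.pair (toIdRight J a b) (homCart b b') rfl) (unitRact (J.pro a (idObj B)))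
        (Category.comp_id _) (Category.comp_id _) := by
  have S₁ : Stack (.single (J.ract a b b')) (.pair (idCell (J.pro a b')) (compUnit b') rfl)
      (.pair (J.ract a b b') (compUnit b') rfl) :=
    .cons_single rfl (Category.comp_id _) (Category.comp_id _) (VirtualDoubleCategory.paste_id _)
      (.cons_nil (Category.id_comp _) (Category.id_comp _) (paste_nil_id _)
        (.nil (Category.id_comp _)))
  have S₂ : Stack (.cons (idCell (J.pro a b)) (.pair (idCell ((represent B).hom b b'))
      (compUnit b') rfl) rfl)
      (.pair (J.ract a b b') (idCell ((represent B).hom b' (idObj B))) rfl)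
      (.pair (J.ract a b b') (compUnit b') rfl) :=
    .cons_pair rfl rfl rfl rfl (Category.comp_id _) (Category.comp_id _)
      (VirtualDoubleCategory.ids_paste _) (.ids_right _)
  have S₃ : Stack (.cons (idCell (J.pro a b)) (.pair (idCell ((represent B).hom b b'))
      (compUnit b') rfl) rfl)
      (.pair (idCell (J.pro a b)) ((represent B).comp b b' (idObj B)) rfl)
      (.pair (idCell (J.pro a b)) (paste (.pair (idCell ((represent B).hom b b')) (compUnit b') rfl)
        ((represent B).comp b b' (idObj B)) (Category.comp_id _) (Category.comp_id _)) rfl) :=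
    .cons_single rfl (Category.comp_id _) (Category.comp_id _) (VirtualDoubleCategory.paste_id _)
      (.cons_pair rfl rfl rfl rfl (Category.comp_id _) (Category.comp_id _) rfl
        (.nil (Category.comp_id _)))
  have S₄ : Stack (.pair (toIdRight J a b) (homCart b b') rfl)
      (.pair (idCell (J.pro a (idObj B))) (unitHomId B) rfl)
      (.pair (toIdRight J a b) (paste (.single (homCart b b')) (unitHomId B) (Category.comp_id _)
        (Category.comp_id _)) rfl) :=
    .cons_single rfl (Category.comp_id _) (Category.comp_id _) (VirtualDoubleCategory.paste_id _)
      (.cons_single rfl (Category.comp_id _) (Category.comp_id _) rfl (.nil (Category.comp_id _)))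
  have S₅ : Stack (.cons (idCell (J.pro a b)) (.pair (compUnit b) (paste (.single (homCart b b'))
        (unitHomId B) (Category.comp_id _) (Category.comp_id _)) rfl) rfl)
      (.pair (J.ract a b (idObj B)) (idCell ((represent B).hom (idObj B) (idObj B))) rfl)
      (.pair (toIdRight J a b) (paste (.single (homCart b b')) (unitHomId B) (Category.comp_id _)
        (Category.comp_id _)) rfl) :=
    .cons_pair rfl rfl rfl rfl (Category.comp_id _) (Category.comp_id _) rfl (.ids_right _)
  have S₆ : Stack (.cons (idCell (J.pro a b)) (.pair (compUnit b) (paste (.single (homCart b b'))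
        (unitHomId B) (Category.comp_id _) (Category.comp_id _)) rfl) rfl)
      (.pair (idCell (J.pro a b)) ((represent B).comp b (idObj B) (idObj B)) rfl)
      (.pair (idCell (J.pro a b)) (paste (.pair (idCell ((represent B).hom b b')) (compUnit b') rfl)
        ((represent B).comp b b' (idObj B)) (Category.comp_id _) (Category.comp_id _)) rfl) :=
    .cons_single rfl (Category.comp_id _) (Category.comp_id _) (VirtualDoubleCategory.paste_id _)
      (.cons_pair rfl rfl rfl rfl (Category.comp_id _) (Category.comp_id _)
        (comp_compUnit b b').symm (.nil (Category.comp_id _)))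
  refine (S₁.paste_paste (J.ract a b' (idObj B)) _ _ _ _ (Category.comp_id _)
    (Category.comp_id _)).trans ?_
  refine (S₂.paste_paste (J.ract a b' (idObj B)) (Category.comp_id _) (Category.comp_id _)
    (Category.comp_id _) (Category.comp_id _) _ _).symm.trans ?_
  refine (congrArg (fun θ => paste (.cons (idCell (J.pro a b))
    (.pair (idCell ((represent B).hom b b')) (compUnit b') rfl) rfl) θ
    (Category.comp_id _) (Category.comp_id _)) (J.ract_comp a b b' (idObj B))).trans ?_
  refine (S₃.paste_paste (J.ract a b (idObj B)) _ _ _ _ (Category.comp_id _)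
    (Category.comp_id _)).trans ?_
  refine (S₆.paste_paste (J.ract a b (idObj B)) (Category.comp_id _) (Category.comp_id _)
    (Category.comp_id _) (Category.comp_id _) _ _).symm.trans ?_
  refine (congrArg (fun θ => paste (.cons (idCell (J.pro a b)) (.pair (compUnit b)
    (paste (.single (homCart b b')) (unitHomId B) (Category.comp_id _) (Category.comp_id _)) rfl)
    rfl) θ (Category.comp_id _) (Category.comp_id _))
    (J.ract_comp a b (idObj B) (idObj B)).symm).trans ?_
  refine (S₅.paste_paste (J.ract a (idObj B) (idObj B)) _ _ _ _ (Category.comp_id _)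
    (Category.comp_id _)).trans ?_
  rw [unitRact_eq_ract]
  exact (S₄.paste_paste (J.ract a (idObj B) (idObj B)) (Category.comp_id _) (Category.comp_id _)
    (Category.comp_id _) (Category.comp_id _) _ _).symm

/-- The 2-cells `J(a, b) → J(id, id)` turn the left action of `|A|` into that of the unit. -/
theorem lact_toId (a a' : (represent A).Obj) (b : (represent B).Obj) :
    paste (.single (J.lact a a' b)) (toId J a b) (Category.id_comp _) (Category.id_comp _) =
      paste (.pair (homCart a a') (toId J a' b) rfl) (unitLact (coreflect J))
        (Category.comp_id _) (Category.comp_id _) := by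
  refine (paste_single_paste (.single (J.lact a a' b)) (toIdLeft J a b) (toIdRight J (idObj A) b)
    (Category.id_comp _) (Category.id_comp _) (Category.comp_id _) (Category.id_comp _)
    _ _).symm.trans ?_
  rw [lact_toIdLeft]
  refine (paste_single_paste (.pair (homCart a a') (toIdLeft J a' b) rfl)
    (unitLact (J.pro (idObj A) b)) (toIdRight J (idObj A) b) _ _ _ _ (Category.id_comp (𝟙 A))
    (Category.id_comp (structArr b))).trans ?_
  have h := unitLact_paste (J.pro (idObj A) b) (.nil _) (toIdRight J (idObj A) b)
  have h₁ : unitHom (𝟙 ((represent A).ext (idObj A))) = idCell (unitPro A) := unitHom_id A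
  rw [h₁] at h
  refine (congrArg (fun θ => paste (.pair (homCart a a') (toIdLeft J a' b) rfl) θ
    (Category.comp_id _) (Category.id_comp _)) h).trans ?_
  have S : Stack (.pair (homCart a a') (toIdLeft J a' b) rfl)
      (.pair (idCell (unitPro A)) (toIdRight J (idObj A) b) rfl)
      (.pair (homCart a a') (toId J a' b) rfl) :=
    .cons_single rfl (Category.comp_id _) (Category.comp_id _) (VirtualDoubleCategory.paste_id _)
      (.cons_single rfl (Category.comp_id _) (Category.id_comp _) rfl (.nil (Category.id_comp _)))
  exact S.paste_paste (unitLact (coreflect J)) _ _ _ _ (Category.comp_id _) (Category.comp_id _)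

/-- The 2-cells `J(a, b) → J(id, id)` turn the right action of `|B|` into that of the unit. -/
theorem ract_toId (a : (represent A).Obj) (b b' : (represent B).Obj) :
    paste (.single (J.ract a b b')) (toId J a b') (Category.id_comp _) (Category.id_comp _) =
      paste (.pair (toId J a b) (homCart b b') rfl) (unitRact (coreflect J))
        (Category.comp_id _) (Category.comp_id _) := by
  rw [← toIdRight_toIdLeft, ← toIdRight_toIdLeft]
  refine (paste_single_paste (.single (J.ract a b b')) (toIdRight J a b') (toIdLeft J a (idObj B))
    (Category.id_comp _) (Category.id_comp _) (Category.id_comp _) (Category.comp_id _)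
    _ _).symm.trans ?_
  rw [ract_toIdRight]
  refine (paste_single_paste (.pair (toIdRight J a b) (homCart b b') rfl)
    (unitRact (J.pro a (idObj B))) (toIdLeft J a (idObj B)) _ _ _ _
    (Category.id_comp (structArr a)) (Category.id_comp (𝟙 B))).trans ?_
  have h := unitRact_paste (.nil _) (J.pro a (idObj B)) rfl rfl rfl (toIdLeft J a (idObj B))
  have h₁ : unitHom (𝟙 ((represent B).ext (idObj B))) = idCell (unitPro B) := unitHom_id B
  rw [h₁] at h
  refine (congrArg (fun θ => paste (.pair (toIdRight J a b) (homCart b b') rfl) θ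
    (Category.id_comp _) (Category.comp_id _)) h).trans ?_
  have S : Stack (.pair (toIdRight J a b) (homCart b b') rfl)
      (.pair (toIdLeft J a (idObj B)) (idCell (unitPro B)) rfl)
      (.pair (paste (.single (toIdRight J a b)) (toIdLeft J a (idObj B)) (Category.id_comp _)
        (Category.comp_id _)) (homCart b b') rfl) :=
    .cons_single rfl (Category.id_comp _) (Category.comp_id _) rfl
      (.cons_single rfl (Category.comp_id _) (Category.comp_id _)
        (VirtualDoubleCategory.paste_id _) (.nil (Category.comp_id _)))
  exact S.paste_paste (unitRact (coreflect J)) _ _ _ _ (Category.comp_id _) (Category.comp_id _)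

end Counit

/-! ### Naturality of the components of a morphism of profunctors -/

section Naturality

variable {E : Type u} [Category.{v} E] [VirtualEquipment.{u, v, w, z} E]

variable {A B C : E} {J : EProfunctor (represent A) (represent B)}
  {K : EProfunctor (represent B) (represent C)} {L : EProfunctor (represent A) (represent C)}
  (μ : ProfMor (.two J K) (EFunctor.id _) (EFunctor.id _) L)

/-- The component of a morphism `μ : J, K → L` of profunctors at three objects. -/
noncomputable def ProfMor.app₂ (a : (represent A).Obj) (b : (represent B).Obj)
    (c : (represent C).Obj) :
    Cell (.two (J.pro a b) (K.pro b c)) (𝟙 ((represent A).ext a)) (𝟙 ((represent C).ext c))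
      (L.pro a c) :=
  μ.app a c (.cons J a (.cons K b (.nil c)))

theorem ProfMor.app₂_left (a a' : (represent A).Obj) (b : (represent B).Obj)
    (c : (represent C).Obj) :
    paste (p := .three ((represent A).hom a a') (J.pro a' b) (K.pro b c)) (h := 𝟙 _) (k := 𝟙 _)
        (.pair (J.lact a a' b) (idCell (K.pro b c)) rfl) (μ.app₂ a b c) =
      paste (.pair (idCell ((represent A).hom a a')) (μ.app₂ a' b c) rfl) (L.lact a a' c) :=
  μ.left a a' b c (.cons K b (.nil c))

theorem ProfMor.app₂_right (a : (represent A).Obj) (b : (represent B).Obj)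
    (c c' : (represent C).Obj) :
    paste (p := .three (J.pro a b) (K.pro b c) ((represent C).hom c c')) (h := 𝟙 _) (k := 𝟙 _)
        (.pair (idCell (J.pro a b)) (K.ract b c c') rfl) (μ.app₂ a b c') =
      paste (.pair (μ.app₂ a b c) (idCell ((represent C).hom c c')) rfl) (L.ract a c c') :=
  μ.right (.there J a (.here K b c c'))

theorem ProfMor.app₂_interior (a : (represent A).Obj) (b b' : (represent B).Obj)
    (c : (represent C).Obj) :
    paste (p := .three (J.pro a b) ((represent B).hom b b') (K.pro b' c)) (h := 𝟙 _) (k := 𝟙 _)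
        (.pair (idCell (J.pro a b)) (K.lact b b' c) rfl) (μ.app₂ a b c) =
      paste (.pair (J.ract a b b') (idCell (K.pro b' c)) rfl) (μ.app₂ a b' c) :=
  μ.interior (.here J K a b b' (.nil c))

theorem ProfMor.app₂_toIdLeft (a : (represent A).Obj) (b : (represent B).Obj)
    (c : (represent C).Obj) :
    paste (.single (μ.app₂ a b c)) (toIdLeft L a c) (Category.id_comp _) (Category.id_comp _) =
      paste (.pair (toIdLeft J a b) (idCell (K.pro b c)) rfl) (μ.app₂ (idObj A) b c)
        (Category.comp_id _) (Category.comp_id _) := by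
  have S₁ : Stack (.single (μ.app₂ a b c)) (.pair (conjUnit a) (idCell (L.pro a c)) rfl)
      (.pair (conjUnit a) (μ.app₂ a b c) rfl) :=
    .cons_nil (Category.id_comp _) (Category.id_comp _) (paste_nil_id _) (.ids_right _)
  have S₂ : Stack (.cons (conjUnit a) (.ids (.two (J.pro a b) (K.pro b c)))
      (ProPath.nil_append _))
      (.pair (idCell ((represent A).hom (idObj A) a)) (μ.app₂ a b c) rfl)
      (.pair (conjUnit a) (μ.app₂ a b c) rfl) :=
    .cons_single rfl (Category.comp_id _) (Category.comp_id _) (VirtualDoubleCategory.paste_id _)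
      (.ids_left (.single (μ.app₂ a b c)))
  have S₃ : Stack (.cons (conjUnit a) (.ids (.two (J.pro a b) (K.pro b c)))
      (ProPath.nil_append _))
      (.pair (J.lact (idObj A) a b) (idCell (K.pro b c)) rfl)
      (.pair (toIdLeft J a b) (idCell (K.pro b c)) rfl) :=
    .cons_pair rfl rfl rfl rfl (Category.comp_id _) (Category.comp_id _) rfl (.ids_right _)
  refine (S₁.paste_paste (L.lact (idObj A) a c) _ _ _ _ (Category.comp_id _)
    (Category.comp_id _)).trans ?_
  refine (S₂.paste_paste (L.lact (idObj A) a c) (Category.comp_id _) (Category.comp_id _)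
    (Category.comp_id _) (Category.comp_id _) _ _).symm.trans ?_
  refine (congrArg (fun θ => paste (.cons (conjUnit a)
    (.ids (.two (J.pro a b) (K.pro b c))) (ProPath.nil_append _)) θ
    (Category.comp_id _) (Category.comp_id _)) (μ.app₂_left (idObj A) a b c).symm).trans ?_
  exact S₃.paste_paste (μ.app₂ (idObj A) b c) _ _ _ _ (Category.comp_id _) (Category.comp_id _)

theorem ProfMor.app₂_toIdRight (a : (represent A).Obj) (b : (represent B).Obj)
    (c : (represent C).Obj) :
    paste (.single (μ.app₂ a b c)) (toIdRight L a c) (Category.id_comp _) (Category.id_comp _) =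
      paste (.pair (idCell (J.pro a b)) (toIdRight K b c) rfl) (μ.app₂ a b (idObj C))
        (Category.comp_id _) (Category.comp_id _) := by
  have S₁ : Stack (.single (μ.app₂ a b c)) (.pair (idCell (L.pro a c)) (compUnit c) rfl)
      (.pair (μ.app₂ a b c) (compUnit c) rfl) :=
    .cons_single rfl (Category.comp_id _) (Category.comp_id _) (VirtualDoubleCategory.paste_id _)
      (.cons_nil (Category.id_comp _) (Category.id_comp _) (paste_nil_id _)
        (.nil (Category.id_comp _)))
  have S₂ : Stack (.cons (idCell (J.pro a b)) (.pair (idCell (K.pro b c)) (compUnit c) rfl) rfl)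
      (.pair (μ.app₂ a b c) (idCell ((represent C).hom c (idObj C))) rfl)
      (.pair (μ.app₂ a b c) (compUnit c) rfl) :=
    .cons_pair rfl rfl rfl rfl (Category.comp_id _) (Category.comp_id _)
      (VirtualDoubleCategory.ids_paste _) (.ids_right _)
  have S₃ : Stack (.cons (idCell (J.pro a b)) (.pair (idCell (K.pro b c)) (compUnit c) rfl) rfl)
      (.pair (idCell (J.pro a b)) (K.ract b c (idObj C)) rfl)
      (.pair (idCell (J.pro a b)) (toIdRight K b c) rfl) :=
    .cons_single rfl (Category.comp_id _) (Category.comp_id _) (VirtualDoubleCategory.paste_id _)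
      (.cons_pair rfl rfl rfl rfl (Category.comp_id _) (Category.comp_id _) rfl
        (.nil (Category.comp_id _)))
  refine (S₁.paste_paste (L.ract a c (idObj C)) _ _ _ _ (Category.comp_id _)
    (Category.comp_id _)).trans ?_
  refine (S₂.paste_paste (L.ract a c (idObj C)) (Category.comp_id _) (Category.comp_id _)
    (Category.comp_id _) (Category.comp_id _) _ _).symm.trans ?_
  refine (congrArg (fun θ => paste (.cons (idCell (J.pro a b))
    (.pair (idCell (K.pro b c)) (compUnit c) rfl) rfl) θ
    (Category.comp_id _) (Category.comp_id _)) (μ.app₂_right a b c (idObj C)).symm).trans ?_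
  exact S₃.paste_paste (μ.app₂ a b (idObj C)) _ _ _ _ (Category.comp_id _) (Category.comp_id _)

/-- In the middle, the actions of the companion and the conjoint of `b` cancel. -/
theorem ProfMor.toIdRight_toIdLeft_app₂ (a : (represent A).Obj) (b : (represent B).Obj)
    (c : (represent C).Obj) :
    paste (.pair (toIdRight J a b) (toIdLeft K b c) rfl) (μ.app₂ a (idObj B) c)
        (Category.comp_id _) (Category.comp_id _) = μ.app₂ a b c := by
  have S₁ : Stack (.cons (idCell (J.pro a b)) (.cons (compUnit b) (.single (toIdLeft K b c))
      (ProPath.nil_append _)) rfl)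
      (.pair (J.ract a b (idObj B)) (idCell (K.pro (idObj B) c)) rfl)
      (.pair (toIdRight J a b) (toIdLeft K b c) rfl) :=
    .cons_pair rfl rfl rfl rfl (Category.comp_id _) (Category.comp_id _) rfl (.ids_right _)
  have S₂ : Stack (.cons (idCell (J.pro a b)) (.cons (compUnit b) (.single (toIdLeft K b c))
      (ProPath.nil_append _)) rfl)
      (.pair (idCell (J.pro a b)) (K.lact b (idObj B) c) rfl)
      (.ids (.two (J.pro a b) (K.pro b c))) := by
    refine .cons_single rfl (Category.comp_id _) (Category.comp_id _)
      (VirtualDoubleCategory.paste_id _) (.cons_pair rfl rfl rfl rfl (Category.comp_id _)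
        (Category.comp_id _) ?_ (.nil (Category.comp_id _)))
    have T₁ : Stack (.cons (compUnit b) (.cons (conjUnit b) (.single (idCell (K.pro b c)))
        (ProPath.nil_append _)) rfl)
        (.pair (idCell ((represent B).hom b (idObj B))) (K.lact (idObj B) b c) rfl)
        (.pair (compUnit b) (toIdLeft K b c) rfl) :=
      .cons_single rfl (Category.comp_id _) (Category.comp_id _)
        (VirtualDoubleCategory.paste_id _) (.cons_pair rfl rfl rfl rfl (Category.comp_id _)
          (Category.comp_id _) rfl (.nil (Category.comp_id _)))
    have T₂ : Stack (.cons (compUnit b) (.cons (conjUnit b) (.single (idCell (K.pro b c)))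
        (ProPath.nil_append _)) rfl)
        (.pair ((represent B).comp b (idObj B) b) (idCell (K.pro b c)) rfl)
        (.pair ((represent B).id b) (idCell (K.pro b c)) rfl) :=
      .cons_pair rfl rfl rfl rfl (Category.comp_id _) (Category.comp_id _)
        (compUnit_conjUnit b) (.ids_right _)
    refine (T₁.paste_paste (K.lact b (idObj B) c) (Category.comp_id _) (Category.comp_id _)
      (Category.comp_id _) (Category.comp_id _) _ _).symm.trans ?_
    refine (congrArg (fun θ => paste (.cons (compUnit b) (.cons (conjUnit b)
      (.single (idCell (K.pro b c))) (ProPath.nil_append _)) rfl) θ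
      (Category.comp_id _) (Category.comp_id _)) (K.comp_lact b (idObj B) b c).symm).trans ?_
    exact (T₂.paste_paste (K.lact b b c) _ _ _ _ (Category.comp_id _)
      (Category.comp_id _)).trans (K.id_lact b c)
  refine (S₁.paste_paste (μ.app₂ a (idObj B) c) (Category.comp_id _) (Category.comp_id _)
    (Category.comp_id _) (Category.comp_id _) _ _).symm.trans ?_
  refine (congrArg (fun θ => paste (.cons (idCell (J.pro a b)) (.cons (compUnit b)
    (.single (toIdLeft K b c)) (ProPath.nil_append _)) rfl) θ
    (Category.comp_id _) (Category.comp_id _)) (μ.app₂_interior a b (idObj B) c).symm).trans ?_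
  exact (S₂.paste_paste (μ.app₂ a b c) _ _ _ _ (Category.id_comp _)
    (Category.id_comp _)).trans (VirtualDoubleCategory.ids_paste _)

/-- The components of `μ` are natural for the 2-cells to the values at the identities. -/
theorem ProfMor.app₂_toId (a : (represent A).Obj) (b : (represent B).Obj) (c : (represent C).Obj) :
    paste (.single (μ.app₂ a b c)) (toId L a c) (Category.id_comp _) (Category.id_comp _) =
      paste (.pair (toId J a b) (toId K b c) rfl) (coreflectMor μ)
        (Category.comp_id _) (Category.comp_id _) := by
  rw [← toIdRight_toIdLeft L]
  refine (paste_single_paste (.single (μ.app₂ a b c)) (toIdRight L a c) (toIdLeft L a (idObj C))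
    (Category.id_comp _) (Category.id_comp _) (Category.id_comp _) (Category.comp_id _)
    _ _).symm.trans ?_
  rw [μ.app₂_toIdRight]
  refine (paste_single_paste (.pair (idCell (J.pro a b)) (toIdRight K b c) rfl)
    (μ.app₂ a b (idObj C)) (toIdLeft L a (idObj C)) _ _ _ _ (Category.id_comp (structArr a))
    (Category.id_comp (𝟙 C))).trans ?_
  refine (congrArg (fun θ => paste (.pair (idCell (J.pro a b)) (toIdRight K b c) rfl) θ
    (Category.id_comp _) (Category.comp_id _)) (μ.app₂_toIdLeft a b (idObj C))).trans ?_
  have S₁ : Stack (.pair (idCell (J.pro a b)) (toIdRight K b c) rfl)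
      (.pair (toIdLeft J a b) (idCell (K.pro b (idObj C))) rfl)
      (.pair (toIdLeft J a b) (toIdRight K b c) rfl) :=
    .cons_single rfl (Category.id_comp _) (Category.id_comp _) (id_paste _)
      (.cons_single rfl (Category.comp_id _) (Category.comp_id _)
        (VirtualDoubleCategory.paste_id _) (.nil (Category.comp_id _)))
  have S₂ : Stack (.pair (toIdLeft J a b) (toIdRight K b c) rfl)
      (.pair (toIdRight J (idObj A) b) (toIdLeft K b (idObj C)) rfl)
      (.pair (toId J a b) (toId K b c) rfl) :=
    .cons_single rfl (Category.comp_id _) (Category.id_comp _) rfl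
      (.cons_single rfl (Category.id_comp _) (Category.comp_id _)
        (toIdRight_toIdLeft K b c) (.nil (Category.comp_id _)))
  refine (S₁.paste_paste (μ.app₂ (idObj A) b (idObj C)) _ _ _ _ (Category.comp_id _)
    (Category.comp_id _)).trans ?_
  rw [← μ.toIdRight_toIdLeft_app₂ (idObj A) b (idObj C)]
  exact S₂.paste_paste (μ.app₂ (idObj A) (idObj B) (idObj C)) _ _ _ _ (Category.comp_id _)
    (Category.comp_id _)

end Naturality

/-! ### Case analysis on choices of objects -/

section Cases

variable {E : Type u} [Category.{v} E] [VirtualDoubleCategory.{u, v, w, z} E]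

variable {B C D : ECategory.{u, v, w, z, x} E}

/-- Case analysis for a choice of objects along the empty list. -/
def Pts.nilCases {motive : ∀ {c d : C.Obj}, Pts (.nil C) c d → Sort*}
    (nil : ∀ c : C.Obj, motive (.nil c)) {c d : C.Obj} (s : Pts (.nil C) c d) : motive s :=
  match s with
  | .nil c => nil c

/-- Case analysis for a choice of objects along a non-empty list. -/
def Pts.consCases {J : EProfunctor B C} {p : Profs C D}
    {motive : ∀ {b : B.Obj} {d : D.Obj}, Pts (.cons J p) b d → Sort*}
    (cons : ∀ (b : B.Obj) {c : C.Obj} {d : D.Obj} (s : Pts p c d), motive (.cons J b s))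
    {b : B.Obj} {d : D.Obj} (s : Pts (.cons J p) b d) : motive s :=
  match s with
  | .cons _ b s => cons b s

theorem Interior.not_nil {c d : C.Obj} (m : Interior (.nil C) c d) : False := nomatch m

theorem Interior.not_one {J : EProfunctor B C} {b : B.Obj} {c : C.Obj}
    (m : Interior (.one J) b c) : False := by
  cases m with
  | there _ _ m => exact m.not_nil

theorem Interior.consCases {A : ECategory.{u, v, w, z, x} E} {J : EProfunctor A B}
    {J' : EProfunctor B C} {p : Profs C D}
    {motive : ∀ {a : A.Obj} {d : D.Obj}, Interior (.cons J (.cons J' p)) a d → Prop}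
    (here : ∀ (a : A.Obj) (b b' : B.Obj) {c : C.Obj} {d : D.Obj} (s : Pts p c d),
      motive (.here J J' a b b' s))
    (there : ∀ (a : A.Obj) {b : B.Obj} {d : D.Obj} (m : Interior (.cons J' p) b d),
      motive (.there J a m))
    {a : A.Obj} {d : D.Obj} (m : Interior (.cons J (.cons J' p)) a d) : motive m := by
  cases m with
  | here => exact here _ _ _ _
  | there _ _ m => exact there _ m

theorem Last.not_nil {c d d' : C.Obj} (m : Last (.nil C) c d d') : False := nomatch m

theorem Last.oneCases {J : EProfunctor B C}
    {motive : ∀ {b : B.Obj} {c c' : C.Obj}, Last (.one J) b c c' → Prop}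
    (here : ∀ (b : B.Obj) (c c' : C.Obj), motive (.here J b c c'))
    {b : B.Obj} {c c' : C.Obj} (m : Last (.one J) b c c') : motive m := by
  cases m with
  | here => exact here _ _ _
  | there _ _ m => exact m.not_nil.elim

theorem Last.consCases {A : ECategory.{u, v, w, z, x} E} {J : EProfunctor A B}
    {J' : EProfunctor B C} {p : Profs C D}
    {motive : ∀ {a : A.Obj} {d d' : D.Obj}, Last (.cons J (.cons J' p)) a d d' → Prop}
    (there : ∀ (a : A.Obj) {b : B.Obj} {d d' : D.Obj} (m : Last (.cons J' p) b d d'),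
      motive (.there J a m))
    {a : A.Obj} {d d' : D.Obj} (m : Last (.cons J (.cons J' p)) a d d') : motive m := by
  cases m with
  | there _ _ m => exact there _ m

theorem Pts.whisker_eq_append {B C D D' : ECategory.{u, v, w, z, x} E} {l : Profs B C}
    {p : Profs C D} {r : Profs D D'} {J : EProfunctor C D} {b : B.Obj} {c : C.Obj} {d : D.Obj}
    {d' : D'.Obj} (s₁ : Pts l b c) (s₂ : Pts p c d)
    (μ : Cell s₂.pros (𝟙 _) (𝟙 _) (J.pro c d)) (s₃ : Pts r d d') :
    Pts.whisker s₁ s₂ μ s₃ =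
      (CellPath.ids s₁.pros).append (.cons μ (.ids s₃.pros) (Pts.pros_append s₂ s₃).symm)
        (Pts.pros_append _ _).symm (Pts.pros_append _ (.cons J c s₃)).symm := by
  induction s₁ with
  | nil => rfl
  | cons H b s₁ ih =>
    rw [Pts.whisker, ih]
    exact (CellPath.cons_append _ _ rfl _ _ _ _ _ rfl).symm

end Cases

/-! ### Transposing 2-cells of the equipment to morphisms of profunctors -/

section Transpose

variable {E : Type u} [Category.{v} E] [VirtualEquipment.{u, v, w, z} E]

/-- A profunctor `P : |A| ⇸ |B|` presented by a proarrow `H : A ⇸ B`: equivariant 2-cells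
`P(a, b) → H`, together with a section of the one at the identities. -/
structure Presentation {A B : E} (P : EProfunctor (represent A) (represent B)) (H : Pro A B) where
  /-- the 2-cell `P(a, b) → H` -/
  cell (a : (represent A).Obj) (b : (represent B).Obj) :
    Cell (.one (P.pro a b)) (structArr a) (structArr b) H
  lact_cell (a a' : (represent A).Obj) (b : (represent B).Obj) :
    paste (.single (P.lact a a' b)) (cell a b) (Category.id_comp _) (Category.id_comp _) =
      paste (.pair (homCart a a') (cell a' b) rfl) (unitLact H)
        (Category.comp_id _) (Category.comp_id _)
  ract_cell (a : (represent A).Obj) (b b' : (represent B).Obj) :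
    paste (.single (P.ract a b b')) (cell a b') (Category.id_comp _) (Category.id_comp _) =
      paste (.pair (cell a b) (homCart b b') rfl) (unitRact H)
        (Category.comp_id _) (Category.comp_id _)
  /-- the 2-cell `H → P(id, id)` -/
  sec : Cell (.one H) (𝟙 A) (𝟙 B) (P.pro (idObj A) (idObj B))
  sec_cell : paste (.single sec) (cell (idObj A) (idObj B)) (Category.id_comp _)
    (Category.id_comp _) = idCell H

/-- The presentation of `|H|` by `H`. -/
noncomputable def Presentation.ofPro {A B : E} (H : Pro A B) :
    Presentation (representPro H) H where
  cell := restrictCart H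
  lact_cell := restrictLact_cart H
  ract_cell := restrictRact_cart H
  sec := IsCartesian.lift (restrictCart_isCartesian H (idObj A) (idObj B)) (idCell H)
    (Category.id_comp _) (Category.id_comp _)
  sec_cell := IsCartesian.lift_paste (restrictCart_isCartesian H (idObj A) (idObj B)) _ _ _

/-- The presentation of `J` by `J(id, id)`. -/
noncomputable def Presentation.ofCoreflect {A B : E}
    (J : EProfunctor (represent A) (represent B)) : Presentation J (coreflect J) where
  cell := toId J
  lact_cell := lact_toId J
  ract_cell := ract_toId J
  sec := idCell (coreflect J)
  sec_cell := (id_paste (toId J (idObj A) (idObj B))).trans (toId_idObj J)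

/-- Lists of presentations of profunctors by proarrows. -/
inductive Presentations : {A B : E} → Profs (represent A) (represent B) → Pros A B →
    Type (max u v w z + 1)
  | nil (A : E) : Presentations (.nil (represent A)) (.nil A)
  | cons {A B C : E} {P : EProfunctor (represent A) (represent B)} {H : Pro A B}
      {p : Profs (represent B) (represent C)} {q : Pros B C} (R : Presentation P H)
      (S : Presentations p q) : Presentations (.cons P p) (.cons H q)

namespace Presentations

/-- Concatenation of lists of presentations. -/
noncomputable def append : {A B C : E} → {p : Profs (represent A) (represent B)} → {q : Pros A B} →
    {p' : Profs (represent B) (represent C)} → {q' : Pros B C} → Presentations p q →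
    Presentations p' q' → Presentations (p.append p') (q.append q')
  | _, _, _, _, _, _, _, nil _, S' => S'
  | _, _, _, _, _, _, _, cons R S, S' => cons R (S.append S')

/-- The list of the 2-cells `P(a, b) → H` at a choice of objects. -/
noncomputable def cells : {A B : E} → {p : Profs (represent A) (represent B)} → {q : Pros A B} →
    Presentations p q → {a : (represent A).Obj} → {b : (represent B).Obj} → (s : Pts p a b) →
    CellPath s.pros (structArr a) (structArr b) q
  | _, _, _, _, nil A, _, _, s =>
      Pts.nilCases (motive := fun {a b} s => CellPath s.pros (structArr a) (structArr b) (.nil A))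
        (fun a => .nil (structArr a)) s
  | _, _, _, _, cons (q := q) (H := H) R S, _, _, s =>
      Pts.consCases (motive := fun {a b} s =>
        CellPath s.pros (structArr a) (structArr b) (.cons H q))
        (fun a b _ s => .cons (R.cell a b) (S.cells s) rfl) s

/-- The choice of the identities along a list of presentations. -/
noncomputable def idPts : {A B : E} → {p : Profs (represent A) (represent B)} → {q : Pros A B} →
    Presentations p q → Pts p (idObj A) (idObj B)
  | _, _, _, _, nil A => .nil (idObj A)
  | _, _, _, _, cons (A := A) (P := P) _ S => .cons P (idObj A) S.idPts

/-- The list of the 2-cells `H → P(id, id)`. -/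
noncomputable def secs : {A B : E} → {p : Profs (represent A) (represent B)} → {q : Pros A B} →
    (S : Presentations p q) → CellPath q (𝟙 A) (𝟙 B) S.idPts.pros
  | _, _, _, _, nil A => .nil (𝟙 A)
  | _, _, _, _, cons R S => .cons R.sec S.secs rfl

/-- Every list of proarrows presents a list of profunctors, namely those it represents. -/
theorem exists_ofPros {A B : E} (q : Pros A B) :
    ∃ p : Profs (represent A) (represent B), Nonempty (Presentations p q) := by
  induction q with
  | nil A => exact ⟨.nil _, ⟨.nil A⟩⟩
  | cons H q ih =>
    obtain ⟨p, ⟨S⟩⟩ := ih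
    exact ⟨.cons (representPro H) p, ⟨.cons (.ofPro H) S⟩⟩

theorem secs_cells {A B : E} {p : Profs (represent A) (represent B)} {q : Pros A B}
    (S : Presentations p q) : Stack S.secs (S.cells S.idPts) (.ids q) := by
  induction S with
  | nil A => exact .nil (Category.id_comp (𝟙 A))
  | cons R S ih => exact .cons_single rfl (Category.id_comp _) (Category.id_comp _) R.sec_cell ih

theorem cells_append {A B C : E} {p : Profs (represent A) (represent B)} {q : Pros A B}
    {p' : Profs (represent B) (represent C)} {q' : Pros B C} (S : Presentations p q)
    (S' : Presentations p' q') {a : (represent A).Obj} {b : (represent B).Obj}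
    {c : (represent C).Obj} (s : Pts p a b) (s' : Pts p' b c) :
    (S.append S').cells (s.append s') =
      (S.cells s).append (S'.cells s') (Pts.pros_append s s').symm rfl := by
  induction S with
  | nil A =>
    exact Pts.nilCases (motive := fun {a b} s => ∀ (s' : Pts p' b c),
      ((Presentations.nil A).append S').cells (s.append s') =
        ((Presentations.nil A).cells s).append (S'.cells s') (Pts.pros_append s s').symm rfl)
      (fun _ _ => rfl) s s'
  | cons R S ih =>
    refine Pts.consCases (motive := fun {a b} s => ∀ (s' : Pts p' b c),
      ((Presentations.cons R S).append S').cells (s.append s') =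
        ((Presentations.cons R S).cells s).append (S'.cells s') (Pts.pros_append s s').symm rfl)
      (fun a _ _ s s' => ?_) s s'
    exact (congrArg (fun Γ => CellPath.cons _ Γ rfl) (ih S' s s')).trans
      (CellPath.cons_append _ _ rfl _ _ rfl _ rfl rfl).symm

end Presentations

/-- `unitRact_unitLact` in terms of 2-cells into the two proarrows and the unit between them. -/
theorem paste_unitRact_unitLact {X₀ X A B C Y X₁ X₂ X₃ Y₀ : E} {p₀ : Pros X₀ X₁} {f₀ : X₀ ⟶ X}
    {f₁ : X₁ ⟶ A} {l : Pros X A} (Λ : CellPath p₀ f₀ f₁ l) {p₁ : Pros X₁ X₂} {f₂ : X₂ ⟶ B}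
    {H : Pro A B} (κ : Cell p₁ f₁ f₂ H) {p₂ : Pros X₂ X₃} {f₃ : X₃ ⟶ B}
    (χ : Cell p₂ f₂ f₃ (unitPro B)) {Y₁ : E} {p₃ : Pros X₃ Y₁} {f₄ : Y₁ ⟶ C} {K : Pro B C}
    (κ' : Cell p₃ f₃ f₄ K) {p₄ : Pros Y₁ Y₀} {f₅ : Y₀ ⟶ Y} {r : Pros C Y}
    (Γ : CellPath p₄ f₄ f₅ r) {t₂ : Pros X₂ Y₁} {t₁ : Pros X₁ X₃} {s₃ : Pros X₃ Y₀}
    {s₂ : Pros X₂ Y₀} {s₁ : Pros X₁ Y₀} {t : Pros X₀ Y₀} {m : Pros X Y}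
    (e₂ : p₂.append p₃ = t₂) (e₁ : p₁.append p₂ = t₁) (i₃ : p₃.append p₄ = s₃)
    (i₂ : t₂.append p₄ = s₂) (i₁ : p₁.append s₂ = s₁) (j : t₁.append s₃ = s₁)
    (e : p₀.append s₁ = t) (e' : l.append (.cons H (.cons K r)) = m)
    {Z W : E} {f : X ⟶ Z} {g : Y ⟶ W} {M : Pro Z W} (φ : Cell m f g M) {f' : X₀ ⟶ Z}
    {g' : Y₀ ⟶ W} (hf : f₀ ≫ f = f') (hg : f₅ ≫ g = g') :
    paste (Λ.append (.cons κ (.cons (paste (h := f₂) (k := f₄) (.pair χ κ' e₂) (unitLact K)) Γ i₂)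
        i₁) e e') φ hf hg =
      paste (Λ.append (.cons (paste (h := f₁) (k := f₃) (.pair κ χ e₁) (unitRact H))
        (.cons κ' Γ i₃) j) e e') φ hf hg := by
  have k₂ : p₂.append s₃ = s₂ := by rw [← i₂, ← e₂, ← i₃, ProPath.append_assoc]
  have S₁ : Stack (.cons κ (.cons χ (.cons κ' Γ i₃) k₂) i₁)
      (.cons (idCell H) (.cons (unitLact K) (.ids r) rfl) rfl)
      (.cons κ (.cons (paste (h := f₂) (k := f₄) (.pair χ κ' e₂) (unitLact K)) Γ i₂) i₁) :=
    .cons_single i₁ (by simp) (by simp) (VirtualDoubleCategory.paste_id κ)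
      (.cons_pair _ _ _ _ (by simp) (by simp) rfl (.ids_right Γ))
  have S₂ : Stack (.cons κ (.cons χ (.cons κ' Γ i₃) k₂) i₁)
      (.cons (unitRact H) (.cons (idCell K) (.ids r) rfl) rfl)
      (.cons (paste (h := f₁) (k := f₃) (.pair κ χ e₁) (unitRact H)) (.cons κ' Γ i₃) j) :=
    .cons_pair _ _ _ _ (by simp) (by simp) rfl (.ids_right (.cons κ' Γ i₃))
  refine (((Stack.ids_right Λ).append S₁ e rfl e').paste_paste φ (Category.id_comp f)
    (Category.id_comp g) hf hg hf hg).symm.trans ?_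
  refine (congrArg (fun θ => paste (Λ.append (.cons κ (.cons χ (.cons κ' Γ i₃) k₂) i₁) e rfl) θ
    hf hg) (unitRact_unitLact l H K r e' rfl φ)).trans ?_
  exact ((Stack.ids_right Λ).append S₂ e rfl e').paste_paste φ _ _ hf hg hf hg

/-- `unitRact_paste` in terms of 2-cells into the last proarrow and the unit after it. -/
theorem paste_unitRact_unitHom {X₀ X A B X₁ X₂ X₃ : E} {p₀ : Pros X₀ X₁} {f₀ : X₀ ⟶ X}
    {f₁ : X₁ ⟶ A} {l : Pros X A} (Λ : CellPath p₀ f₀ f₁ l) {p₁ : Pros X₁ X₂} {f₂ : X₂ ⟶ B}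
    {H : Pro A B} (κ : Cell p₁ f₁ f₂ H) {p₂ : Pros X₂ X₃} {f₃ : X₃ ⟶ B}
    (χ : Cell p₂ f₂ f₃ (unitPro B)) {t₁ : Pros X₁ X₃} {t₀ : Pros X₀ X₂} {t : Pros X₀ X₃}
    {m : Pros X B} (e₁ : p₁.append p₂ = t₁) (e : p₀.append t₁ = t) (e₀ : p₀.append p₁ = t₀)
    (i : t₀.append p₂ = t) (e' : l.append (.one H) = m)
    {Z W : E} {f : X ⟶ Z} {g : B ⟶ W} {M : Pro Z W} (φ : Cell m f g M) {f' : X₀ ⟶ Z}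
    {g' : X₂ ⟶ W} {g'' : X₃ ⟶ W} (hf : f₀ ≫ f = f') (hg : f₂ ≫ g = g') (hg' : f₃ ≫ g = g'') :
    paste (Λ.append (.single (paste (h := f₁) (k := f₃) (.pair κ χ e₁) (unitRact H))) e e') φ
        hf hg' =
      paste (.pair (paste (Λ.append (.single κ) e₀ e') φ hf hg)
        (paste (.single χ) (unitHom g) hg hg') i) (unitRact M) (by simp) (by simp) := by
  have n : m.append (.one (unitPro B)) = l.append (.two H (unitPro B)) := by
    rw [← e', ProPath.append_assoc]; rfl
  subst e₁
  have S : Stack (.pair κ χ rfl) (.single (unitRact H))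
      (.single (paste (h := f₁) (k := f₃) (.pair κ χ rfl) (unitRact H))) :=
    .cons_pair _ _ _ _ (by simp) (by simp) rfl (.nil (by simp))
  refine (((Stack.ids_right Λ).append S e rfl e').paste_paste φ (Category.id_comp f)
    (Category.id_comp g) hf hg' hf hg').symm.trans ?_
  refine (congrArg (fun θ => paste (Λ.append (.pair κ χ rfl) e rfl) θ hf hg')
    (unitRact_paste l H e' rfl n φ)).trans ?_
  refine Eq.trans ?_ (paste_pair_paste (Λ.append (.single κ) e₀ e') (.single χ) i n φ (unitHom g)
    (unitRact M) hf hg hg' (by simp) (by simp) (Category.comp_id f) (Category.comp_id g)).symm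
  rw [CellPath.append_assoc (t₂ := p₁.append p₂) (m₂ := .two H (unitPro B)) (e₂ := rfl)
    (e₂' := rfl) (i := e) (i' := rfl)]
  rfl

namespace Presentations

/-- The two interior actions of a morphism law become equal after passing to the presenting
proarrows: on either side, a hom of the middle category acts as a unit. The list `Λ` of 2-cells on
the left makes the statement inductive. -/
theorem interior_cells {A B : E} {p : Profs (represent A) (represent B)} {q : Pros A B}
    (S : Presentations p q) : ∀ {a : (represent A).Obj} {b : (represent B).Obj}
    (m : Interior p a b), ∃ Γ Γ' : CellPath m.pros (structArr a) (structArr b) q,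
      Stack m.actFst (S.cells m.fstPts) Γ ∧ Stack m.actSnd (S.cells m.sndPts) Γ' ∧
      ∀ {X₀ X : E} {p₀ : Pros X₀ ((represent A).ext a)} {f₀ : X₀ ⟶ X} {l : Pros X A}
        (Λ : CellPath p₀ f₀ (structArr a) l) {t : Pros X₀ ((represent B).ext b)} {n : Pros X B}
        (e : p₀.append m.pros = t) (e' : l.append q = n) {Z W : E} {f : X ⟶ Z} {g : B ⟶ W}
        {M : Pro Z W} (φ : Cell n f g M),
        paste (Λ.append Γ e e') φ rfl rfl = paste (Λ.append Γ' e e') φ rfl rfl := by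
  induction S with
  | nil A => exact fun m => m.not_nil.elim
  | @cons A B C P H p q R S ih =>
    cases S with
    | nil => exact fun m => m.not_one.elim
    | @cons _ B' _ P' H' p' q' R' S' =>
      intro a c m
      refine Interior.consCases (motive := fun {a c} m =>
        ∃ Γ Γ' : CellPath m.pros (structArr a) (structArr c) (.cons H (.cons H' q')),
          Stack m.actFst ((Presentations.cons R (.cons R' S')).cells m.fstPts) Γ ∧
          Stack m.actSnd ((Presentations.cons R (.cons R' S')).cells m.sndPts) Γ' ∧
          ∀ {X₀ X : E} {p₀ : Pros X₀ ((represent A).ext a)} {f₀ : X₀ ⟶ X} {l : Pros X A}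
            (Λ : CellPath p₀ f₀ (structArr a) l) {t : Pros X₀ ((represent C).ext c)} {n : Pros X C}
            (e : p₀.append m.pros = t) (e' : l.append (.cons H (.cons H' q')) = n) {Z W : E}
            {f : X ⟶ Z} {g : C ⟶ W} {M : Pro Z W} (φ : Cell n f g M),
            paste (Λ.append Γ e e') φ rfl rfl = paste (Λ.append Γ' e e') φ rfl rfl) ?_ ?_ m
      · intro a y y' d c s
        refine ⟨.cons (R.cell a y) (.cons (paste (.pair (homCart y y') (R'.cell y' d) rfl)
            (unitLact H') (Category.comp_id _) (Category.comp_id _)) (S'.cells s) rfl) rfl,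
          .cons (paste (.pair (R.cell a y) (homCart y y') rfl) (unitRact H)
            (Category.comp_id _) (Category.comp_id _)) (.cons (R'.cell y' d) (S'.cells s) rfl) rfl,
          ?_, ?_, ?_⟩
        · exact .cons_single rfl (Category.id_comp _) (Category.id_comp _) (id_paste _)
            (.cons_single rfl (Category.id_comp _) (Category.id_comp _) (R'.lact_cell y y' d)
              (.ids_left _))
        · exact .cons_single rfl (Category.id_comp _) (Category.id_comp _) (R.ract_cell a y y')
            (.cons_single rfl (Category.id_comp _) (Category.id_comp _) (id_paste _)
              (.ids_left _))
        · intro X₀ X p₀ f₀ l Λ t n e e' Z W f g M φ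
          exact paste_unitRact_unitLact Λ (R.cell a y) (homCart y y') (R'.cell y' d) (S'.cells s)
            rfl rfl rfl rfl rfl rfl e e' φ rfl rfl
      · intro a b c m
        obtain ⟨Γ, Γ', h, h', hΓ⟩ := ih m
        refine ⟨.cons (R.cell a b) Γ rfl, .cons (R.cell a b) Γ' rfl,
          .cons_single rfl (Category.id_comp _) (Category.id_comp _) (id_paste _) h,
          .cons_single rfl (Category.id_comp _) (Category.id_comp _) (id_paste _) h', ?_⟩
        intro X₀ X p₀ f₀ l Λ t n e e' Z W f g M φ
        have e₁ : (p₀.append (.one (P.pro a b))).append m.pros = t := by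
          rw [ProPath.append_assoc]; exact e
        have e₂ : (l.append (.one H)).append (.cons H' q') = n := by
          rw [ProPath.append_assoc]; exact e'
        have hh := hΓ (Λ.append (.single (R.cell a b)) rfl rfl) e₁ e₂ φ
        rwa [CellPath.append_assoc (e₂ := rfl) (e₂' := rfl) (i := e) (i' := e'),
          CellPath.append_assoc (e₂ := rfl) (e₂' := rfl) (i := e) (i' := e')] at hh

/-- After passing to the presenting proarrows, the right action on the last profunctor becomes
that of a unit on the codomain. The list `Λ` of 2-cells on the left makes the statement
inductive. -/
theorem last_cells {A B : E} {p : Profs (represent A) (represent B)} {q : Pros A B}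
    (S : Presentations p q) : ∀ {a : (represent A).Obj} {b b' : (represent B).Obj}
    (m : Last p a b b'), ∃ Γ : CellPath (m.fstPts.pros.append (.one ((represent B).hom b b')))
        (structArr a) (structArr b') q,
      Stack m.act (S.cells m.sndPts) Γ ∧
      ∀ {X₀ X : E} {p₀ : Pros X₀ ((represent A).ext a)} {f₀ : X₀ ⟶ X} {l : Pros X A}
        (Λ : CellPath p₀ f₀ (structArr a) l) {t₀ : Pros X₀ ((represent B).ext b)}
        {t : Pros X₀ ((represent B).ext b')} {n : Pros X B}
        (e : p₀.append (m.fstPts.pros.append (.one ((represent B).hom b b'))) = t)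
        (e₀ : p₀.append m.fstPts.pros = t₀) (i : t₀.append (.one ((represent B).hom b b')) = t)
        (e' : l.append q = n) {Z W : E} {f : X ⟶ Z} {g : B ⟶ W} {M : Pro Z W}
        (φ : Cell n f g M),
        paste (Λ.append Γ e e') φ rfl rfl =
          paste (.pair (paste (Λ.append (S.cells m.fstPts) e₀ e') φ rfl rfl)
            (paste (.single (homCart b b')) (unitHom g) rfl rfl) i) (unitRact M)
            (Category.comp_id _) (Category.comp_id _) := by
  induction S with
  | nil A => exact fun m => m.not_nil.elim
  | @cons A B C P H p q R S ih =>
    cases S with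
    | nil =>
      intro a c c' m
      refine Last.oneCases (motive := fun {a c c'} m =>
        ∃ Γ : CellPath (m.fstPts.pros.append (.one ((represent B).hom c c')))
            (structArr a) (structArr c') (.one H),
          Stack m.act ((Presentations.cons R (.nil B)).cells m.sndPts) Γ ∧
          ∀ {X₀ X : E} {p₀ : Pros X₀ ((represent A).ext a)} {f₀ : X₀ ⟶ X} {l : Pros X A}
            (Λ : CellPath p₀ f₀ (structArr a) l) {t₀ : Pros X₀ ((represent B).ext c)}
            {t : Pros X₀ ((represent B).ext c')} {n : Pros X B}
            (e : p₀.append (m.fstPts.pros.append (.one ((represent B).hom c c'))) = t)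
            (e₀ : p₀.append m.fstPts.pros = t₀)
            (i : t₀.append (.one ((represent B).hom c c')) = t)
            (e' : l.append (.one H) = n) {Z W : E} {f : X ⟶ Z} {g : B ⟶ W} {M : Pro Z W}
            (φ : Cell n f g M),
            paste (Λ.append Γ e e') φ rfl rfl =
              paste (.pair (paste (Λ.append ((Presentations.cons R (.nil B)).cells m.fstPts)
                e₀ e') φ rfl rfl)
                (paste (.single (homCart c c')) (unitHom g) rfl rfl) i) (unitRact M)
                (Category.comp_id _) (Category.comp_id _)) ?_ m
      intro a c c'
      refine ⟨.single (paste (.pair (R.cell a c) (homCart c c') rfl) (unitRact H)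
        (Category.comp_id _) (Category.comp_id _)), ?_, ?_⟩
      · exact .cons_single rfl (Category.id_comp _) (Category.id_comp _) (R.ract_cell a c c')
          (.nil (Category.id_comp _))
      · intro X₀ X p₀ f₀ l Λ t₀ t n e e₀ i e' Z W f g M φ
        exact paste_unitRact_unitHom Λ (R.cell a c) (homCart c c') rfl e e₀ i e' φ rfl rfl rfl
    | @cons _ B' _ P' H' p' q' R' S' =>
      intro a c c' m
      refine Last.consCases (motive := fun {a c c'} m =>
        ∃ Γ : CellPath (m.fstPts.pros.append (.one ((represent C).hom c c')))
            (structArr a) (structArr c') (.cons H (.cons H' q')),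
          Stack m.act ((Presentations.cons R (.cons R' S')).cells m.sndPts) Γ ∧
          ∀ {X₀ X : E} {p₀ : Pros X₀ ((represent A).ext a)} {f₀ : X₀ ⟶ X} {l : Pros X A}
            (Λ : CellPath p₀ f₀ (structArr a) l) {t₀ : Pros X₀ ((represent C).ext c)}
            {t : Pros X₀ ((represent C).ext c')} {n : Pros X C}
            (e : p₀.append (m.fstPts.pros.append (.one ((represent C).hom c c'))) = t)
            (e₀ : p₀.append m.fstPts.pros = t₀)
            (i : t₀.append (.one ((represent C).hom c c')) = t)
            (e' : l.append (.cons H (.cons H' q')) = n) {Z W : E} {f : X ⟶ Z} {g : C ⟶ W}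
            {M : Pro Z W} (φ : Cell n f g M),
            paste (Λ.append Γ e e') φ rfl rfl =
              paste (.pair (paste (Λ.append
                ((Presentations.cons R (.cons R' S')).cells m.fstPts) e₀ e') φ rfl rfl)
                (paste (.single (homCart c c')) (unitHom g) rfl rfl) i) (unitRact M)
                (Category.comp_id _) (Category.comp_id _)) ?_ m
      intro a b c c' m
      obtain ⟨Γ, h, hΓ⟩ := ih m
      refine ⟨.cons (R.cell a b) Γ rfl,
        .cons_single rfl (Category.id_comp _) (Category.id_comp _) (id_paste _) h, ?_⟩
      intro X₀ X p₀ f₀ l Λ t₀ t n e e₀ i e' Z W f g M φ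
      have e₁ : (p₀.append (.one (P.pro a b))).append
          (m.fstPts.pros.append (.one ((represent C).hom c c'))) = t := by
        rw [ProPath.append_assoc]; exact e
      have e₂ : (l.append (.one H)).append (.cons H' q') = n := by
        rw [ProPath.append_assoc]; exact e'
      have e₃ : (p₀.append (.one (P.pro a b))).append m.fstPts.pros = t₀ := by
        rw [ProPath.append_assoc]; exact e₀
      have hh := hΓ (Λ.append (.single (R.cell a b)) rfl rfl) e₁ e₃ i e₂ φ
      exact ((congrArg (fun Ξ => paste Ξ φ rfl rfl) (CellPath.append_assoc Λ
        (.single (R.cell a b)) Γ rfl rfl rfl rfl e₁ e₂ e e')).symm.trans hh).trans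
        (congrArg (fun Ξ => paste (.pair (paste Ξ φ rfl rfl)
          (paste (.single (homCart c c')) (unitHom g) rfl rfl) i) (unitRact M)
          (Category.comp_id _) (Category.comp_id _)) (CellPath.append_assoc Λ
          (.single (R.cell a b)) ((Presentations.cons R' S').cells m.fstPts)
          rfl rfl rfl rfl e₃ e₂ e₀ e'))

variable {A B Z W : E} {p : Profs (represent A) (represent B)} {q : Pros A B}
  {f : A ⟶ Z} {g : B ⟶ W} {M : Pro Z W}

/-- The components of the transpose of a 2-cell `φ : H₁, …, H_k → M`: the factorizations of
`P₁(a₀, a₁), …, P_k(a_{k-1}, a_k) → M` through the restrictions of `M`. -/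
noncomputable def transposeApp (S : Presentations p q) (φ : Cell q f g M) :
    ProfFamily p (representHom f) (representHom g) (representPro M) := fun a b s =>
  IsCartesian.lift (restrictCart_isCartesian M (postObj f a) (postObj g b))
    (paste (S.cells s) φ rfl rfl) (Category.id_comp _) (Category.id_comp _)

theorem transposeApp_cart (S : Presentations p q) (φ : Cell q f g M) {a : (represent A).Obj}
    {b : (represent B).Obj} (s : Pts p a b) :
    paste (.single (S.transposeApp φ a b s)) (restrictCart M (postObj f a) (postObj g b))
      (Category.id_comp _) (Category.id_comp _) = paste (S.cells s) φ rfl rfl :=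
  IsCartesian.lift_paste (restrictCart_isCartesian M (postObj f a) (postObj g b)) _ _ _

end Presentations

/-- `unitLact_paste` in terms of 2-cells into the first proarrow and the unit before it. -/
theorem paste_unitLact_unitHom {X₁ X₂ X₃ X₄ A B Y : E} {p₁ : Pros X₁ X₂} {f₁ : X₁ ⟶ A}
    {f₂ : X₂ ⟶ A} (χ : Cell p₁ f₁ f₂ (unitPro A)) {p₂ : Pros X₂ X₃} {f₃ : X₃ ⟶ B} {H : Pro A B}
    (κ : Cell p₂ f₂ f₃ H) {p₃ : Pros X₃ X₄} {f₄ : X₄ ⟶ Y} {r : Pros B Y}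
    (Γ : CellPath p₃ f₃ f₄ r) {t : Pros X₁ X₃} {s : Pros X₂ X₄} {n : Pros X₁ X₄}
    (e : p₁.append p₂ = t) (i : t.append p₃ = n) (j : p₂.append p₃ = s) (k : p₁.append s = n)
    {Z W : E} {f : A ⟶ Z} {g : Y ⟶ W} {M : Pro Z W} (φ : Cell (.cons H r) f g M) {f' : X₁ ⟶ Z}
    {f'' : X₂ ⟶ Z} {g' : X₄ ⟶ W} (hf : f₁ ≫ f = f') (hf' : f₂ ≫ f = f'') (hg : f₄ ≫ g = g') :
    paste (.cons (paste (h := f₁) (k := f₃) (.pair χ κ e) (unitLact H)) Γ i) φ hf hg =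
      paste (.pair (paste (.single χ) (unitHom f) hf hf') (paste (.cons κ Γ j) φ hf' hg) k)
        (unitLact M) (Category.comp_id _) (Category.comp_id _) := by
  have S : Stack (.cons χ (.cons κ Γ j) k) (.cons (unitLact H) (.ids r) rfl)
      (.cons (paste (h := f₁) (k := f₃) (.pair χ κ e) (unitLact H)) Γ i) :=
    .cons_pair _ _ _ _ (by simp) (by simp) rfl (.ids_right Γ)
  refine (S.paste_paste φ (Category.id_comp f) (Category.id_comp g) hf hg hf hg).symm.trans ?_
  refine (congrArg (fun θ => paste (.cons χ (.cons κ Γ j) k) θ hf hg)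
    (unitLact_paste H r φ)).trans ?_
  exact (paste_pair_paste (.single χ) (.cons κ Γ j) k rfl (unitHom f) φ (unitLact M) hf hf' hg
    (Category.comp_id _) (Category.comp_id _) (Category.comp_id f) (Category.comp_id g)).symm

namespace Presentations

variable {A B Z W : E} {p : Profs (represent A) (represent B)} {q : Pros A B}
  {f : A ⟶ Z} {g : B ⟶ W} {M : Pro Z W}

theorem transposeApp_interior (S : Presentations p q) (φ : Cell q f g M)
    {a : (represent A).Obj} {b : (represent B).Obj} (m : Interior p a b) :
    paste m.actFst (S.transposeApp φ a b m.fstPts) (Category.id_comp _) (Category.id_comp _) =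
      paste m.actSnd (S.transposeApp φ a b m.sndPts) (Category.id_comp _) (Category.id_comp _) := by
  obtain ⟨Γ, Γ', h, h', hΓ⟩ := S.interior_cells m
  refine IsCartesian.hom_ext (restrictCart_isCartesian M (postObj f a) (postObj g b))
    (Category.id_comp _) (Category.id_comp _) ?_
  refine (paste_single_paste m.actFst (S.transposeApp φ a b m.fstPts)
    (restrictCart M (postObj f a) (postObj g b)) _ _ _ _ (Category.id_comp _)
    (Category.id_comp _)).trans ?_
  refine Eq.trans ?_ (paste_single_paste m.actSnd (S.transposeApp φ a b m.sndPts)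
    (restrictCart M (postObj f a) (postObj g b)) _ _ _ _ (Category.id_comp _)
    (Category.id_comp _)).symm
  refine (congrArg (fun θ => paste m.actFst θ (Category.id_comp _) (Category.id_comp _))
    (S.transposeApp_cart φ m.fstPts)).trans ?_
  refine Eq.trans ?_ (congrArg (fun θ => paste m.actSnd θ (Category.id_comp _)
    (Category.id_comp _)) (S.transposeApp_cart φ m.sndPts)).symm
  exact (h.paste_paste φ _ _ _ _ rfl rfl).trans ((hΓ (.nil (structArr a)) rfl rfl φ).trans
    (h'.paste_paste φ _ _ _ _ rfl rfl).symm)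

theorem transposeApp_left (S : Presentations p q) (φ : Cell q f g M) :
    (S.transposeApp φ).LeftLaw := by
  cases S with
  | nil =>
    intro a a'
    refine IsCartesian.hom_ext (restrictCart_isCartesian M (postObj f a) (postObj g a'))
      (Category.id_comp _) (Category.id_comp _) ?_
    refine (paste_restrictLact (a := postObj f a) (a' := postObj f a') (b := postObj g a')
      (postMap f (structArr a) (structArr a'))
      ((Presentations.nil A).transposeApp φ a' a' (.nil a')) rfl (Category.id_comp _)
      (Category.id_comp _) (Category.id_comp _)).trans ?_
    refine Eq.trans ?_ (paste_restrictRact (a := postObj f a) (b := postObj g a)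
      (b' := postObj g a') ((Presentations.nil A).transposeApp φ a a (.nil a))
      (postMap g (structArr a) (structArr a')) rfl (Category.id_comp _)
      (Category.id_comp _) (Category.id_comp _)).symm
    refine (congrArg₂ (fun θ θ' => paste (.pair θ θ' rfl) (unitLact M) (Category.comp_id _)
      (Category.comp_id _)) (postMap_cart f (structArr a) (structArr a'))
      ((Presentations.nil A).transposeApp_cart φ (.nil a'))).trans ?_
    refine Eq.trans ?_ (congrArg₂ (fun θ θ' => paste (.pair θ θ' rfl) (unitRact M)
      (Category.comp_id _) (Category.comp_id _))
      ((Presentations.nil A).transposeApp_cart φ (.nil a))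
      (postMap_cart g (structArr a) (structArr a'))).symm
    refine (paste_pair_paste (.single (homCart a a')) (.nil (structArr a')) rfl rfl (unitHom f) φ
      (unitLact M) rfl rfl rfl (Category.comp_id _) (Category.comp_id _) (Category.comp_id f)
      (Category.comp_id g)).trans ?_
    refine Eq.trans ?_ (paste_pair_paste (.nil (structArr a)) (.single (homCart a a')) rfl rfl φ
      (unitHom g) (unitRact M) rfl rfl rfl (Category.comp_id _) (Category.comp_id _)
      (Category.comp_id f) (Category.comp_id g)).symm
    exact congrArg (fun θ => paste (.single (homCart a a')) θ rfl rfl) (unitLact_unitRact_nil φ)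
  | @cons _ B' _ P H p' q' R S =>
    intro a a' b b' s
    refine IsCartesian.hom_ext (restrictCart_isCartesian M (postObj f a) (postObj g b'))
      (Category.id_comp _) (Category.id_comp _) ?_
    refine Eq.trans ?_ (paste_restrictLact (a := postObj f a) (a' := postObj f a')
      (b := postObj g b') (postMap f (structArr a) (structArr a'))
      ((Presentations.cons R S).transposeApp φ a' b' (.cons P a' s)) rfl (Category.id_comp _)
      (Category.id_comp _) (Category.id_comp _)).symm
    refine Eq.trans ?_ (congrArg₂ (fun θ θ' => paste (.pair θ θ' rfl) (unitLact M)
      (Category.comp_id _) (Category.comp_id _)) (postMap_cart f (structArr a) (structArr a'))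
      ((Presentations.cons R S).transposeApp_cart φ (.cons P a' s))).symm
    refine (paste_single_paste (.cons (P.lact a a' b) (.ids s.pros) rfl)
      ((Presentations.cons R S).transposeApp φ a b' (.cons P a s))
      (restrictCart M (postObj f a) (postObj g b')) (Category.id_comp _) (Category.id_comp _)
      _ _ (Category.id_comp _) (Category.id_comp _)).trans ?_
    refine (congrArg (fun θ => paste (.cons (P.lact a a' b) (.ids s.pros) rfl) θ
      (Category.id_comp _) (Category.id_comp _))
      ((Presentations.cons R S).transposeApp_cart φ (.cons P a s))).trans ?_
    have T : Stack (.cons (P.lact a a' b) (.ids s.pros) rfl)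
        ((Presentations.cons R S).cells (.cons P a s))
        (.cons (paste (.pair (homCart a a') (R.cell a' b) rfl) (unitLact H) (Category.comp_id _)
          (Category.comp_id _)) (S.cells s) rfl) :=
      .cons_single rfl (Category.id_comp _) (Category.id_comp _) (R.lact_cell a a' b)
        (.ids_left _)
    refine (T.paste_paste φ _ _ _ _ rfl rfl).trans ?_
    exact paste_unitLact_unitHom (homCart a a') (R.cell a' b) (S.cells s) rfl rfl rfl rfl φ
      rfl rfl rfl

theorem transposeApp_right (S : Presentations p q) (φ : Cell q f g M)
    {a : (represent A).Obj} {b b' : (represent B).Obj} (m : Last p a b b') :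
    paste m.act (S.transposeApp φ a b' m.sndPts) (Category.id_comp _) (Category.id_comp _) =
      paste (.pair (S.transposeApp φ a b m.fstPts) (postMap g (structArr b) (structArr b')) rfl)
        (restrictRact M (postObj f a) (postObj g b) (postObj g b')) (Category.id_comp _)
        (Category.id_comp _) := by
  obtain ⟨Γ, h, hΓ⟩ := S.last_cells m
  refine IsCartesian.hom_ext (restrictCart_isCartesian M (postObj f a) (postObj g b'))
    (Category.id_comp _) (Category.id_comp _) ?_
  refine Eq.trans ?_ (paste_restrictRact (a := postObj f a) (b := postObj g b)
    (b' := postObj g b') (S.transposeApp φ a b m.fstPts)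
    (postMap g (structArr b) (structArr b')) rfl (Category.id_comp _)
    (Category.id_comp _) (Category.id_comp _)).symm
  refine Eq.trans ?_ (congrArg₂ (fun θ θ' => paste (.pair θ θ' rfl) (unitRact M)
    (Category.comp_id _) (Category.comp_id _)) (S.transposeApp_cart φ m.fstPts)
    (postMap_cart g (structArr b) (structArr b'))).symm
  refine (paste_single_paste m.act (S.transposeApp φ a b' m.sndPts)
    (restrictCart M (postObj f a) (postObj g b')) _ _ _ _ (Category.id_comp _)
    (Category.id_comp _)).trans ?_
  refine (congrArg (fun θ => paste m.act θ (Category.id_comp _) (Category.id_comp _))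
    (S.transposeApp_cart φ m.sndPts)).trans ?_
  exact (h.paste_paste φ _ _ _ _ rfl rfl).trans
    (hΓ (.nil (structArr a)) rfl rfl rfl rfl φ)

/-- The transpose of a 2-cell `φ : H₁, …, H_k → M` of the equipment: the morphism
`P₁, …, P_k → |M|` of profunctors whose components restrict `φ`. -/
noncomputable def transpose (S : Presentations p q) (φ : Cell q f g M) :
    ProfMor p (representHom f) (representHom g) (representPro M) where
  app := S.transposeApp φ
  interior m := S.transposeApp_interior φ m
  left := S.transposeApp_left φ
  right m := S.transposeApp_right φ m

end Presentations

end Transpose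

/-! ### Composites of profunctors between represented categories -/

section Composites

variable {E : Type u} [Category.{v} E] [VirtualEquipment.{u, v, w, z} E]

/-- If `μ` exhibits `L` as the composite of `J` and `K`, then the component of `μ` at the identities
exhibits `L(id, id)` as the composite of `J(id, id)` and `K(id, id)`. -/
theorem coreflectMor_isComposite {A B C : E} {J : EProfunctor (represent A) (represent B)}
    {K : EProfunctor (represent B) (represent C)} {L : EProfunctor (represent A) (represent C)}
    {μ : ProfMor (.two J K) (EFunctor.id _) (EFunctor.id _) L} (hμ : IsProfComposite μ) :
    IsComposite (coreflectMor μ) := by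
  intro X Y Z W l r f g M φ
  obtain ⟨l', ⟨Sl⟩⟩ := Presentations.exists_ofPros l
  obtain ⟨r', ⟨Sr⟩⟩ := Presentations.exists_ofPros r
  let SJK : Presentations (l'.append ((ProPath.two J K).append r'))
      (l.append ((ProPath.two (coreflect J) (coreflect K)).append r)) :=
    Sl.append (.cons (.ofCoreflect J) (.cons (.ofCoreflect K) Sr))
  let SL : Presentations (l'.append (.cons L r')) (l.append (.cons (coreflect L) r)) :=
    Sl.append (.cons (.ofCoreflect L) Sr)
  have hJK : ∀ (a : (represent X).Obj) (b : (represent A).Obj) (c : (represent B).Obj)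
      (d : (represent C).Obj) (e : (represent Y).Obj) (s₁ : Pts l' a b) (s₃ : Pts r' d e),
      SJK.cells (s₁.append ((Pts.cons J b (.cons K c (.nil d))).append s₃)) =
        (Sl.cells s₁).append (.cons (toId J b c) (.cons (toId K c d) (Sr.cells s₃) rfl) rfl)
          (Pts.pros_append s₁ (.cons J b (.cons K c s₃))).symm rfl := fun a b c d e s₁ s₃ =>
    Sl.cells_append (.cons (.ofCoreflect J) (.cons (.ofCoreflect K) Sr)) s₁
      (.cons J b (.cons K c s₃))
  have hL : ∀ (a : (represent X).Obj) (b : (represent A).Obj)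
      (d : (represent C).Obj) (e : (represent Y).Obj) (s₁ : Pts l' a b) (s₃ : Pts r' d e),
      SL.cells (s₁.append (.cons L b s₃)) =
        (Sl.cells s₁).append (.cons (toId L b d) (Sr.cells s₃) rfl)
          (Pts.pros_append s₁ (.cons L b s₃)).symm rfl := fun a b d e s₁ s₃ =>
    Sl.cells_append (.cons (.ofCoreflect L) Sr) s₁ (.cons L b s₃)
  -- the components of `μ` at arbitrary objects, compared with the one at the identities
  have square : ∀ (a : (represent X).Obj) (b : (represent A).Obj) (d : (represent C).Obj)
      (e : (represent Y).Obj) (s₁ : Pts l' a b) (s₂ : Pts (.two J K) b d) (s₃ : Pts r' d e),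
      ∃ Θ : CellPath (s₁.append (s₂.append s₃)).pros (structArr a) (structArr e)
          (l.append (.cons (coreflect L) r)),
        Stack (Pts.whisker s₁ s₂ (μ.app b d s₂) s₃) (SL.cells (s₁.append (.cons L b s₃))) Θ ∧
        Stack (SJK.cells (s₁.append (s₂.append s₃))) (CellPath.whisker l (coreflectMor μ) r) Θ := by
    intro a b d e s₁ s₂
    refine Pts.consCases (motive := fun {b d} s₂ => ∀ (s₁ : Pts l' a b) (s₃ : Pts r' d e),
      ∃ Θ : CellPath (s₁.append (s₂.append s₃)).pros (structArr a) (structArr e)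
          (l.append (.cons (coreflect L) r)),
        Stack (Pts.whisker s₁ s₂ (μ.app b d s₂) s₃) (SL.cells (s₁.append (.cons L b s₃))) Θ ∧
        Stack (SJK.cells (s₁.append (s₂.append s₃))) (CellPath.whisker l (coreflectMor μ) r) Θ)
      (fun b c d t s₁ => ?_) s₂ s₁
    refine Pts.consCases (motive := fun {c d} t => ∀ (s₃ : Pts r' d e),
      ∃ Θ : CellPath (s₁.append ((Pts.cons J b t).append s₃)).pros (structArr a) (structArr e)
          (l.append (.cons (coreflect L) r)),
        Stack (Pts.whisker s₁ (.cons J b t) (μ.app b d (.cons J b t)) s₃)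
          (SL.cells (s₁.append (.cons L b s₃))) Θ ∧
        Stack (SJK.cells (s₁.append ((Pts.cons J b t).append s₃)))
          (CellPath.whisker l (coreflectMor μ) r) Θ) (fun c d d' t => ?_) t
    refine Pts.nilCases (motive := fun {d d'} t => ∀ (s₃ : Pts r' d' e),
      ∃ Θ : CellPath (s₁.append ((Pts.cons J b (.cons K c t)).append s₃)).pros (structArr a)
          (structArr e) (l.append (.cons (coreflect L) r)),
        Stack (Pts.whisker s₁ (.cons J b (.cons K c t))
            (μ.app b d' (.cons J b (.cons K c t))) s₃)
          (SL.cells (s₁.append (.cons L b s₃))) Θ ∧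
        Stack (SJK.cells (s₁.append ((Pts.cons J b (.cons K c t)).append s₃)))
          (CellPath.whisker l (coreflectMor μ) r) Θ) (fun d s₃ => ?_) t
    refine ⟨(Sl.cells s₁).append (.cons (paste (.single (μ.app₂ b c d)) (toId L b d)
      (Category.id_comp _) (Category.id_comp _)) (Sr.cells s₃) rfl)
      (Pts.pros_append s₁ (.cons J b (.cons K c s₃))).symm rfl, ?_, ?_⟩
    · refine (congrArg₂ (fun Γ Δ => Stack Γ Δ _) (Pts.whisker_eq_append (J := L) s₁
        (.cons J b (.cons K c (.nil d))) (μ.app₂ b c d) s₃) (hL a b d e s₁ s₃)).mpr ?_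
      exact (Stack.ids_left (Sl.cells s₁)).append (.cons_single rfl (Category.id_comp _)
        (Category.id_comp _) rfl (.ids_left (Sr.cells s₃))) _ _ _
    · refine (congrArg₂ (fun Γ Δ => Stack Γ Δ _) (hJK a b c d e s₁ s₃)
        (CellPath.whisker_eq_append l (coreflectMor μ) r)).mpr ?_
      exact (Stack.ids_right (Sl.cells s₁)).append (.cons_pair rfl rfl rfl rfl
        (Category.comp_id _) (Category.comp_id _) (μ.app₂_toId b c d).symm
        (.ids_right (Sr.cells s₃))) _ _ _
  -- the identities along the lists, and the sections of the presentations there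
  let sl := Sl.idPts
  let sr := Sr.idPts
  let sJK : Pts (.two J K) (idObj A) (idObj C) :=
    .cons J (idObj A) (.cons K (idObj B) (.nil (idObj C)))
  let secJK : CellPath (l.append ((ProPath.two (coreflect J) (coreflect K)).append r)) (𝟙 X) (𝟙 Y)
      (sl.append (sJK.append sr)).pros :=
    Sl.secs.append (.cons (idCell (coreflect J)) (.cons (idCell (coreflect K)) Sr.secs rfl) rfl) rfl
      (Pts.pros_append sl (sJK.append sr)).symm
  let secL : CellPath (l.append (.cons (coreflect L) r)) (𝟙 X) (𝟙 Y)
      (sl.append (.cons L (idObj A) sr)).pros :=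
    Sl.secs.append (.cons (idCell (coreflect L)) Sr.secs rfl) rfl
      (Pts.pros_append sl (.cons L (idObj A) sr)).symm
  have ids_μ : paste (.pair (idCell (coreflect J)) (idCell (coreflect K)) rfl) (coreflectMor μ)
      (Category.id_comp _) (Category.id_comp _) = coreflectMor μ :=
    VirtualDoubleCategory.ids_paste _
  have sec_whisker : ∃ Θ : CellPath (l.append ((ProPath.two (coreflect J)
      (coreflect K)).append r)) (𝟙 X) (𝟙 Y) (sl.append (.cons L (idObj A) sr)).pros,
      Stack secJK (Pts.whisker sl sJK (μ.app (idObj A) (idObj C) sJK) sr) Θ ∧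
      Stack (CellPath.whisker l (coreflectMor μ) r) secL Θ := by
    refine ⟨Sl.secs.append (.cons (coreflectMor μ) Sr.secs rfl) rfl
      (Pts.pros_append sl (.cons L (idObj A) sr)).symm, ?_, ?_⟩
    · refine (congrArg (fun Γ => Stack secJK Γ _) (Pts.whisker_eq_append (J := L) sl sJK
        (coreflectMor μ) sr)).mpr ?_
      exact (Stack.ids_right Sl.secs).append (.cons_pair rfl rfl rfl rfl (Category.id_comp _)
        (Category.id_comp _) ids_μ (.ids_right Sr.secs)) _ _ _
    · rw [CellPath.whisker_eq_append]
      exact (Stack.ids_left Sl.secs).append (.cons_single rfl (Category.id_comp _)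
        (Category.id_comp _) (VirtualDoubleCategory.paste_id _) (.ids_left Sr.secs)) _ _ _
  have secJK_cells : Stack secJK (SJK.cells (sl.append (sJK.append sr))) (.ids _) := by
    rw [hJK, CellPath.ids_append]
    exact Sl.secs_cells.append (.cons_single rfl (Category.id_comp _) (Category.id_comp _)
      (Presentation.ofCoreflect J).sec_cell (.cons_single rfl (Category.id_comp _)
      (Category.id_comp _) (Presentation.ofCoreflect K).sec_cell Sr.secs_cells)) _ _ _
  have secL_cells : Stack secL (SL.cells (sl.append (.cons L (idObj A) sr))) (.ids _) := by
    rw [hL, CellPath.ids_append]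
    exact Sl.secs_cells.append (.cons_single rfl (Category.id_comp _) (Category.id_comp _)
      (Presentation.ofCoreflect L).sec_cell Sr.secs_cells) _ _ _
  -- transposition turns precomposition with the component at the identities into
  -- precomposition with `μ`
  have transpose_whisker : ∀ (ψ : Cell (l.append (.cons (coreflect L) r)) f g M)
      (a : (represent X).Obj) (b : (represent A).Obj) (d : (represent C).Obj)
      (e : (represent Y).Obj) (s₁ : Pts l' a b) (s₂ : Pts (.two J K) b d) (s₃ : Pts r' d e),
      paste (Pts.whisker s₁ s₂ (μ.app b d s₂) s₃)
          ((SL.transpose ψ).app a e (s₁.append (.cons L b s₃))) (Category.id_comp _)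
          (Category.id_comp _) =
        (SJK.transpose (paste (CellPath.whisker l (coreflectMor μ) r) ψ (Category.id_comp f)
          (Category.id_comp g))).app a e (s₁.append (s₂.append s₃)) := by
    intro ψ a b d e s₁ s₂ s₃
    obtain ⟨Θ, h, h'⟩ := square a b d e s₁ s₂ s₃
    refine IsCartesian.hom_ext (restrictCart_isCartesian M (postObj f a) (postObj g e))
      (Category.id_comp _) (Category.id_comp _) ?_
    refine (paste_single_paste _ (SL.transposeApp ψ a e (s₁.append (.cons L b s₃)))
      (restrictCart M (postObj f a) (postObj g e)) _ _ _ _ (Category.id_comp _)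
      (Category.id_comp _)).trans ?_
    refine (congrArg (fun θ => paste (Pts.whisker s₁ s₂ (μ.app b d s₂) s₃) θ
      (Category.id_comp _) (Category.id_comp _)) (SL.transposeApp_cart ψ _)).trans ?_
    refine Eq.trans ?_ (SJK.transposeApp_cart _ _).symm
    exact (h.paste_paste ψ _ _ _ _ rfl rfl).trans (h'.paste_paste ψ _ _ _ _ rfl rfl).symm
  have inj : ∀ ψ ψ' : Cell (l.append (.cons (coreflect L) r)) f g M,
      paste (CellPath.whisker l (coreflectMor μ) r) ψ (Category.id_comp f) (Category.id_comp g) =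
        paste (CellPath.whisker l (coreflectMor μ) r) ψ' (Category.id_comp f)
          (Category.id_comp g) → ψ = ψ' := by
    intro ψ ψ' h
    have hΨ : SL.transpose ψ = SL.transpose ψ' :=
      (hμ l' r' (representHom f) (representHom g) (representPro M) (SJK.transpose
        (paste (CellPath.whisker l (coreflectMor μ) r) ψ (Category.id_comp f)
          (Category.id_comp g)))).unique (transpose_whisker ψ)
        (by rw [h]; exact transpose_whisker ψ')
    -- a 2-cell is recovered from the component of its transpose at the identities
    have recover : ∀ θ : Cell (l.append (.cons (coreflect L) r)) f g M,
        paste secL (paste (.single ((SL.transpose θ).app (idObj X) (idObj Y)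
          (sl.append (.cons L (idObj A) sr)))) (restrictCart M (postObj f (idObj X))
          (postObj g (idObj Y))) (Category.id_comp (𝟙 X ≫ f)) (Category.id_comp (𝟙 Y ≫ g)))
          ((Category.id_comp _).trans (Category.id_comp f))
          ((Category.id_comp _).trans (Category.id_comp g)) = θ := by
      intro θ
      refine (congrArg (fun ξ => paste secL ξ _ _) (SL.transposeApp_cart θ _)).trans ?_
      exact (secL_cells.paste_paste θ _ _ _ _ (Category.id_comp f) (Category.id_comp g)).trans
        (VirtualDoubleCategory.ids_paste θ)
    rw [← recover ψ, hΨ, recover ψ']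
  -- the factorization is the component at the identities of the factorization of the transpose
  obtain ⟨Ψ, hΨ, -⟩ := hμ l' r' (representHom f) (representHom g) (representPro M)
    (SJK.transpose φ)
  refine existsUnique_of_exists_of_unique ⟨paste secL (paste (.single (Ψ.app (idObj X) (idObj Y)
      (sl.append (.cons L (idObj A) sr)))) (restrictCart M (postObj f (idObj X))
      (postObj g (idObj Y))) (Category.id_comp (𝟙 X ≫ f)) (Category.id_comp (𝟙 Y ≫ g)))
      ((Category.id_comp _).trans (Category.id_comp f))
      ((Category.id_comp _).trans (Category.id_comp g)), ?_⟩
    fun ψ ψ' h h' => inj ψ ψ' (h.trans h'.symm)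
  obtain ⟨Θ, h, h'⟩ := sec_whisker
  refine (h'.paste_paste _ _ _ (Category.id_comp f) (Category.id_comp g)
    ((Category.id_comp _).trans (Category.id_comp f))
    ((Category.id_comp _).trans (Category.id_comp g))).trans ?_
  refine (h.paste_paste _ (Category.id_comp (𝟙 X ≫ f)) (Category.id_comp (𝟙 Y ≫ g))
    ((Category.id_comp _).trans (Category.id_comp f))
    ((Category.id_comp _).trans (Category.id_comp g)) _ _).symm.trans ?_
  have hφ := (paste_single_paste _ (Ψ.app (idObj X) (idObj Y) (sl.append (.cons L (idObj A) sr)))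
    (restrictCart M (postObj f (idObj X)) (postObj g (idObj Y))) (Category.id_comp _)
    (Category.id_comp _) (Category.id_comp _) (Category.id_comp _) (Category.id_comp _)
    (Category.id_comp _)).symm.trans ((congrArg (fun θ => paste (.single θ)
    (restrictCart M (postObj f (idObj X)) (postObj g (idObj Y))) (Category.id_comp _)
    (Category.id_comp _)) (hΨ (idObj X) (idObj A) (idObj C) (idObj Y) sl sJK sr)).trans
    (SJK.transposeApp_cart φ _))
  refine (congrArg (fun θ => paste secJK θ _ _) hφ).trans ?_
  exact (secJK_cells.paste_paste φ _ _ _ _ (Category.id_comp f) (Category.id_comp g)).trans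
    (VirtualDoubleCategory.ids_paste φ)

end Composites

theorem mainTheorem3 {E : Type u} [Category.{v} E] [VirtualEquipment.{u, v, w, z} E] (A B C : E)
    (J : EProfunctor (represent A) (represent B)) (K : EProfunctor (represent B) (represent C))
    (L : EProfunctor (represent A) (represent C))
    (μ : ProfMor (.two J K) (EFunctor.id _) (EFunctor.id _) L)
    (hμ : IsProfComposite μ) :
    IsComposite (coreflectMor μ) ∧
      ∀ (P : Pro A C) (ν : Cell (.two (coreflect J) (coreflect K)) (𝟙 A) (𝟙 C) P),
        IsComposite ν →
          ∃ i : ProIso P (coreflect L), paste (.single ν) i.hom = coreflectMor μ :=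
  ⟨coreflectMor_isComposite hμ, fun _ _ hν =>
    IsComposite.exists_proIso hν (coreflectMor_isComposite hμ)⟩
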